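/- Let $X$ be a real Banach space with separable dual $X^*$. All sequences $(E_j),(F_j),(n_k),(Z_k)$ below are numbered from $1$, and $E_0=\{0\}$, $F_0=\{0\}$, $n_0=0$. **Definitions.** A sequence $(E_j)$ of finite dimensional subspaces of a Banach space $V$ is an *FMD* (finite dimensional Markushevich decomposition) of $V$ if $\operatorname{span}(E_j:j)$ is dense in $V$, $E_k\cap\overline{\operatorname{span}}(E_j:j\ne k)=\{0\}$ for all $k$, and the biorthogonal sequence $F_k=\{f\in V^*: f|_{E_j}=0 \text{ for all } j\neq k\}$ separates the points of $V$. It is *shrinking* if $\operatorname{span}(F_k:k)$ is norm dense in $V^*$. It is an *FDD* if every $v\in V$ has a unique expansion $v=\sum_j v_j$ with $v_j\in E_j$. It is *unconditional* if there is $C<\infty$ with $\|\sum_j\sigma_jv_j\|\le C$ (the series being convergent) whenever $\sigma_j=\pm1$, $v_j\in E_j$ and $\|\sum_j v_j\|\le1$. A sequence $(y_i)$ of non-zero vectors is *unconditional* if for some $C$, $\|\sum_i\sigma_ia_iy_i\|\le C\|\sum_i a_iy_i\|$ for all finitely supported real $(a_i)$ and all signs $\sigma_i=\pm1$. The space $X$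 has the *$w^*$-Unconditional Tree Property* if for every family $(x_t)$ of norm-one elements of $X^*$, indexed by the finite subsets $t$ of $\mathbb N$, such that $(x_{t\cup\{k\}})_{k>\max t}$ is $w^*$-null for every $t$, there are $k_1<k_2<\cdots$ such that the sequence $(x_{\{k_1,\dots,k_i\}})_{i\ge1}$ is unconditional. **Construction of $Z$.** Let $(E_j)$ be a shrinking FMD of $X$ with biorthogonal sequence $(F_j)$. Write $E_{[m,n]}=E_m+\dots+E_n$, $F_{[m,n]}=F_m+\dots+F_n$. Suppose that for all $1\le m\le n$ the *block estimates* hold: 1. every $e^*\in (E_{[m,n]})^*$ extends to some $x^*\in F_{[m-1,n+1]}$ with $\|x^*\|\le 2.5\|e^*\|$; 2. every $f^*\in (F_{[m,n]})^*$ is the restriction to $F_{[m,n]}$ of the evaluation at some $z\in E_{[m-1,n+1]}$ with $\|z\|\le2.5\|f^*\|$; 3. $\|x^*\|\le2.5\,\|x^*|_{E_{[m-1,n+1]}}\|$ for $x^*\in F_{[m,n]}$; 4. $\|x\|\le2.5\sup\{|x^*(x)|:x^*\in F_{[m-1,n+1]},\|x^*\|\le1\}$ for $x\in E_{[m,n]}$.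 Let $(\varepsilon_k)\subset(0,1)$ be non-increasing with $\sum_k\varepsilon_k<\frac1{50}$. Call $0<n_1<n_2<\cdots$ *admissible* if for every $k\ge1$ and every $x^*$ with $\|x^*\|\le1$ there is $j\in[n_k,n_{k+1}]$ with $\|x^*|_{E_j}\|\le\varepsilon_k$. Given an admissible $(n_k)$, let $B^*$ be the set of all $x^*\in X^*$, $\|x^*\|\le1$, such that for every $k\ge1$ there is $j\in[n_k,n_{k+1}]$ with $x^*|_{E_j}=0$. Let $\mathbb B^*$ be the set of sequences $(x_k^*)_{k\ge1}$ in $X^*$ for which there are $j_0=0$ and $j_k\in[n_k,n_{k+1}]$, $k\ge1$, such that $x_k^*$ vanishes on $E_i$ unless $j_{k-1}<i<j_k$, and for which $\sum_kx_k^*$ converges in norm to an element of norm at most $1$. Let $Y_k=\operatorname{span}(E_j:n_{k-1}<j<n_{k+1})$. Then $Z$ is the completion of the space of finitely supported sequences $(z_k)$, $z_k\in Y_k$, under $\|(z_k)\|=\sup\{\sum_kx_k^*(z_k):(x_k^*)\in\mathbb B^*\}$, and $Z_k\subset Z$ is the $k$-th coordinate space. **Corollary.** Assume that $X^*$ is separable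 and that $X$ has the $w^*$-Unconditional Tree Property. Then there is a shrinking FMD $(E_j)$ of $X$ satisfying the block estimates such that for every $(\varepsilon_k)$ as above admissible sequences exist, and for every admissible $(n_k)$ the sequence $(Z_k)$ is a shrinking and unconditional FDD of $Z$. Moreover, $X$ embeds into $Z$: there is a bounded linear map $J:X\to Z$, bounded below, with $\|Jx\|=\sup_{x^*\in B^*}|x^*(x)|$ for all $x \in X$, which maps $x\in E_j$ to the sequence whose $k$-th term is $x$ if $n_{k-1}<j<n_{k+1}$ and $0$ otherwise. In particular, $X$ embeds isomorphically into a Banach space with a shrinking unconditional FDD; and $X$ also embeds isomorphically into a Banach space with a shrinking unconditional Schauder basis. -/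

import Mathlib

open Filter Topology

noncomputable section

namespace FMD

section Decompositions

variable {X : Type*} [NormedAddCommGroup X] [NormedSpace ℝ X]

/-- The biorthogonal sequence of `(E k)`: `F k` is the annihilator in the dual of the linear span
of all `E j` with `j ≠ k`. -/
def biorth (E : ℕ → Submodule ℝ X) (k : ℕ) : Submodule ℝ (StrongDual ℝ X) where
  carrier := {f | ∀ x ∈ ⨆ (j : ℕ) (_ : j ≠ k), E j, f x = 0}
  zero_mem' := by
    intro x _
    simp
  add_mem' := by
    intro f g hf hg x hx
    simp [hf x hx, hg x hx]
  smul_mem' := by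
    intro c f hf x hx
    simp [hf x hx]

/-- Finite dimensional Markushevich decompositions. -/
structure IsFMD (E : ℕ → Submodule ℝ X) : Prop where
  finiteDimensional : ∀ k, FiniteDimensional ℝ (E k)
  fundamental : (⨆ k, E k).topologicalClosure = ⊤
  minimal : ∀ k, E k ⊓ (⨆ (j : ℕ) (_ : j ≠ k), E j).topologicalClosure = ⊥
  total : ∀ x : X, (∀ k, ∀ f ∈ biorth E k, f x = 0) → x = 0

/-- The biorthogonal sequence has dense linear span in the dual. -/
def IsShrinking (E : ℕ → Submodule ℝ X) : Prop :=
  (⨆ k, biorth E k).topologicalClosure = ⊤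

/-- The series `∑ y k` converges in norm, in the order of the indices, to `x`. -/
def SeriesTendsto (y : ℕ → X) (x : X) : Prop :=
  Tendsto (fun N => ∑ k ∈ Finset.range N, y k) atTop (𝓝 x)

/-- Finite dimensional decompositions. -/
structure IsFDD (E : ℕ → Submodule ℝ X) : Prop extends IsFMD E where
  existsUnique_expansion : ∀ x : X, ∃! y : ℕ → X, (∀ k, y k ∈ E k) ∧ SeriesTendsto y x

/-- The finiteness of the unconditional constant of the decomposition `(E k)`. -/
def IsUnconditional (E : ℕ → Submodule ℝ X) : Prop :=
  ∃ C : ℝ, ∀ (σ : ℕ → ℝ) (y : ℕ → X) (x : X), (∀ k, σ k = 1 ∨ σ k = -1) → (∀ k, y k ∈ E k) →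
    SeriesTendsto y x → ‖x‖ ≤ 1 → ∃ x', SeriesTendsto (fun k => σ k • y k) x' ∧ ‖x'‖ ≤ C

/-- The sum `E m + E (m + 1) + ⋯ + E n`. -/
def blockSum {Y : Type*} [NormedAddCommGroup Y] [NormedSpace ℝ Y] (E : ℕ → Submodule ℝ Y) (m n : ℕ) :
    Submodule ℝ Y :=
  ⨆ j ∈ Finset.Icc m n, E j

/-- The restriction of a continuous functional to a subspace, with its norm on the subspace. -/
def restr {Y : Type*} [NormedAddCommGroup Y] [NormedSpace ℝ Y] (f : StrongDual ℝ Y)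
    (S : Submodule ℝ Y) : StrongDual ℝ S :=
  f.comp S.subtypeL

/-- Extension and norming estimates between consecutive blocks of `(E j)` and of its biorthogonal
sequence. The decomposition is numbered from `1`; `E 0` is meant to be the null space. -/
structure BlockEstimates (E : ℕ → Submodule ℝ X) : Prop where
  extend_dual : ∀ m n, 1 ≤ m → m ≤ n → ∀ e : StrongDual ℝ (blockSum E m n),
    ∃ f ∈ blockSum (biorth E) (m - 1) (n + 1),
      restr f (blockSum E m n) = e ∧ ‖f‖ ≤ 2.5 * ‖e‖
  extend_predual : ∀ m n, 1 ≤ m → m ≤ n → ∀ e : StrongDual ℝ (blockSum (biorth E) m n),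
    ∃ z ∈ blockSum E (m - 1) (n + 1),
      restr (NormedSpace.inclusionInDoubleDual ℝ X z) (blockSum (biorth E) m n) = e ∧
        ‖z‖ ≤ 2.5 * ‖e‖
  norming_dual : ∀ m n, 1 ≤ m → m ≤ n → ∀ f ∈ blockSum (biorth E) m n,
    ‖f‖ ≤ 2.5 * ‖restr f (blockSum E (m - 1) (n + 1))‖
  norming_predual : ∀ m n, 1 ≤ m → m ≤ n → ∀ x ∈ blockSum E m n,
    ‖x‖ ≤ 2.5 * ‖restr (NormedSpace.inclusionInDoubleDual ℝ X x)
      (blockSum (biorth E) (m - 1) (n + 1))‖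

end Decompositions

section TreeProperty

variable (X : Type*) [NormedAddCommGroup X] [NormedSpace ℝ X]

/-- The sequence `(x i)` is unconditional. -/
def IsUnconditionalSeq {Y : Type*} [NormedAddCommGroup Y] [NormedSpace ℝ Y] (x : ℕ → Y) : Prop :=
  ∃ C : ℝ, ∀ (N : ℕ) (a σ : ℕ → ℝ), (∀ i, σ i = 1 ∨ σ i = -1) →
    ‖∑ i ∈ Finset.range N, (σ i * a i) • x i‖ ≤ C * ‖∑ i ∈ Finset.range N, a i • x i‖

/-- The weak* Unconditional Tree Property: every normalized family in the dual that is indexed by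
the finite sets of natural numbers, and all of whose nodes `(x (t ∪ {k}))`, `k > max t`, are weak*
null, has an unconditional branch `x {κ 0}, x {κ 0, κ 1}, …` with `κ 0 < κ 1 < ⋯`. -/
def WeakStarUTP : Prop :=
  ∀ x : Finset ℕ → StrongDual ℝ X, (∀ t, ‖x t‖ = 1) →
    (∀ t, Tendsto (fun k => StrongDual.toWeakDual (x (insert k t))) atTop (𝓝 0)) →
    ∃ κ : ℕ → ℕ, StrictMono κ ∧
      IsUnconditionalSeq (fun i => x ((Finset.range (i + 1)).image κ))

end TreeProperty

section Construction

variable {X : Type*} [NormedAddCommGroup X] [NormedSpace ℝ X]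

/-- An increasing sequence `0 = n 0 < n 1 < ⋯` such that for all `k ≥ 1` every functional of norm
at most one is small on some `E j`, `n k ≤ j ≤ n (k + 1)`; the bound for `k` is `ε (k - 1)`. -/
structure Admissible (E : ℕ → Submodule ℝ X) (ε : ℕ → ℝ) (n : ℕ → ℕ) : Prop where
  zero : n 0 = 0
  strictMono : StrictMono n
  small : ∀ k, ∀ f : StrongDual ℝ X, ‖f‖ ≤ 1 →
    ∃ j ∈ Set.Icc (n (k + 1)) (n (k + 2)), ‖restr f (E j)‖ ≤ ε k

/-- The set `B*` of all `f` in the dual unit ball that vanish, for every `k ≥ 1`, on some `E j`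
with `n k ≤ j ≤ n (k + 1)`. -/
def skippedBall (E : ℕ → Submodule ℝ X) (n : ℕ → ℕ) : Set (StrongDual ℝ X) :=
  {f | ‖f‖ ≤ 1 ∧ ∀ k, ∃ j ∈ Set.Icc (n (k + 1)) (n (k + 2)), ∀ x ∈ E j, f x = 0}

/-- The support of a functional with respect to `(E j)`. -/
def dualSupp (E : ℕ → Submodule ℝ X) (f : StrongDual ℝ X) : Set ℕ :=
  {j | ∃ x ∈ E j, f x ≠ 0}

/-- The set `𝔹*` of the sequences of functionals that define the norm of `Z`. Here `f k` stands for
the `(k + 1)`-st term of the sequence: its support lies strictly between `j k` and `j (k + 1)`,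
where `j 0 = 0` and `n k ≤ j k ≤ n (k + 1)` for `k ≥ 1`. -/
def skippedSeqBall (E : ℕ → Submodule ℝ X) (n : ℕ → ℕ) : Set (ℕ → StrongDual ℝ X) :=
  {f | ∃ j : ℕ → ℕ, j 0 = 0 ∧ (∀ k, j (k + 1) ∈ Set.Icc (n (k + 1)) (n (k + 2))) ∧
    (∀ k, dualSupp E (f k) ⊆ Set.Ioo (j k) (j (k + 1))) ∧
    ∃ g, SeriesTendsto f g ∧ ‖g‖ ≤ 1}

/-- `ZBlock E n k` is the linear span of the `E j` with `n k < j < n (k + 2)`; it stands for the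
`(k + 1)`-st space `Z (k + 1)`. -/
def ZBlock (E : ℕ → Submodule ℝ X) (n : ℕ → ℕ) (k : ℕ) : Submodule ℝ X :=
  ⨆ j ∈ Set.Ioo (n k) (n (k + 2)), E j

/-- The finitely supported sequences `(z k)` with `z k ∈ ZBlock E n k`. -/
def PreZ (E : ℕ → Submodule ℝ X) (n : ℕ → ℕ) : Type _ :=
  Π₀ k, ZBlock E n k

instance (E : ℕ → Submodule ℝ X) (n : ℕ → ℕ) : AddCommGroup (PreZ E n) :=
  inferInstanceAs (AddCommGroup (Π₀ k, ZBlock E n k))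

instance (E : ℕ → Submodule ℝ X) (n : ℕ → ℕ) : Module ℝ (PreZ E n) :=
  inferInstanceAs (Module ℝ (Π₀ k, ZBlock E n k))

/-- The inclusion of the `k`-th coordinate space. -/
def PreZ.single (E : ℕ → Submodule ℝ X) (n : ℕ → ℕ) (k : ℕ) : ZBlock E n k →ₗ[ℝ] PreZ E n :=
  DFinsupp.lsingle (R := ℝ) (M := fun i => ↥(ZBlock E n i)) k

/-- The functional `(z k) ↦ ∑ k, f k (z k)`. -/
def PreZ.pairing (E : ℕ → Submodule ℝ X) (n : ℕ → ℕ) (f : ℕ → StrongDual ℝ X) :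
    PreZ E n →ₗ[ℝ] ℝ :=
  DFinsupp.lsum ℕ (fun k => (f k).toLinearMap ∘ₗ (ZBlock E n k).subtype)

/-- The seminorm `(z k) ↦ sup |∑ k, f k (z k)|`, the supremum being taken over all `(f k)` in the
symmetric set `skippedSeqBall E n`. -/
def PreZ.seminorm (E : ℕ → Submodule ℝ X) (n : ℕ → ℕ) : Seminorm ℝ (PreZ E n) :=
  ⨆ f : skippedSeqBall E n, (normSeminorm ℝ ℝ).comp (PreZ.pairing E n f)

instance (E : ℕ → Submodule ℝ X) (n : ℕ → ℕ) : SeminormedAddCommGroup (PreZ E n) :=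
  (PreZ.seminorm E n).toAddGroupSeminorm.toSeminormedAddCommGroup

instance (E : ℕ → Submodule ℝ X) (n : ℕ → ℕ) : NormedSpace ℝ (PreZ E n) where
  norm_smul_le a z := (map_smul_eq_mul (PreZ.seminorm E n) a z).le

/-- The Banach space `Z`, the completion of the finitely supported sequences. -/
abbrev ZSpace (E : ℕ → Submodule ℝ X) (n : ℕ → ℕ) : Type _ :=
  UniformSpace.Completion (PreZ E n)

/-- The decomposition `(Z k)` of `Z`, as a sequence of subspaces of `Z`, numbered from `0`. -/
def ZDecomp (E : ℕ → Submodule ℝ X) (n : ℕ → ℕ) (k : ℕ) : Submodule ℝ (ZSpace E n) :=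
  LinearMap.range
    ((UniformSpace.Completion.toComplₗᵢ (𝕜 := ℝ) (E := PreZ E n)).toLinearMap ∘ₗ
      PreZ.single E n k)

theorem mem_ZBlock {E : ℕ → Submodule ℝ X} {n : ℕ → ℕ} {k j : ℕ} (h : n k < j ∧ j < n (k + 2))
    (x : E j) : (x : X) ∈ ZBlock E n k :=
  (le_iSup₂ (f := fun i (_ : i ∈ Set.Ioo (n k) (n (k + 2))) => E i) j h) x.2

/-- For `x` in `E j`, the sequence whose `k`-th term is `x` if `n k < j < n (k + 2)` and `0`
otherwise. (If `n` is strictly increasing, then `n k < j` forces `k < j`.) -/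
def diag (E : ℕ → Submodule ℝ X) (n : ℕ → ℕ) (j : ℕ) (x : E j) : PreZ E n :=
  ∑ k ∈ Finset.range j,
    if h : n k < j ∧ j < n (k + 2) then PreZ.single E n k ⟨x, mem_ZBlock h x⟩ else 0

end Construction

end FMD

end

/-! The decomposition comes from increasing finite dimensional spaces `A n` in X and `B n` in X*, in
exact duality with each other, each normed up to the factor 1.1 by the next space on the other side,
with dense union of the `B n`. Put E_n = A_n ∩ (B_{n-1})^⊥. This is a shrinking FMD with
biorthogonal spaces B_n ∩ (A_{n-1})^⊥, and correcting the norming vectors gives the block estimates,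
since 1.1·2.1 ≤ 2.5 (`IsTower.blockEstimates`).

The tree property enters once, through a game: one player names k, the other answers with a
normalized functional vanishing on `A k` and wants to produce a sequence that is not unconditional
with constant C. If the second player could win for every integer C, the winning strategies, played
one after the other, would form a weak*-null tree without unconditional branch (`exists_not_lost`).
So for some C the first player can avoid lost positions forever. With finite nets only finitely many
positions need an answer at each stage, and a subsequence of the tower answers them all in advance.
After a perturbation, functionals supported in successive gaps are unconditional with one constant
(`exists_skippedUnconditional`).

A functional g vanishing on E_{j_k} for every k is the norm convergent sum of its pieces between the
j_k, so the elements of 𝔹* are the pairs (g, j). These pairs form a compact set on which every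
finitely supported z is continuous, and each single pair is small on tails. By Hahn-Banach and
Riesz-Markov, functionals on Z are integrals over this compact set, and dominated convergence makes
every functional small on tails (`tail_small_of_compact`): (Z_k) is shrinking. Its unconditionality
is that of the pieces. X embeds because, by admissibility, every functional of the unit ball is
within 1/20 of one that vanishes on some E_j in each interval (`IsBlockFMD.exists_skipped_near`).

For the basis, the pieces are replaced by multiples of members of finite nets, so that a functional
is coded by scalars with at most one non-zero entry per block. The codes and their sign changes form
a compact norming set for a sequence space; sign invariance makes its unit vectors an unconditional
basis, the same compactness criterion makes it shrinking, and x ↦ (φ_a(x)) embeds X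
(`IsBlockFMD.exists_basis_embedding`). -/

noncomputable section

namespace FMD

/-! ### Finite dimensional duality and nets of unit spheres. -/

section FiniteDimensional

variable {V W : Type*} [NormedAddCommGroup V] [NormedSpace ℝ V] [NormedAddCommGroup W]
  [NormedSpace ℝ W]

theorem inclusionInDoubleDual_surjective [FiniteDimensional ℝ V] :
    Function.Surjective (NormedSpace.inclusionInDoubleDual ℝ V) := by
  have hfin : ∀ (U : Type _) [NormedAddCommGroup U] [NormedSpace ℝ U] [FiniteDimensional ℝ U],
      Module.finrank ℝ (StrongDual ℝ U) = Module.finrank ℝ U := by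
    intro U _ _ _
    rw [← Subspace.dual_finrank_eq (K := ℝ) (V := U)]
    exact (LinearMap.toContinuousLinearMap (𝕜 := ℝ) (E := U) (F' := ℝ)).finrank_eq.symm
  have hinj : Function.Injective (NormedSpace.inclusionInDoubleDual ℝ V).toLinearMap :=
    (NormedSpace.inclusionInDoubleDualLi (E := V) ℝ).injective
  have := (LinearMap.injective_iff_surjective_of_finrank_eq_finrank
    (f := (NormedSpace.inclusionInDoubleDual ℝ V).toLinearMap)
    (by rw [hfin (StrongDual ℝ V), hfin V])).1 hinj
  exact this

/-- Functionals extend along maps that are bounded below. -/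
theorem exists_extension_of_bounded_below (T : V →ₗ[ℝ] W) {c : ℝ}
    (hc : 0 ≤ c) (hT : ∀ v, ‖v‖ ≤ c * ‖T v‖) (e : StrongDual ℝ V) :
    ∃ ψ : StrongDual ℝ W, (∀ v, ψ (T v) = e v) ∧ ‖ψ‖ ≤ c * ‖e‖ := by
  have hinj : Function.Injective T := by
    rw [← LinearMap.ker_eq_bot, LinearMap.ker_eq_bot']
    intro v hv
    have := hT v
    rw [hv] at this
    simpa using this
  let T' := LinearEquiv.ofInjective T hinj
  let ψ₁ : LinearMap.range T →ₗ[ℝ] ℝ := e.toLinearMap ∘ₗ T'.symm.toLinearMap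
  have hψ₁ : ∀ v, ψ₁ (T' v) = e v := fun v => by simp [ψ₁]
  have hψ₁' : ∀ x, ‖ψ₁ x‖ ≤ c * ‖e‖ * ‖x‖ := by
    intro x
    obtain ⟨v, rfl⟩ := T'.surjective x
    rw [hψ₁]
    calc ‖e v‖ ≤ ‖e‖ * ‖v‖ := e.le_opNorm v
      _ ≤ ‖e‖ * (c * ‖T v‖) := by gcongr; exact hT v
      _ = c * ‖e‖ * ‖T v‖ := by ring
  let ψ₀ : StrongDual ℝ (LinearMap.range T) := ψ₁.mkContinuous _ hψ₁'
  obtain ⟨ψ, hψ, hn⟩ := _root_.exists_extension_norm_eq (LinearMap.range T) ψ₀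
  refine ⟨ψ, fun v => ?_, ?_⟩
  · have := hψ (T' v)
    rw [← hψ₁ v]
    exact this
  · rw [hn]
    exact ContinuousLinearMap.opNorm_le_bound ψ₀ (by positivity) hψ₁'

/-- If `T : V → U*` is bounded below, every functional on `V` is `v ↦ T v u` for some `u`,
with control of the norm. -/
theorem exists_representative {U : Type*} [NormedAddCommGroup U] [NormedSpace ℝ U]
    [FiniteDimensional ℝ U] (T : V →ₗ[ℝ] StrongDual ℝ U) {c : ℝ}
    (hc : 0 ≤ c) (hT : ∀ v, ‖v‖ ≤ c * ‖T v‖) (e : StrongDual ℝ V) :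
    ∃ u : U, (∀ v, T v u = e v) ∧ ‖u‖ ≤ c * ‖e‖ := by
  obtain ⟨ψ, hψ, hn⟩ := exists_extension_of_bounded_below T hc hT e
  obtain ⟨u, rfl⟩ := inclusionInDoubleDual_surjective ψ
  refine ⟨u, fun v => hψ v, ?_⟩
  have h1 : ‖u‖ = ‖NormedSpace.inclusionInDoubleDual ℝ U u‖ :=
    ((NormedSpace.inclusionInDoubleDualLi (E := U) ℝ).norm_map u).symm
  rw [h1]
  exact hn

/-- Compactness of the unit sphere. The homogeneous form lets a vector be replaced by its own norm
times a net member, with relative error δ. -/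
theorem exists_finite_net (S : Submodule ℝ V) [FiniteDimensional ℝ S] {δ : ℝ} (hδ : 0 < δ) :
    ∃ D : Finset V, (∀ y ∈ D, y ∈ S ∧ ‖y‖ = 1) ∧
      ∀ v ∈ S, v ≠ 0 → ∃ y ∈ D, ‖v - ‖v‖ • y‖ ≤ δ * ‖v‖ := by
  classical
  have : ProperSpace S := FiniteDimensional.proper ℝ S
  obtain ⟨t, hts, htf, htc⟩ := (isCompact_sphere (0 : S) 1).finite_cover_balls hδ
  refine ⟨htf.toFinset.image Subtype.val, ?_, ?_⟩
  · intro y hy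
    simp only [Finset.mem_image, Set.Finite.mem_toFinset] at hy
    obtain ⟨z, hz, rfl⟩ := hy
    exact ⟨z.2, by simpa using hts hz⟩
  · intro v hv hv0
    have hn : ‖v‖ ≠ 0 := norm_ne_zero_iff.2 hv0
    let w : S := ⟨‖v‖⁻¹ • v, S.smul_mem _ hv⟩
    have hw : w ∈ Metric.sphere (0 : S) 1 := by
      simp [w, norm_smul, hn]
    obtain ⟨y, hy, hyw⟩ := Set.mem_iUnion₂.1 (htc hw)
    refine ⟨y, Finset.mem_image.2 ⟨y, by simpa using hy, rfl⟩, ?_⟩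
    have h1 : ‖(w : V) - y‖ ≤ δ := by
      have := (Metric.mem_ball.1 hyw).le
      rwa [dist_eq_norm, Submodule.coe_norm] at this
    have h2 : v - ‖v‖ • (y : V) = ‖v‖ • ((w : V) - y) := by
      simp [w, smul_sub, smul_smul, hn]
    rw [h2, norm_smul, norm_norm, mul_comm]
    gcongr

end FiniteDimensional

/-! ### Pairings of spaces, norming subspaces and annihilators. -/

section Pairing

variable {V W : Type*} [NormedAddCommGroup V] [NormedSpace ℝ V] [NormedAddCommGroup W]
  [NormedSpace ℝ W]

theorem le_norm_restr {Y : Type*} [NormedAddCommGroup Y] [NormedSpace ℝ Y] (f : StrongDual ℝ Y)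
    {S : Submodule ℝ Y} {y : Y} (hy : y ∈ S) : |f y| ≤ ‖restr f S‖ * ‖y‖ :=
  (restr f S).le_opNorm ⟨y, hy⟩

theorem norm_restr_le {Y : Type*} [NormedAddCommGroup Y] [NormedSpace ℝ Y] {f : StrongDual ℝ Y}
    {S : Submodule ℝ Y} {c : ℝ} (hc : 0 ≤ c) (h : ∀ y ∈ S, |f y| ≤ c * ‖y‖) : ‖restr f S‖ ≤ c :=
  (restr f S).opNorm_le_bound hc fun y => h y y.2

theorem norm_restr_mono {Y : Type*} [NormedAddCommGroup Y] [NormedSpace ℝ Y] (f : StrongDual ℝ Y)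
    {S S' : Submodule ℝ Y} (h : S ≤ S') : ‖restr f S‖ ≤ ‖restr f S'‖ :=
  norm_restr_le (norm_nonneg (restr f S')) fun _ hy => le_norm_restr f (h hy)

/-- The annihilator of a subspace with respect to a pairing. -/
def ann (p : V →L[ℝ] StrongDual ℝ W) (S : Submodule ℝ V) : Submodule ℝ W where
  carrier := {w | ∀ v ∈ S, p v w = 0}
  zero_mem' := by intro v _; simp
  add_mem' := by
    intro a b ha hb v hv
    simp [ha v hv, hb v hv]
  smul_mem' := by
    intro c a ha v hv
    simp [ha v hv]

theorem ann_anti (p : V →L[ℝ] StrongDual ℝ W) {S S' : Submodule ℝ V} (h : S ≤ S') :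
    ann p S' ≤ ann p S := fun _ hw v hv => hw v (h hv)

/-- It suffices to norm a finite net of the sphere of `S` almost exactly; the almost norming vectors
span `R`. The general pairing serves both X against X* and X* against X. -/
theorem exists_norming_subspace (p : V →L[ℝ] StrongDual ℝ W) (hp : ∀ v, ‖p v‖ = ‖v‖)
    (S : Submodule ℝ V) [FiniteDimensional ℝ S] :
    ∃ R : Submodule ℝ W, FiniteDimensional ℝ R ∧ ∀ v ∈ S, ‖v‖ ≤ 1.1 * ‖restr (p v) R‖ := by
  classical
  -- Net members are normed up to 21/22 and the net error costs 1/22, leaving 20/22 = 1/1.1.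
  obtain ⟨D, hD, hnet⟩ := exists_finite_net S (δ := 1 / 22) (by norm_num)
  have hw : ∀ y : V, ‖y‖ = 1 → ∃ w : W, ‖w‖ ≤ 1 ∧ 21 / 22 ≤ |p y w| := by
    intro y hy
    by_contra! hcon
    have : ‖p y‖ ≤ 21 / 22 := by
      refine ContinuousLinearMap.opNorm_le_of_unit_norm (by norm_num) fun w hw => ?_
      exact (hcon w hw.le).le
    rw [hp, hy] at this
    norm_num at this
  choose! w hw1 hw2 using hw
  refine ⟨Submodule.span ℝ (D.image w), FiniteDimensional.span_finset ℝ _, fun v hv => ?_⟩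
  rcases eq_or_ne v 0 with rfl | hv0
  · simp only [norm_zero]; positivity
  obtain ⟨y, hy, hyv⟩ := hnet v hv hv0
  have hmem : w y ∈ Submodule.span ℝ ((D.image w : Finset W) : Set W) :=
    Submodule.subset_span (by simpa using ⟨y, hy, rfl⟩)
  have h1 := le_norm_restr (p v) hmem
  have hy1 := (hD y hy).2
  have h2 : |p (v - ‖v‖ • y) (w y)| ≤ 1 / 22 * ‖v‖ := by
    calc |p (v - ‖v‖ • y) (w y)| ≤ ‖p (v - ‖v‖ • y)‖ * ‖w y‖ := (p _).le_opNorm _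
      _ ≤ (1 / 22 * ‖v‖) * 1 := by
        rw [hp]; gcongr; exact hw1 y hy1
      _ = _ := by ring
  have h3 : p (v - ‖v‖ • y) (w y) = p v (w y) - ‖v‖ * p y (w y) := by simp
  have h4 : ‖v‖ * (21 / 22) ≤ |‖v‖ * p y (w y)| := by
    rw [abs_mul, abs_norm]; gcongr; exact hw2 y hy1
  have h5 : |‖v‖ * p y (w y)| ≤ |p v (w y)| + |p v (w y) - ‖v‖ * p y (w y)| := by
    have := abs_sub_abs_le_abs_sub (‖v‖ * p y (w y)) (p v (w y))
    rw [abs_sub_comm] at this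
    linarith
  rw [h3] at h2
  have h6 : ‖restr (p v) (Submodule.span ℝ ((D.image w : Finset W) : Set W))‖ * ‖w y‖ ≤
      ‖restr (p v) (Submodule.span ℝ ((D.image w : Finset W) : Set W))‖ * 1 := by
    gcongr; exact hw1 y hy1
  linarith

/-- A norming estimate survives the passage to the annihilator of a smaller subspace. -/
theorem norming_ann (p : V →L[ℝ] StrongDual ℝ W) (hp : ∀ v, ‖p v‖ ≤ ‖v‖) {c : ℝ} (hc : 0 ≤ c)
    {A₀ : Submodule ℝ V} {B₀ B₁ : Submodule ℝ W} [FiniteDimensional ℝ A₀] [FiniteDimensional ℝ B₀]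
    (hB : B₀ ≤ B₁) (hA : ∀ a ∈ A₀, ‖a‖ ≤ c * ‖restr (p a) B₀‖) {v : V}
    (hv0 : ∀ w ∈ B₀, p v w = 0) (hv : ‖v‖ ≤ c * ‖restr (p v) B₁‖) :
    ‖v‖ ≤ c * (1 + c) * ‖restr (p v) (B₁ ⊓ ann p A₀)‖ := by
  refine hv.trans ?_
  rw [mul_assoc]
  gcongr
  refine norm_restr_le (by positivity) fun w hw => ?_
  let T : A₀ →ₗ[ℝ] StrongDual ℝ B₀ :=
    { toFun := fun a => restr (p a) B₀
      map_add' := by intro a b; ext; simp [restr]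
      map_smul' := by intro r a; ext; simp [restr] }
  let e : StrongDual ℝ A₀ := restr (p.flip w) A₀
  -- `b` in `B₀` acts on `A₀` as `w` does and is killed by `v`. So `w - b` annihilates `A₀`, takes
  -- the same value at `v`, and has norm at most (1 + c)‖w‖.
  obtain ⟨b, hb, hbn⟩ := exists_representative T hc (fun a => hA a a.2) e
  have he : ‖e‖ ≤ ‖w‖ := norm_restr_le (norm_nonneg _) fun a _ => by
    calc |p a w| ≤ ‖p a‖ * ‖w‖ := (p a).le_opNorm w
      _ ≤ ‖w‖ * ‖a‖ := by rw [mul_comm]; gcongr; exact hp a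
  have hmem : w - b ∈ B₁ ⊓ ann p A₀ := by
    refine ⟨B₁.sub_mem hw (hB b.2), fun a ha => ?_⟩
    have h0 : p a b = p a w := hb ⟨a, ha⟩
    rw [map_sub, h0, sub_self]
  have h1 := le_norm_restr (p v) hmem
  rw [map_sub, hv0 b b.2, sub_zero] at h1
  have h2 : ‖w - (b : W)‖ ≤ (1 + c) * ‖w‖ := by
    calc ‖w - (b : W)‖ ≤ ‖w‖ + ‖(b : W)‖ := norm_sub_le _ _
      _ ≤ ‖w‖ + c * ‖w‖ := by
        have : ‖(b : W)‖ ≤ c * ‖e‖ := hbn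
        gcongr
        exact this.trans (by gcongr)
      _ = _ := by ring
  calc |p v w| ≤ _ := h1
    _ ≤ ‖restr (p v) (B₁ ⊓ ann p A₀)‖ * ((1 + c) * ‖w‖) := by gcongr
    _ = _ := by ring

/-- The blocks of the decomposition given by an increasing sequence `A` of subspaces and the
annihilators of an increasing sequence `B`. -/
theorem blockSum_inf_ann (q : W →L[ℝ] StrongDual ℝ V) {A : ℕ → Submodule ℝ V}
    {B : ℕ → Submodule ℝ W} (hA : Monotone A) (hB : Monotone B) (hA0 : A 0 = ⊥)
    (hAB : ∀ n, ∀ v : V, ∃ a ∈ A n, ∀ b ∈ B n, q b a = q b v) (m n : ℕ) (hmn : m ≤ n) :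
    blockSum (fun k => A k ⊓ ann q (B (k - 1))) m n = A n ⊓ ann q (B (m - 1)) := by
  apply le_antisymm
  · refine iSup₂_le fun j hj => ?_
    rw [Finset.mem_Icc] at hj
    exact inf_le_inf (hA hj.2) (ann_anti q (hB (by omega)))
  · rcases Nat.eq_zero_or_pos n with rfl | hn
    · rw [hA0]; simp
    induction n, hmn using Nat.le_induction with
    | base => exact le_iSup₂_of_le m (by simp) le_rfl
    | succ n hmn ih =>
      rintro v ⟨hv, hv'⟩
      -- Split `v` as `(v - a) + a`: the difference annihilates `B n` and lies in the last summand,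
      -- while `a` still annihilates `B (m - 1)`, so induction applies to it.
      obtain ⟨a, ha, hav⟩ := hAB n v
      have h1 : v - a ∈ A (n + 1) ⊓ ann q (B (n + 1 - 1)) := by
        refine ⟨(A (n + 1)).sub_mem hv (hA n.le_succ ha), fun b hb => ?_⟩
        rw [map_sub, hav b hb, sub_self]
      have h2 : a ∈ blockSum (fun k => A k ⊓ ann q (B (k - 1))) m n := by
        rcases Nat.eq_zero_or_pos n with rfl | hn
        · rw [hA0, Submodule.mem_bot] at ha
          rw [ha]; exact zero_mem _
        refine ih hn ⟨ha, fun b hb => ?_⟩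
        rw [hav b (hB (by omega) hb)]
        exact hv' b hb
      rw [← sub_add_cancel v a]
      refine add_mem ?_ ?_
      · exact (le_iSup₂_of_le (f := fun j (_ : j ∈ Finset.Icc m (n + 1)) =>
          A j ⊓ ann q (B (j - 1))) (n + 1) (by simp; omega) le_rfl) h1
      · refine (iSup₂_le fun j hj => ?_ :
          blockSum (fun k => A k ⊓ ann q (B (k - 1))) m n ≤ _) h2
        rw [Finset.mem_Icc] at hj
        exact le_iSup₂_of_le (f := fun j (_ : j ∈ Finset.Icc m (n + 1)) =>
          A j ⊓ ann q (B (j - 1))) j (by simp; omega) le_rfl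

/-- Nondegenerate pairings of finite dimensional spaces represent all functionals. -/
theorem exists_representative_of_separating (q : W →L[ℝ] StrongDual ℝ V) {A : Submodule ℝ V}
    {B : Submodule ℝ W} [FiniteDimensional ℝ A] [FiniteDimensional ℝ B]
    (hB : ∀ b ∈ B, (∀ a ∈ A, q b a = 0) → b = 0) (v : V) :
    ∃ a ∈ A, ∀ b ∈ B, q b a = q b v := by
  let T : A →ₗ[ℝ] Module.Dual ℝ B :=
    { toFun := fun a => ((q.flip a).toLinearMap).comp B.subtype
      map_add' := by intro a b; ext; simp
      map_smul' := by intro r a; ext; simp }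
  have hT : Function.Surjective T := by
    -- Surjectivity of A → B* is dual to injectivity of B = B** → A*, which is the separation
    -- hypothesis.
    rw [← LinearMap.dualMap_injective_iff, ← LinearMap.ker_eq_bot, LinearMap.ker_eq_bot']
    intro ψ hψ
    obtain ⟨b, rfl⟩ := (Module.evalEquiv ℝ B).surjective ψ
    have : b = 0 := by
      apply Subtype.ext
      refine hB b b.2 fun a ha => ?_
      exact LinearMap.congr_fun hψ ⟨a, ha⟩
    rw [this, map_zero]
  obtain ⟨a, ha⟩ := hT (((q.flip v).toLinearMap).comp B.subtype)
  exact ⟨a, a.2, fun b hb => LinearMap.congr_fun ha ⟨b, hb⟩⟩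

end Pairing

/-! ### Dense subspaces and functionals. -/

section Density

variable {X : Type*} [NormedAddCommGroup X] [NormedSpace ℝ X]

theorem topologicalClosure_eq_top_of_forall_dual {S : Submodule ℝ X}
    (h : ∀ f : StrongDual ℝ X, (∀ x ∈ S, f x = 0) → f = 0) : S.topologicalClosure = ⊤ := by
  by_contra hne
  obtain ⟨x, hx⟩ : ∃ x, x ∉ S.topologicalClosure := by
    by_contra! hall
    exact hne (eq_top_iff.2 fun x _ => hall x)
  obtain ⟨f, u, hf, hu⟩ := geometric_hahn_banach_closed_point (s := (S.topologicalClosure : Set X))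
    S.topologicalClosure.convex S.isClosed_topologicalClosure hx
  have h0 : (0 : ℝ) < u := by simpa using hf 0 (zero_mem _)
  have hf0 : f = 0 := by
    refine h f fun y hy => ?_
    by_contra hy0
    have := hf ((u / f y) • y) (S.topologicalClosure.smul_mem _ (S.le_topologicalClosure hy))
    rw [map_smul, smul_eq_mul, div_mul_cancel₀ _ hy0] at this
    exact lt_irrefl _ this
  rw [hf0] at hu
  simp at hu
  linarith

theorem dual_ext_of_topologicalClosure_eq_top {ι : Sort*} {E : ι → Submodule ℝ X}
    (hE : (⨆ k, E k).topologicalClosure = ⊤) {f g : StrongDual ℝ X}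
    (h : ∀ k, ∀ x ∈ E k, f x = g x) : f = g := by
  have hle : (⨆ k, E k).topologicalClosure ≤ LinearMap.ker (f - g).toLinearMap := by
    refine Submodule.topologicalClosure_minimal _ (iSup_le fun k x hx => ?_) (f - g).isClosed_ker
    simp [h k x hx]
  ext x
  have := hle (hE ▸ Submodule.mem_top : x ∈ _)
  simpa [sub_eq_zero] using this

end Density

/-! ### The tower of subspaces, its FMD and the block estimates. -/

section Tower

variable {X : Type*} [NormedAddCommGroup X] [NormedSpace ℝ X]

/-- Increasing sequences of finite dimensional subspaces of `X` and of its dual, in duality with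
each other, which norm each other and exhaust both spaces. -/
structure IsTower (A : ℕ → Submodule ℝ X) (B : ℕ → Submodule ℝ (StrongDual ℝ X)) : Prop where
  finA : ∀ n, FiniteDimensional ℝ (A n)
  finB : ∀ n, FiniteDimensional ℝ (B n)
  monoA : Monotone A
  monoB : Monotone B
  zeroA : A 0 = ⊥
  zeroB : B 0 = ⊥
  sepA : ∀ n, ∀ a ∈ A n, (∀ b ∈ B n, b a = 0) → a = 0
  sepB : ∀ n, ∀ b ∈ B n, (∀ a ∈ A n, b a = 0) → b = 0
  denseB : (⨆ n, B n).topologicalClosure = ⊤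
  normA : ∀ n, ∀ a ∈ A n,
    ‖a‖ ≤ 1.1 * ‖restr (NormedSpace.inclusionInDoubleDual ℝ X a) (B (n + 1))‖
  normB : ∀ n, ∀ b ∈ B n, ‖b‖ ≤ 1.1 * ‖restr b (A (n + 1))‖

/-- Restriction to `A'` is injective on `B'`. Adding to `B'` linear lifts of a complement of its
image in the dual of `A'` makes restriction an isomorphism onto that dual, which is separation on
both sides. -/
theorem exists_duality (A' : Submodule ℝ X) (B' : Submodule ℝ (StrongDual ℝ X))
    [FiniteDimensional ℝ A'] [FiniteDimensional ℝ B'] (hB' : ∀ b ∈ B', (∀ a ∈ A', b a = 0) → b = 0) :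
    ∃ B : Submodule ℝ (StrongDual ℝ X), FiniteDimensional ℝ B ∧ B' ≤ B ∧
      (∀ a ∈ A', (∀ b ∈ B, b a = 0) → a = 0) ∧ (∀ b ∈ B, (∀ a ∈ A', b a = 0) → b = 0) := by
  let r : StrongDual ℝ X →ₗ[ℝ] StrongDual ℝ A' :=
    { toFun := fun f => restr f A'
      map_add' := by intro a b; ext; simp [restr]
      map_smul' := by intro r a; ext; simp [restr] }
  have hr : Function.Surjective r := by
    intro e
    obtain ⟨g, hg, -⟩ := _root_.exists_extension_norm_eq A' e
    exact ⟨g, by ext a; exact hg a⟩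
  obtain ⟨s, hs⟩ := LinearMap.exists_rightInverse_of_surjective r (LinearMap.range_eq_top.2 hr)
  have hs' : ∀ e, r (s e) = e := fun e => LinearMap.congr_fun hs e
  obtain ⟨C, hC⟩ := Submodule.exists_isCompl (B'.map r)
  have hrz : ∀ f : StrongDual ℝ X, (∀ a ∈ A', f a = 0) → r f = 0 := fun f hf => by
    ext a; exact hf a a.2
  refine ⟨B' ⊔ C.map s, inferInstance, le_sup_left, ?_, ?_⟩
  · intro a ha hab
    have h1 : ∀ e : StrongDual ℝ A', e ⟨a, ha⟩ = 0 := by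
      intro e
      have : e ∈ B'.map r ⊔ C := by rw [hC.sup_eq_top]; trivial
      obtain ⟨_, ⟨b, hb, rfl⟩, c, hc, rfl⟩ := Submodule.mem_sup.1 this
      have h2 : (b + s c) a = 0 :=
        hab _ (Submodule.mem_sup.2 ⟨b, hb, s c, Submodule.mem_map_of_mem hc, rfl⟩)
      have h3 : r (b + s c) ⟨a, ha⟩ = (b + s c) a := rfl
      rw [map_add, hs', h2] at h3
      exact h3
    obtain ⟨g, -, hg⟩ := exists_dual_vector'' ℝ (⟨a, ha⟩ : A')
    rw [h1 g] at hg
    have : ‖a‖ = 0 := by simpa using hg.symm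
    exact norm_eq_zero.1 this
  · intro b hb hba
    obtain ⟨b', hb', _, ⟨c, hc, rfl⟩, rfl⟩ := Submodule.mem_sup.1 hb
    have h0 := hrz _ hba
    rw [map_add, hs'] at h0
    have hc0 : c = 0 := by
      refine Submodule.disjoint_def.1 hC.disjoint c ?_ hc
      rw [eq_neg_of_add_eq_zero_right h0]
      exact neg_mem (Submodule.mem_map_of_mem hb')
    subst hc0
    rw [map_zero, add_zero]
    refine hB' b' hb' fun a ha => ?_
    have := hba a ha
    simpa using this

/-- The order of the enlargements matters: first `B` receives `f` and functionals norming `A`, then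
`A` receives vectors norming the enlarged `B'`, and only then is `B'` completed to a duality. The
functionals added last need not be normed yet; that is left to the next step. -/
theorem exists_tower_step (A : Submodule ℝ X) (B : Submodule ℝ (StrongDual ℝ X))
    [FiniteDimensional ℝ A] [FiniteDimensional ℝ B] (f : StrongDual ℝ X) :
    ∃ (A₁ : Submodule ℝ X) (B₁ : Submodule ℝ (StrongDual ℝ X)),
      (FiniteDimensional ℝ A₁ ∧ FiniteDimensional ℝ B₁) ∧ A ≤ A₁ ∧ B ≤ B₁ ∧ f ∈ B₁ ∧
      (∀ a ∈ A₁, (∀ b ∈ B₁, b a = 0) → a = 0) ∧ (∀ b ∈ B₁, (∀ a ∈ A₁, b a = 0) → b = 0) ∧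
      (∀ a ∈ A, ‖a‖ ≤ 1.1 * ‖restr (NormedSpace.inclusionInDoubleDual ℝ X a) B₁‖) ∧
      (∀ b ∈ B, ‖b‖ ≤ 1.1 * ‖restr b A₁‖) := by
  obtain ⟨R, hR, hRn⟩ := exists_norming_subspace (NormedSpace.inclusionInDoubleDual ℝ X)
    (NormedSpace.inclusionInDoubleDualLi (E := X) ℝ).norm_map A
  let B' : Submodule ℝ (StrongDual ℝ X) := B ⊔ R ⊔ Submodule.span ℝ {f}
  obtain ⟨S, hS, hSn⟩ := exists_norming_subspace (ContinuousLinearMap.id ℝ (StrongDual ℝ X))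
    (fun _ => rfl) B'
  have hBn : ∀ b ∈ B', ‖b‖ ≤ 1.1 * ‖restr b (A ⊔ S)‖ := fun b hb => by
    refine (hSn b hb).trans ?_
    gcongr
    exact norm_restr_mono b le_sup_right
  obtain ⟨B₁, hB₁, hle, h1, h2⟩ := exists_duality (A ⊔ S) B' (by
    intro b hb hba
    have h := hBn b hb
    have h0 : ‖restr b (A ⊔ S)‖ ≤ 0 := norm_restr_le le_rfl fun y hy => by simp [hba y hy]
    have : ‖b‖ ≤ 0 := by nlinarith
    exact norm_le_zero_iff.1 this)
  refine ⟨A ⊔ S, B₁, ⟨inferInstance, hB₁⟩, le_sup_left, (le_sup_left.trans le_sup_left).trans hle,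
    hle (Submodule.mem_sup_right (Submodule.mem_span_singleton_self f)), h1, h2, ?_, ?_⟩
  · intro a ha
    refine (hRn a ha).trans ?_
    gcongr
    exact norm_restr_mono _ ((le_sup_right.trans le_sup_left).trans hle)
  · intro b hb
    exact hBn b ((le_sup_left.trans le_sup_left : B ≤ B') hb)

theorem exists_tower [TopologicalSpace.SeparableSpace (StrongDual ℝ X)] :
    ∃ (A : ℕ → Submodule ℝ X) (B : ℕ → Submodule ℝ (StrongDual ℝ X)), IsTower A B := by
  let P := {p : Submodule ℝ X × Submodule ℝ (StrongDual ℝ X) //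
    FiniteDimensional ℝ p.1 ∧ FiniteDimensional ℝ p.2}
  let d := TopologicalSpace.denseSeq (StrongDual ℝ X)
  have hstep : ∀ (n : ℕ) (p : P), ∃ p' : P, p.1.1 ≤ p'.1.1 ∧ p.1.2 ≤ p'.1.2 ∧ d n ∈ p'.1.2 ∧
      (∀ a ∈ p'.1.1, (∀ b ∈ p'.1.2, b a = 0) → a = 0) ∧
      (∀ b ∈ p'.1.2, (∀ a ∈ p'.1.1, b a = 0) → b = 0) ∧
      (∀ a ∈ p.1.1, ‖a‖ ≤ 1.1 * ‖restr (NormedSpace.inclusionInDoubleDual ℝ X a) p'.1.2‖) ∧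
      (∀ b ∈ p.1.2, ‖b‖ ≤ 1.1 * ‖restr b p'.1.1‖) := by
    intro n p
    have := p.2.1
    have := p.2.2
    obtain ⟨A₁, B₁, h, h'⟩ := exists_tower_step p.1.1 p.1.2 (d n)
    exact ⟨⟨(A₁, B₁), h⟩, h'⟩
  choose step hs using hstep
  let seq : ℕ → P := fun n => Nat.rec ⟨(⊥, ⊥), inferInstance, inferInstance⟩ step n
  have hseq : ∀ n, seq (n + 1) = step n (seq n) := fun _ => rfl
  refine ⟨fun n => (seq n).1.1, fun n => (seq n).1.2, fun n => (seq n).2.1, fun n => (seq n).2.2,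
    monotone_nat_of_le_succ fun n => (hs n (seq n)).1,
    monotone_nat_of_le_succ fun n => (hs n (seq n)).2.1, rfl, rfl, ?_, ?_, ?_,
    fun n => (hs n (seq n)).2.2.2.2.2.1, fun n => (hs n (seq n)).2.2.2.2.2.2⟩
  · intro n
    cases n with
    | zero => intro a ha _; exact (Submodule.mem_bot ℝ).1 ha
    | succ n => exact (hs n (seq n)).2.2.2.1
  · intro n
    cases n with
    | zero => intro a ha _; exact (Submodule.mem_bot ℝ).1 ha
    | succ n => exact (hs n (seq n)).2.2.2.2.1
  · rw [← Submodule.dense_iff_topologicalClosure_eq_top]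
    refine (TopologicalSpace.denseRange_denseSeq (StrongDual ℝ X)).mono ?_
    rintro _ ⟨n, rfl⟩
    exact Submodule.mem_iSup_of_mem (n + 1) (hs n (seq n)).2.2.1

namespace IsTower

variable {A : ℕ → Submodule ℝ X} {B : ℕ → Submodule ℝ (StrongDual ℝ X)}

theorem comp (h : IsTower A B) {N : ℕ → ℕ} (hN : StrictMono N) (hN0 : N 0 = 0) :
    IsTower (A ∘ N) (B ∘ N) where
  finA n := h.finA _
  finB n := h.finB _
  monoA := h.monoA.comp hN.monotone
  monoB := h.monoB.comp hN.monotone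
  zeroA := by simp [hN0, h.zeroA]
  zeroB := by simp [hN0, h.zeroB]
  sepA n := h.sepA _
  sepB n := h.sepB _
  denseB := by
    rw [← h.denseB]
    congr 1
    exact le_antisymm (iSup_le fun n => le_iSup B (N n))
      (iSup_le fun n => le_iSup_of_le n (h.monoB (hN.le_apply)))
  normA n a ha := by
    refine (h.normA _ a ha).trans ?_
    gcongr
    exact norm_restr_mono _ (h.monoB (hN n.lt_succ_self))
  normB n b hb := by
    refine (h.normB _ b hb).trans ?_
    gcongr
    exact norm_restr_mono _ (h.monoA (hN n.lt_succ_self))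

/-- If `f` vanishes on all `A n` and `b` in `B n` is η-close to `f`, then `b` is at most η on `A (n
+ 1)`, hence ‖b‖ ≤ 1.1η and ‖f‖ ≤ 2.1η. So only density in the dual has to be built in. -/
theorem denseA (h : IsTower A B) : (⨆ n, A n).topologicalClosure = ⊤ := by
  refine topologicalClosure_eq_top_of_forall_dual fun f hf => ?_
  have hle : ∀ η : ℝ, 0 < η → ‖f‖ ≤ 2.1 * η := by
    intro η hη
    have hd := Submodule.dense_iff_topologicalClosure_eq_top.2 h.denseB
    obtain ⟨b, hb, hbf⟩ := Metric.mem_closure_iff.1 (hd f) η hη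
    obtain ⟨n, hn⟩ := (Submodule.mem_iSup_of_directed B h.monoB.directed_le).1 hb
    rw [dist_eq_norm] at hbf
    have h1 : ‖restr b (A (n + 1))‖ ≤ ‖f - b‖ := norm_restr_le (norm_nonneg _) fun x hx => by
      have h0 := hf x (Submodule.mem_iSup_of_mem (n + 1) hx)
      have := (f - b).le_opNorm x
      simpa [h0] using this
    have h2 := h.normB n b hn
    have h3 : ‖f‖ ≤ ‖f - b‖ + ‖b‖ := by simpa using norm_add_le (f - b) b
    linarith
  by_contra hne
  have := hle (‖f‖ / 3) (by positivity)
  have : 0 < ‖f‖ := norm_pos_iff.2 hne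
  linarith

theorem exists_predual_representative (h : IsTower A B) (n : ℕ) (x : X) :
    ∃ a ∈ A n, ∀ b ∈ B n, b a = b x := by
  have := h.finA n
  have := h.finB n
  exact exists_representative_of_separating (ContinuousLinearMap.id ℝ (StrongDual ℝ X))
    (h.sepB n) x

theorem exists_dual_representative (h : IsTower A B) (n : ℕ) (f : StrongDual ℝ X) :
    ∃ b ∈ B n, ∀ a ∈ A n, b a = f a := by
  have := h.finA n
  have := h.finB n
  exact exists_representative_of_separating (NormedSpace.inclusionInDoubleDual ℝ X)
    (h.sepA n) f

end IsTower

/-- The decomposition of `X` defined by the tower. -/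
def towerDecomp (A : ℕ → Submodule ℝ X) (B : ℕ → Submodule ℝ (StrongDual ℝ X)) (n : ℕ) :
    Submodule ℝ X :=
  A n ⊓ ann (ContinuousLinearMap.id ℝ (StrongDual ℝ X)) (B (n - 1))

namespace IsTower

variable {A : ℕ → Submodule ℝ X} {B : ℕ → Submodule ℝ (StrongDual ℝ X)}

theorem blockSum_towerDecomp (h : IsTower A B) {m n : ℕ} (hmn : m ≤ n) :
    blockSum (towerDecomp A B) m n =
      A n ⊓ ann (ContinuousLinearMap.id ℝ (StrongDual ℝ X)) (B (m - 1)) :=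
  blockSum_inf_ann _ h.monoA h.monoB h.zeroA h.exists_predual_representative m n hmn

theorem towerDecomp_zero (h : IsTower A B) : towerDecomp A B 0 = ⊥ := by
  simp [towerDecomp, h.zeroA]

theorem le_of_forall_towerDecomp_le (h : IsTower A B) {n : ℕ} {S : Submodule ℝ X}
    (hS : ∀ j ≤ n, towerDecomp A B j ≤ S) : A n ≤ S := by
  have h1 : A n = blockSum (towerDecomp A B) 0 n := by
    rw [h.blockSum_towerDecomp (Nat.zero_le n), left_eq_inf]
    intro a _ b hb
    simp only [h.zeroB, Nat.zero_sub, Submodule.mem_bot] at hb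
    simp [hb]
  rw [h1]
  exact iSup₂_le fun j hj => hS j (Finset.mem_Icc.1 hj).2

theorem iSup_towerDecomp (h : IsTower A B) : ⨆ n, towerDecomp A B n = ⨆ n, A n :=
  le_antisymm (iSup_mono fun _ => inf_le_left)
    (iSup_le fun _ => h.le_of_forall_towerDecomp_le fun j _ => le_iSup (towerDecomp A B) j)

theorem fundamental (h : IsTower A B) : (⨆ n, towerDecomp A B n).topologicalClosure = ⊤ := by
  rw [h.iSup_towerDecomp, h.denseA]

theorem mem_biorth_iff {E : ℕ → Submodule ℝ X} {k : ℕ} {f : StrongDual ℝ X} :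
    f ∈ biorth E k ↔ ∀ j, j ≠ k → ∀ x ∈ E j, f x = 0 := by
  constructor
  · intro hf j hj x hx
    exact hf x ((le_iSup₂ (f := fun i (_ : i ≠ k) => E i) j hj) hx)
  · intro hf
    have : (⨆ (j : ℕ) (_ : j ≠ k), E j) ≤ LinearMap.ker f.toLinearMap :=
      iSup₂_le fun j hj x hx => hf j hj x hx
    exact fun x hx => this hx

theorem vanish_of_lt (h : IsTower A B) {n j : ℕ} (hnj : n < j) {b : StrongDual ℝ X} (hb : b ∈ B n)
    {x : X} (hx : x ∈ towerDecomp A B j) : b x = 0 :=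
  hx.2 b (h.monoB (by omega) hb)

/-- A functional `f` of the left side and the `b` in `B n` agreeing with it on `A n` both vanish on
all later summands, so they coincide by density. The construction is thus symmetric in `A` and `B`.
-/
theorem biorth_towerDecomp (h : IsTower A B) : biorth (towerDecomp A B) =
    fun n => B n ⊓ ann (NormedSpace.inclusionInDoubleDual ℝ X) (A (n - 1)) := by
  funext n
  ext f
  rw [mem_biorth_iff]
  constructor
  · intro hf
    obtain ⟨b, hb, hba⟩ := h.exists_dual_representative n f
    have hfb : f = b := by
      refine dual_ext_of_topologicalClosure_eq_top h.fundamental fun j x hx => ?_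
      rcases le_or_gt j n with hj | hj
      · exact (hba x (h.monoA hj hx.1)).symm
      · rw [hf j hj.ne' x hx, h.vanish_of_lt hj hb hx]
    refine ⟨hfb ▸ hb, fun a ha => ?_⟩
    rcases Nat.eq_zero_or_pos n with rfl | hn
    · simp only [Nat.zero_sub, h.zeroA, Submodule.mem_bot] at ha
      simp [ha]
    · have : A (n - 1) ≤ LinearMap.ker f.toLinearMap :=
        h.le_of_forall_towerDecomp_le fun j hj x hx => hf j (by omega) x hx
      exact this ha
  · rintro ⟨hb, hba⟩ j hj x hx
    rcases lt_or_gt_of_ne hj with hj | hj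
    · exact hba x (h.monoA (by omega) hx.1)
    · exact h.vanish_of_lt hj hb hx

theorem blockSum_biorth (h : IsTower A B) {m n : ℕ} (hmn : m ≤ n) :
    blockSum (biorth (towerDecomp A B)) m n =
      B n ⊓ ann (NormedSpace.inclusionInDoubleDual ℝ X) (A (m - 1)) := by
  rw [h.biorth_towerDecomp]
  exact blockSum_inf_ann _ h.monoB h.monoA h.zeroB h.exists_dual_representative m n hmn

theorem le_iSup_biorth (h : IsTower A B) (n : ℕ) : B n ≤ ⨆ k, biorth (towerDecomp A B) k := by
  have h1 : B n ≤ blockSum (biorth (towerDecomp A B)) 0 n := by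
    rw [h.blockSum_biorth (Nat.zero_le n)]
    refine le_inf le_rfl fun b _ a ha => ?_
    simp only [h.zeroA, Nat.zero_sub, Submodule.mem_bot] at ha
    simp [ha]
  exact h1.trans (iSup₂_le fun j _ => le_iSup (biorth (towerDecomp A B)) j)

theorem isShrinking (h : IsTower A B) : IsShrinking (towerDecomp A B) := by
  unfold IsShrinking
  rw [eq_top_iff, ← h.denseB]
  exact Submodule.topologicalClosure_mono (iSup_le h.le_iSup_biorth)

theorem isFMD (h : IsTower A B) : IsFMD (towerDecomp A B) where
  finiteDimensional k := by
    have := h.finA k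
    exact Submodule.finiteDimensional_of_le (inf_le_left : towerDecomp A B k ≤ A k)
  fundamental := h.fundamental
  minimal k := by
    rw [eq_bot_iff]
    rintro x ⟨hx, hx'⟩
    refine (Submodule.mem_bot ℝ).2 (h.sepA k x hx.1 fun b hb => ?_)
    have hvan : ∀ f ∈ biorth (towerDecomp A B) k, f x = 0 := by
      intro f hf
      have : (⨆ (j : ℕ) (_ : j ≠ k), towerDecomp A B j).topologicalClosure ≤
          LinearMap.ker f.toLinearMap :=
        Submodule.topologicalClosure_minimal _ (fun y hy => hf y hy) f.isClosed_ker
      exact this hx'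
    -- Each `b` in `B k` is the sum of a member of the k-th biorthogonal space, which kills the
    -- closed span of the other summands, and a member of `B (k - 1)`, which kills `E k`.
    obtain ⟨b', hb', hbb'⟩ := h.exists_dual_representative (k - 1) b
    have h1 : b - b' ∈ biorth (towerDecomp A B) k := by
      rw [h.biorth_towerDecomp]
      refine ⟨(B k).sub_mem hb (h.monoB (Nat.sub_le k 1) hb'), fun a ha => ?_⟩
      simp [hbb' a ha]
    have h2 := hvan _ h1
    have h3 : b' x = 0 := hx.2 b' hb'
    simpa [h3] using h2
  total x hx := by
    refine SeparatingDual.eq_zero_of_forall_dual_eq_zero (R := ℝ) fun f => ?_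
    have : (⨆ k, biorth (towerDecomp A B) k).topologicalClosure ≤
        LinearMap.ker (NormedSpace.inclusionInDoubleDual ℝ X x).toLinearMap :=
      Submodule.topologicalClosure_minimal _ (iSup_le fun k f hf => hx k f hf)
        (NormedSpace.inclusionInDoubleDual ℝ X x).isClosed_ker
    exact this (h.isShrinking ▸ Submodule.mem_top : f ∈ _)

/-- Any functional can be cut off to the blocks strictly between `p` and `q`. -/
theorem exists_part (h : IsTower A B) (g : StrongDual ℝ X) (p q : ℕ) :
    ∃ f : StrongDual ℝ X, (∀ l ∈ Set.Ioo p q, ∀ x ∈ towerDecomp A B l, f x = g x) ∧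
      ∀ l ∉ Set.Ioo p q, ∀ x ∈ towerDecomp A B l, f x = 0 := by
  by_cases hpq : p < q
  · obtain ⟨b, hb, hbg⟩ := h.exists_dual_representative (q - 1) g
    obtain ⟨b', hb', hbg'⟩ := h.exists_dual_representative p g
    refine ⟨b - b', ?_, ?_⟩
    · rintro l ⟨h1, h2⟩ x hx
      rw [sub_apply, h.vanish_of_lt h1 hb' hx, hbg x (h.monoA (by omega) hx.1), sub_zero]
    · intro l hl x hx
      rw [Set.mem_Ioo, not_and_or, not_lt, not_lt] at hl
      rw [sub_apply]
      rcases hl with hl | hl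
      · rw [hbg x (h.monoA (by omega) hx.1), hbg' x (h.monoA hl hx.1), sub_self]
      · rw [h.vanish_of_lt (by omega) hb hx, h.vanish_of_lt (by omega) hb' hx, sub_self]
  · exact ⟨0, fun l hl => absurd (hl.1.trans hl.2) hpq, by simp⟩

/-- The two norming estimates are `norming_ann` with c = 1.1, as 1.1·2.1 = 2.31; the two extension
estimates follow from them by finite dimensional duality. -/
theorem blockEstimates (h : IsTower A B) : BlockEstimates (towerDecomp A B) := by
  have hconst : (1.1 : ℝ) * (1 + 1.1) ≤ 2.5 := by norm_num
  have hfinE : ∀ m n, m ≤ n → FiniteDimensional ℝ (blockSum (towerDecomp A B) m n) := by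
    intro m n hmn
    have := h.finA n
    rw [h.blockSum_towerDecomp hmn]
    exact Submodule.finiteDimensional_of_le inf_le_left
  have hfinF : ∀ m n, m ≤ n → FiniteDimensional ℝ (blockSum (biorth (towerDecomp A B)) m n) := by
    intro m n hmn
    have := h.finB n
    rw [h.blockSum_biorth hmn]
    exact Submodule.finiteDimensional_of_le inf_le_left
  have hdual : ∀ m n, 1 ≤ m → m ≤ n → ∀ f ∈ blockSum (biorth (towerDecomp A B)) m n,
      ‖f‖ ≤ 2.5 * ‖restr f (blockSum (towerDecomp A B) (m - 1) (n + 1))‖ := by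
    intro m n hm hmn f hf
    rw [h.blockSum_biorth hmn] at hf
    rw [h.blockSum_towerDecomp (by omega)]
    have := h.finA (m - 1)
    have := h.finB (m - 1 - 1)
    refine (norming_ann (ContinuousLinearMap.id ℝ (StrongDual ℝ X)) (fun _ => le_rfl)
      (by norm_num) (h.monoA (show m - 1 ≤ n + 1 by omega)) (A₀ := B (m - 1 - 1)) ?_ hf.2
      (h.normB n f hf.1)).trans (mul_le_mul_of_nonneg_right hconst (ContinuousLinearMap.opNorm_nonneg _))
    intro b hb
    refine (h.normB _ b hb).trans ?_
    gcongr
    -- For m = 1 truncated subtraction gives m - 2 = m - 1 = 0, so the tower estimate between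
    -- consecutive indices is unavailable; but `B 0` is null.
    rcases Nat.eq_zero_or_pos (m - 1) with h0 | h0
    · simp only [h0, Nat.zero_sub, h.zeroB, Submodule.mem_bot] at hb
      subst hb
      refine (norm_restr_le le_rfl fun y _ => by simp).trans (ContinuousLinearMap.opNorm_nonneg _)
    · exact norm_restr_mono _ (h.monoA (by omega))
  have hpredual : ∀ m n, 1 ≤ m → m ≤ n → ∀ x ∈ blockSum (towerDecomp A B) m n,
      ‖x‖ ≤ 2.5 * ‖restr (NormedSpace.inclusionInDoubleDual ℝ X x)
        (blockSum (biorth (towerDecomp A B)) (m - 1) (n + 1))‖ := by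
    intro m n hm hmn f hf
    rw [h.blockSum_towerDecomp hmn] at hf
    rw [h.blockSum_biorth (by omega)]
    have := h.finB (m - 1)
    have := h.finA (m - 1 - 1)
    refine (norming_ann (NormedSpace.inclusionInDoubleDual ℝ X)
      (NormedSpace.double_dual_bound ℝ X)
      (by norm_num) (h.monoB (show m - 1 ≤ n + 1 by omega)) (A₀ := A (m - 1 - 1)) ?_ hf.2
      (h.normA n f hf.1)).trans (mul_le_mul_of_nonneg_right hconst (ContinuousLinearMap.opNorm_nonneg _))
    intro b hb
    refine (h.normA _ b hb).trans ?_
    gcongr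
    rcases Nat.eq_zero_or_pos (m - 1) with h0 | h0
    · simp only [h0, Nat.zero_sub, h.zeroA, Submodule.mem_bot] at hb
      subst hb
      refine (norm_restr_le le_rfl fun y _ => by simp).trans (ContinuousLinearMap.opNorm_nonneg _)
    · exact norm_restr_mono _ (h.monoB (by omega))
  refine ⟨?_, ?_, hdual, hpredual⟩
  · intro m n hm hmn e
    have := hfinF (m - 1) (n + 1) (by omega)
    obtain ⟨f, hf, hfn⟩ := exists_representative
      (V := blockSum (towerDecomp A B) m n)
      (U := blockSum (biorth (towerDecomp A B)) (m - 1) (n + 1))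
      { toFun := fun x => restr (NormedSpace.inclusionInDoubleDual ℝ X x) _
        map_add' := by intro a b; ext; simp [restr]
        map_smul' := by intro r a; ext; simp [restr] } (c := 2.5) (by norm_num)
      (fun x => hpredual m n hm hmn x x.2) e
    exact ⟨f, f.2, by ext x; exact hf x, hfn⟩
  · intro m n hm hmn e
    have := hfinE (m - 1) (n + 1) (by omega)
    obtain ⟨f, hf, hfn⟩ := exists_representative
      (V := blockSum (biorth (towerDecomp A B)) m n)
      (U := blockSum (towerDecomp A B) (m - 1) (n + 1))
      { toFun := fun x => restr (x : StrongDual ℝ X) _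
        map_add' := by intro a b; ext; simp [restr]
        map_smul' := by intro r a; ext; simp [restr] } (c := 2.5) (by norm_num)
      (fun x => hdual m n hm hmn x x.2) e
    exact ⟨f, f.2, by ext x; exact hf x, hfn⟩

end IsTower

end Tower

/-! ### The game for conditional sequences and the combination of winning strategies. -/

section Game

variable {Y : Type*} [NormedAddCommGroup Y] [NormedSpace ℝ Y]

/-- `SignComb s u v`: for some coefficients `a` and signs `σ`, `u = ∑ a i • s i` and
`v = ∑ σ i • a i • s i`. -/
inductive SignComb : List Y → Y → Y → Prop
  | nil : SignComb [] 0 0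
  | cons {s : List Y} {u v : Y} (x : Y) (a σ : ℝ) (hσ : σ = 1 ∨ σ = -1) (h : SignComb s u v) :
      SignComb (x :: s) (u + a • x) (v + (σ * a) • x)

/-- The finite sequence `s` is unconditional with constant `C`. -/
def UncList (C : ℝ) (s : List Y) : Prop :=
  ∀ u v, SignComb s u v → ‖v‖ ≤ C * ‖u‖

theorem SignComb.zero : ∀ s : List Y, SignComb s 0 0
  | [] => .nil
  | x :: s => by simpa using (SignComb.zero s).cons x 0 1 (Or.inl rfl)

theorem SignComb.append_left {s : List Y} {u v : Y} (h : SignComb s u v) (t : List Y) :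
    SignComb (s ++ t) u v := by
  induction h with
  | nil => exact SignComb.zero t
  | cons x a σ hσ _ ih => exact ih.cons x a σ hσ

theorem UncList.of_append {C : ℝ} {s t : List Y} (h : UncList C (s ++ t)) : UncList C s :=
  fun u v huv => h u v (huv.append_left t)

theorem uncList_nil {C : ℝ} : UncList C ([] : List Y) := by
  rintro _ _ ⟨⟩
  simp

/-- Strategies that are won after finitely many moves. -/
inductive Strat (Y : Type*)
  | done : Strat Y
  | node (v : ℕ → Y) (next : ℕ → Strat Y) : Strat Y

/-- The strategy makes legal moves and produces a sequence that is not unconditional with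
constant `C`, starting from the position `s`. The last move comes first in the list. -/
def Wins (legal : ℕ → Y → Prop) (C : ℝ) : List Y → Strat Y → Prop
  | s, .done => ¬ UncList C s
  | s, .node v next => ∀ k, legal k (v k) ∧ Wins legal C (v k :: s) (next k)

/-- There is a winning strategy from the position `s`. -/
def Lost (legal : ℕ → Y → Prop) (C : ℝ) (s : List Y) : Prop :=
  ∃ T, Wins legal C s T

variable {legal : ℕ → Y → Prop} {C : ℝ}

theorem uncList_of_not_lost {s : List Y} (h : ¬ Lost legal C s) : UncList C s := by
  by_contra hs
  exact h ⟨.done, hs⟩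

/-- Otherwise every `k` has an answer leading to a lost position, and the winning strategies from
these positions combine into one from `s`. -/
theorem exists_of_not_lost {s : List Y} (h : ¬ Lost legal C s) :
    ∃ k, ∀ x, legal k x → ¬ Lost legal C (x :: s) := by
  by_contra! hcon
  choose v hv next hnext using hcon
  exact h ⟨.node v next, fun k => ⟨hv k, hnext k⟩⟩

section Tree

variable (v₀ : ℕ → ℕ → Y) (next₀ : ℕ → ℕ → Strat Y)

/-- One move of the combination of strategies for all constants `n`. -/
def move : ℕ × Strat Y → ℕ → Y × (ℕ × Strat Y)
  | (n, .node v next), k => (v k, (n, next k))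
  | (n, .done), k => (v₀ (n + 1) k, (n + 1, next₀ (n + 1) k))

/-- The state of the game after the answers to the moves in `l`. -/
def gameState (l : List ℕ) : ℕ × Strat Y :=
  l.foldl (fun S k => (move v₀ next₀ S k).2) (0, .node (v₀ 0) (next₀ 0))

/-- The tree of all answers. -/
def gameTree (t : Finset ℕ) : Y :=
  (move v₀ next₀ (gameState v₀ next₀ ((t.erase (t.sup id)).sort (· ≤ ·))) (t.sup id)).1

theorem sort_insert_of_lt {t : Finset ℕ} {k : ℕ} (hk : ∀ i ∈ t, i < k) :
    (insert k t).sort (· ≤ ·) = t.sort (· ≤ ·) ++ [k] := by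
  have hkt : k ∉ t := fun h => lt_irrefl _ (hk k h)
  refine List.Perm.eq_of_pairwise' (r := (· ≤ ·)) ?_ ?_ ?_
  · exact Finset.pairwise_sort _ _
  · rw [List.pairwise_append]
    refine ⟨Finset.pairwise_sort _ _, by simp, ?_⟩
    intro a ha b hb
    rw [List.mem_singleton.1 hb]
    exact (hk a (by simpa using ha)).le
  · rw [List.perm_ext_iff_of_nodup (Finset.sort_nodup _ _)]
    · intro a
      simp [or_comm]
    · rw [List.nodup_append]
      refine ⟨Finset.sort_nodup _ _, by simp, ?_⟩
      intro a ha b hb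
      rw [List.mem_singleton.1 hb]
      exact (hk a (by simpa using ha)).ne

omit [NormedAddCommGroup Y] [NormedSpace ℝ Y] in
theorem gameState_insert {t : Finset ℕ} {k : ℕ} (hk : ∀ i ∈ t, i < k) :
    gameState v₀ next₀ ((insert k t).sort (· ≤ ·)) =
      (move v₀ next₀ (gameState v₀ next₀ (t.sort (· ≤ ·))) k).2 := by
  rw [sort_insert_of_lt hk, gameState, List.foldl_append]
  rfl

omit [NormedAddCommGroup Y] [NormedSpace ℝ Y] in
theorem gameTree_insert {t : Finset ℕ} {k : ℕ} (hk : ∀ i ∈ t, i < k) :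
    gameTree v₀ next₀ (insert k t) =
      (move v₀ next₀ (gameState v₀ next₀ (t.sort (· ≤ ·))) k).1 := by
  have h1 : (insert k t).sup id = k := by
    rw [Finset.sup_insert, id, sup_eq_left]
    exact Finset.sup_le fun i hi => (hk i hi).le
  have h2 : (insert k t).erase k = t := Finset.erase_insert fun h => lt_irrefl _ (hk k h)
  rw [gameTree, h1, h2]

variable (hw : ∀ n : ℕ, Wins legal (n : ℝ) [] (.node (v₀ n) (next₀ n)))

include hw in
-- The invariant: only the recent part `s` of the history belongs to the current strategy, and the
-- older moves `o` are ignored. Once a strategy is done, the strategy for the next constant starts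
-- with a fresh segment.
theorem move_legal {S : ℕ × Strat Y} (hS : ∃ s, Wins legal (S.1 : ℝ) s S.2) (k : ℕ) :
    legal k (move v₀ next₀ S k).1 ∧
      ∀ h s o : List Y, h = s ++ o → Wins legal (S.1 : ℝ) s S.2 →
      ∃ s' o', (move v₀ next₀ S k).1 :: h = s' ++ o' ∧
        Wins legal ((move v₀ next₀ S k).2.1 : ℝ) s' (move v₀ next₀ S k).2.2 := by
  obtain ⟨s, hs⟩ := hS
  obtain ⟨n, T⟩ := S
  cases T with
  | done =>
    refine ⟨(hw (n + 1) k).1, fun h s o hh hs => ⟨[v₀ (n + 1) k], h, rfl, (hw (n + 1) k).2⟩⟩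
  | node v next =>
    refine ⟨(hs k).1, fun h s o hh hs => ⟨v k :: s, o, ?_, (hs k).2⟩⟩
    rw [hh]; rfl

include hw in
theorem gameState_wins (l : List ℕ) :
    ∃ s, Wins legal ((gameState v₀ next₀ l).1 : ℝ) s (gameState v₀ next₀ l).2 := by
  induction l using List.reverseRecOn with
  | nil => exact ⟨[], hw 0⟩
  | append_singleton l k ih =>
    obtain ⟨s, hs⟩ := ih
    obtain ⟨s', -, -, h⟩ := (move_legal v₀ next₀ hw ⟨s, hs⟩ k).2 s s [] (by simp) hs
    refine ⟨s', ?_⟩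
    rw [gameState, List.foldl_append]
    exact h

include hw in
theorem gameTree_legal {t : Finset ℕ} {k : ℕ} (hk : ∀ i ∈ t, i < k) :
    legal k (gameTree v₀ next₀ (insert k t)) := by
  rw [gameTree_insert v₀ next₀ hk]
  exact (move_legal v₀ next₀ hw (gameState_wins v₀ next₀ hw _) k).1

include hw in
theorem gameTree_exists_legal (t : Finset ℕ) : ∃ k, legal k (gameTree v₀ next₀ t) :=
  ⟨_, (move_legal v₀ next₀ hw (gameState_wins v₀ next₀ hw _) _).1⟩

theorem signComb_sum {y : ℕ → Y} {hist : ℕ → List Y} (h0 : hist 0 = [])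
    (hs : ∀ i, hist (i + 1) = y i :: hist i) (N : ℕ) :
    ∀ u v, SignComb (hist N) u v → ∃ a σ : ℕ → ℝ, (∀ i, σ i = 1 ∨ σ i = -1) ∧
      u = ∑ i ∈ Finset.range N, a i • y i ∧ v = ∑ i ∈ Finset.range N, (σ i * a i) • y i := by
  induction N with
  | zero =>
    intro u v h
    rw [h0] at h
    cases h
    exact ⟨0, 1, fun _ => Or.inl rfl, by simp, by simp⟩
  | succ N ih =>
    intro u v h
    rw [hs] at h
    cases h with
    | cons x a σ hσ h =>
      obtain ⟨a', σ', hσ', rfl, rfl⟩ := ih _ _ h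
      refine ⟨Function.update a' N a, Function.update σ' N σ, fun i => ?_, ?_, ?_⟩
      · rcases eq_or_ne i N with rfl | hi
        · simpa using hσ
        · simpa [hi] using hσ' i
      all_goals
        rw [Finset.sum_range_succ]
        simp only [Function.update_self]
        congr 1
        refine Finset.sum_congr rfl fun i hi => ?_
        have : i ≠ N := (Finset.mem_range.1 hi).ne
        simp [this]

include hw in
/-- No branch of the tree is unconditional. -/
theorem not_isUnconditionalSeq_gameTree {κ : ℕ → ℕ} (hκ : StrictMono κ) :
    ¬ IsUnconditionalSeq
      (fun i => gameTree v₀ next₀ ((Finset.range (i + 1)).image κ)) := by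
  rintro ⟨C, hC⟩
  let S : ℕ → ℕ × Strat Y := fun i =>
    gameState v₀ next₀ (((Finset.range i).image κ).sort (· ≤ ·))
  have hins : ∀ i, (Finset.range (i + 1)).image κ = insert (κ i) ((Finset.range i).image κ) := by
    intro i
    rw [Finset.range_add_one, Finset.image_insert]
  have hlt : ∀ i, ∀ j ∈ (Finset.range i).image κ, j < κ i := by
    intro i j hj
    obtain ⟨l, hl, rfl⟩ := Finset.mem_image.1 hj
    exact hκ (Finset.mem_range.1 hl)
  have hS : ∀ i, S (i + 1) = (move v₀ next₀ (S i) (κ i)).2 := by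
    intro i
    simp only [S]
    rw [hins, gameState_insert v₀ next₀ (hlt i)]
  have hS0 : S 0 = (0, .node (v₀ 0) (next₀ 0)) := by simp [S, gameState]
  let y : ℕ → Y := fun i => gameTree v₀ next₀ ((Finset.range (i + 1)).image κ)
  have hy : ∀ i, y i = (move v₀ next₀ (S i) (κ i)).1 := by
    intro i
    simp only [y, S]
    rw [hins, gameTree_insert v₀ next₀ (hlt i)]
  let hist : ℕ → List Y := fun i => Nat.rec [] (fun i l => y i :: l) i
  have hvalid : ∀ i, ∃ s o, hist i = s ++ o ∧ Wins legal ((S i).1 : ℝ) s (S i).2 := by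
    intro i
    induction i with
    | zero => exact ⟨[], [], rfl, by rw [hS0]; exact hw 0⟩
    | succ i ih =>
      obtain ⟨s, o, hso, hsw⟩ := ih
      obtain ⟨s', o', h1, h2⟩ := (move_legal v₀ next₀ hw ⟨s, hsw⟩ (κ i)).2 _ s o hso hsw
      refine ⟨s', o', ?_, ?_⟩
      · rw [← h1, ← hy]
      · rw [hS]; exact h2
  -- Strategies are well-founded trees, so along every branch each is completed after finitely many
  -- moves, and all constants get their turn.
  have hprog : ∀ (T : Strat Y) (i n : ℕ), S i = (n, T) → ∃ i', S i' = (n, .done) := by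
    intro T
    induction T with
    | done => intro i n h; exact ⟨i, h⟩
    | node v next ih =>
      intro i n h
      refine ih (κ i) (i + 1) n ?_
      rw [hS, h]; rfl
  have hall : ∀ n, ∃ i, S i = (n, .done) := by
    intro n
    induction n with
    | zero => exact hprog _ 0 0 hS0
    | succ n ih =>
      obtain ⟨i, hi⟩ := ih
      refine hprog (next₀ (n + 1) (κ i)) (i + 1) (n + 1) ?_
      rw [hS, hi]; rfl
  -- When the strategy for some n ≥ C is completed, the recent segment is not unconditional with
  -- constant n; zero coefficients on the older moves contradict unconditionality of the branch.
  obtain ⟨n, hn⟩ := exists_nat_ge C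
  obtain ⟨i, hi⟩ := hall n
  obtain ⟨s, o, hso, hsw⟩ := hvalid i
  rw [hi] at hsw
  refine hsw (UncList.of_append (t := o) ?_)
  rw [← hso]
  intro u v huv
  obtain ⟨a, σ, hσ, rfl, rfl⟩ := signComb_sum (y := y) (hist := hist) rfl (fun _ => rfl) i u v huv
  refine (hC i a σ hσ).trans ?_
  gcongr

end Tree

/-- If every tree of legal moves has an unconditional branch, then for some constant the
player who aims at a conditional sequence has no winning strategy. -/
theorem exists_not_lost
    (h : ∀ x : Finset ℕ → Y, (∀ t, ∃ k, legal k (x t)) →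
      (∀ t k, (∀ i ∈ t, i < k) → legal k (x (insert k t))) →
      ∃ κ : ℕ → ℕ, StrictMono κ ∧
        IsUnconditionalSeq (fun i => x ((Finset.range (i + 1)).image κ))) :
    ∃ n : ℕ, ¬ Lost legal (n : ℝ) [] := by
  by_contra! hcon
  have : ∀ n : ℕ, ∃ v next, Wins legal (n : ℝ) [] (.node v next) := by
    intro n
    obtain ⟨T, hT⟩ := hcon n
    cases T with
    | done => exact absurd uncList_nil hT
    | node v next => exact ⟨v, next, hT⟩
  choose v₀ next₀ hw using this
  obtain ⟨κ, hκ, hu⟩ := h (gameTree v₀ next₀) (gameTree_exists_legal v₀ next₀ hw)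
    (fun t k hk => gameTree_legal v₀ next₀ hw hk)
  exact not_isUnconditionalSeq_gameTree v₀ next₀ hw hκ hu

end Game

/-! ### Blocking the tower: skipped sequences of functionals are unconditional. -/

section Blocking

variable {X : Type*} [NormedAddCommGroup X] [NormedSpace ℝ X]

theorem notMem_dualSupp {E : ℕ → Submodule ℝ X} {f : StrongDual ℝ X} {l : ℕ} :
    l ∉ dualSupp E f ↔ ∀ x ∈ E l, f x = 0 := by
  simp [dualSupp]

theorem IsTower.mem_of_dualSupp {A : ℕ → Submodule ℝ X} {B : ℕ → Submodule ℝ (StrongDual ℝ X)}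
    (h : IsTower A B) {f : StrongDual ℝ X} {p q : ℕ}
    (hf : dualSupp (towerDecomp A B) f ⊆ Set.Ioo p q) :
    f ∈ B (q - 1) ⊓ ann (NormedSpace.inclusionInDoubleDual ℝ X) (A p) := by
  have hf' : ∀ l, ¬ (p < l ∧ l < q) → ∀ x ∈ towerDecomp A B l, f x = 0 :=
    fun l hl => notMem_dualSupp.1 fun hl' => hl (hf hl')
  obtain ⟨b, hb, hbf⟩ := h.exists_dual_representative (q - 1) f
  have hfb : f = b := by
    refine dual_ext_of_topologicalClosure_eq_top h.fundamental fun j x hx => ?_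
    rcases le_or_gt j (q - 1) with hj | hj
    · exact (hbf x (h.monoA hj hx.1)).symm
    · rw [hf' j (by omega) x hx, h.vanish_of_lt hj hb hx]
  refine ⟨hfb ▸ hb, fun a ha => ?_⟩
  have : A p ≤ LinearMap.ker f.toLinearMap :=
    h.le_of_forall_towerDecomp_le fun j hj x hx => hf' j (by omega) x hx
  exact this ha

/-- The moves in the game: normalized functionals vanishing on `A k`. -/
def LegalMove (A : ℕ → Submodule ℝ X) (k : ℕ) (f : StrongDual ℝ X) : Prop :=
  ‖f‖ = 1 ∧ ∀ a ∈ A k, f a = 0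

/-- Bounded functionals vanishing on `A k` tend weak* to zero as k grows, because the union of the
`A n` is dense. So trees of legal moves are weak* null trees. -/
theorem exists_not_lost_of_weakStarUTP (hX : WeakStarUTP X) {A : ℕ → Submodule ℝ X}
    (hmono : Monotone A) (hdense : (⨆ n, A n).topologicalClosure = ⊤) :
    ∃ n : ℕ, ¬ Lost (LegalMove A) (n : ℝ) [] := by
  refine exists_not_lost fun x h1 h2 => hX x (fun t => (h1 t).choose_spec.1) fun t => ?_
  refine tendsto_iff_forall_eval_tendsto_topDualPairing.2 fun z => ?_
  rw [Metric.tendsto_atTop]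
  intro η hη
  have hd := Submodule.dense_iff_topologicalClosure_eq_top.2 hdense
  obtain ⟨a, ha, hza⟩ := Metric.mem_closure_iff.1 (hd z) η hη
  obtain ⟨n, hn⟩ := (Submodule.mem_iSup_of_directed A hmono.directed_le).1 ha
  refine ⟨max n (t.sup id + 1), fun k hk => ?_⟩
  have hlt : ∀ i ∈ t, i < k := fun i hi => by
    have := Finset.le_sup (f := id) hi
    simp only [id] at this
    omega
  have hl := h2 t k hlt
  have ha0 := hl.2 a (hmono (by omega) hn)
  have h3 : x (insert k t) z = x (insert k t) (z - a) := by rw [map_sub, ha0, sub_zero]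
  change dist (x (insert k t) z) 0 < η
  rw [dist_zero_right, h3]
  refine ((x (insert k t)).le_opNorm _).trans_lt ?_
  rw [hl.1, one_mul, ← dist_eq_norm]
  exact hza

section Combinatorics

variable {A : ℕ → Submodule ℝ X} {B : ℕ → Submodule ℝ (StrongDual ℝ X)}

/-- The blocking of the tower: after `i` steps, its last index and the positions of the game that
have to be taken care of. -/
def blockingData (D : ℕ → ℕ → Finset (StrongDual ℝ X)) (K : List (StrongDual ℝ X) → ℕ) :
    ℕ → ℕ × Set (List (StrongDual ℝ X))
  | 0 => (0, {[]})
  | i + 1 =>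
    let N := (blockingData D K i).1 + 1 + sSup (K '' (blockingData D K i).2)
    (N, (blockingData D K i).2 ∪
      Set.image2 List.cons (⋃ p ∈ Set.Iic N, (D p N : Set (StrongDual ℝ X))) (blockingData D K i).2)

variable (D : ℕ → ℕ → Finset (StrongDual ℝ X)) (K : List (StrongDual ℝ X) → ℕ)

theorem blockingData_finite (i : ℕ) : (blockingData D K i).2.Finite := by
  induction i with
  | zero => exact Set.finite_singleton _
  | succ i ih =>
    refine ih.union (Set.Finite.image2 _ ?_ ih)
    exact (Set.finite_Iic _).biUnion fun p _ => Finset.finite_toSet _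

theorem blockingData_strictMono : StrictMono fun i => (blockingData D K i).1 :=
  strictMono_nat_of_lt_succ fun i => by
    simp only [blockingData]
    omega

theorem blockingData_mono : Monotone fun i => (blockingData D K i).2 :=
  monotone_nat_of_le_succ fun _ => Set.subset_union_left

theorem blockingData_le {i : ℕ} {s : List (StrongDual ℝ X)} (hs : s ∈ (blockingData D K i).2) :
    K s ≤ (blockingData D K (i + 1)).1 := by
  have := le_csSup ((blockingData_finite D K i).image K).bddAbove (Set.mem_image_of_mem K hs)
  simp only [blockingData]
  omega

theorem cons_mem_blockingData {i p : ℕ} {s : List (StrongDual ℝ X)}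
    (hs : s ∈ (blockingData D K i).2) {y : StrongDual ℝ X} (hp : p ≤ i + 1)
    (hy : y ∈ D (blockingData D K p).1 (blockingData D K (i + 1)).1) :
    y :: s ∈ (blockingData D K (i + 1)).2 := by
  refine Or.inr ⟨y, ?_, s, hs, rfl⟩
  refine Set.mem_iUnion₂.2 ⟨(blockingData D K p).1, ?_, hy⟩
  exact (blockingData_strictMono D K).monotone hp

end Combinatorics

/-- The perturbation argument. -/
theorem norm_sum_le_of_perturbation {Y : Type*} [NormedAddCommGroup Y] [NormedSpace ℝ Y]
    {C : ℝ} (hC : 0 ≤ C) {δ : ℕ → ℝ} {f y : ℕ → Y} {n : ℕ} (hδ0 : ∀ k, 0 ≤ δ k)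
    (hδ : ∑ k ∈ Finset.range n, δ k ≤ 1 / (C + 1))
    (hfy : ∀ k, ‖f k - ‖f k‖ • y k‖ ≤ δ k * ‖f k‖) (hy : ∀ k, f k ≠ 0 → ‖y k‖ = 1)
    (hu : ∀ σ : ℕ → ℝ, (∀ k, σ k = 1 ∨ σ k = -1) →
      ‖∑ k ∈ Finset.range n, (σ k * ‖f k‖) • y k‖ ≤ C * ‖∑ k ∈ Finset.range n, ‖f k‖ • y k‖)
    {σ : ℕ → ℝ} (hσ : ∀ k, σ k = 1 ∨ σ k = -1) :
    ‖∑ k ∈ Finset.range n, σ k • f k‖ ≤ (2 * C + 1) * ‖∑ k ∈ Finset.range n, f k‖ := by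
  set U := ∑ k ∈ Finset.range n, ‖f k‖ • y k with hU
  have hcoef : ∀ m ∈ Finset.range n, ‖f m‖ ≤ (C + 1) / 2 * ‖U‖ := by
    intro m hm
    rcases eq_or_ne (f m) 0 with h0 | h0
    · rw [h0, norm_zero]; positivity
    -- Flipping a single sign isolates one coefficient, so ‖f m‖ ≤ (C + 1)/2·‖U‖. With ∑ δ ≤ 1/(C +
    -- 1) the total perturbation is at most half of ‖U‖.
    let τ : ℕ → ℝ := fun k => if k = m then -1 else 1
    have h1 := hu τ fun k => by by_cases h : k = m <;> simp [τ, h]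
    have h2 : U - ∑ k ∈ Finset.range n, (τ k * ‖f k‖) • y k = (2 * ‖f m‖) • y m := by
      rw [hU, ← Finset.sum_sub_distrib, Finset.sum_eq_single_of_mem m hm]
      · simp only [τ, if_true]; module
      · intro k _ hk; simp [τ, hk]
    have h3 : 2 * ‖f m‖ = ‖(2 * ‖f m‖) • y m‖ := by
      rw [norm_smul, hy m h0, mul_one, Real.norm_of_nonneg (by positivity)]
    have h4 := norm_sub_le U (∑ k ∈ Finset.range n, (τ k * ‖f k‖) • y k)
    rw [h2, ← h3] at h4
    linarith
  have herr : ∀ τ : ℕ → ℝ, (∀ k, τ k = 1 ∨ τ k = -1) →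
      ‖∑ k ∈ Finset.range n, τ k • f k - ∑ k ∈ Finset.range n, (τ k * ‖f k‖) • y k‖ ≤
        1 / 2 * ‖U‖ := by
    intro τ hτ
    rw [← Finset.sum_sub_distrib]
    calc ‖∑ k ∈ Finset.range n, (τ k • f k - (τ k * ‖f k‖) • y k)‖
        ≤ ∑ k ∈ Finset.range n, δ k * ((C + 1) / 2 * ‖U‖) := by
          refine norm_sum_le_of_le _ fun k hk => ?_
          rw [mul_smul, ← smul_sub, norm_smul]
          have : ‖τ k‖ = 1 := by rcases hτ k with h | h <;> simp [h]
          rw [this, one_mul]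
          exact (hfy k).trans (mul_le_mul_of_nonneg_left (hcoef k hk) (hδ0 k))
      _ = (∑ k ∈ Finset.range n, δ k) * ((C + 1) / 2 * ‖U‖) := by rw [Finset.sum_mul]
      _ ≤ 1 / (C + 1) * ((C + 1) / 2 * ‖U‖) := by gcongr
      _ = 1 / 2 * ‖U‖ := by field_simp
  have h1 : ‖U‖ ≤ 2 * ‖∑ k ∈ Finset.range n, f k‖ := by
    have := herr 1 fun _ => Or.inl rfl
    simp only [Pi.one_apply, one_smul, one_mul] at this
    rw [← hU] at this
    have h2 := norm_sub_norm_le U (∑ k ∈ Finset.range n, f k)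
    rw [norm_sub_rev] at h2
    linarith
  have h2 := norm_le_norm_sub_add (∑ k ∈ Finset.range n, σ k • f k)
    (∑ k ∈ Finset.range n, (σ k * ‖f k‖) • y k)
  have h3 := herr σ hσ
  have h4 := hu σ hσ
  nlinarith

/-- Each `f k` is approximated in direction by a net member `y k`. The blocking makes `y k` vanish
on the space demanded at the position reached so far, so the successive `y k` are legal moves that
keep the position not lost, hence unconditional. -/
theorem exists_unconditional_tails (hX : WeakStarUTP X) {A : ℕ → Submodule ℝ X}
    {B : ℕ → Submodule ℝ (StrongDual ℝ X)} (h : IsTower A B) :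
    ∃ N : ℕ → ℕ, StrictMono N ∧ N 0 = 0 ∧ ∃ C : ℝ, 0 ≤ C ∧
      ∀ (j : ℕ → ℕ) (f : ℕ → StrongDual ℝ X), Monotone j → (∀ k, k + 1 ≤ j k) →
      (∀ k, f k ∈ B (N (j (k + 1) - 1)) ⊓
        ann (NormedSpace.inclusionInDoubleDual ℝ X) (A (N (j k)))) →
      ∀ (n : ℕ) (σ : ℕ → ℝ), (∀ k, σ k = 1 ∨ σ k = -1) →
        ‖∑ k ∈ Finset.range n, σ k • f k‖ ≤ C * ‖∑ k ∈ Finset.range n, f k‖ := by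
  obtain ⟨c, hc⟩ := exists_not_lost_of_weakStarUTP hX h.monoA h.denseA
  have hc0 : (0 : ℝ) ≤ c := Nat.cast_nonneg c
  let δ : ℕ → ℝ := fun q => (1 / 2) ^ (q + 1) / ((c : ℝ) + 1)
  have hδ : ∀ q, 0 < δ q := fun q => by positivity
  have hδanti : Antitone δ := by
    intro a b hab
    simp only [δ]
    gcongr ?_ / _
    exact pow_le_pow_of_le_one (by norm_num) (by norm_num) (by omega)
  have hδsum : ∀ n, ∑ k ∈ Finset.range n, δ k ≤ 1 / ((c : ℝ) + 1) := by
    intro n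
    simp only [δ]
    rw [← Finset.sum_div]
    gcongr
    have : ∀ n, ∑ k ∈ Finset.range n, (1 / 2 : ℝ) ^ (k + 1) = 1 - (1 / 2) ^ n := by
      intro n
      induction n with
      | zero => simp
      | succ n ih => rw [Finset.sum_range_succ, ih]; ring
    rw [this]
    have : (0 : ℝ) ≤ (1 / 2) ^ n := by positivity
    linarith
  have hnet : ∀ p q : ℕ, ∃ D : Finset (StrongDual ℝ X),
      (∀ y ∈ D, y ∈ B q ⊓ ann (NormedSpace.inclusionInDoubleDual ℝ X) (A p) ∧ ‖y‖ = 1) ∧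
      ∀ v ∈ B q ⊓ ann (NormedSpace.inclusionInDoubleDual ℝ X) (A p), v ≠ 0 →
        ∃ y ∈ D, ‖v - ‖v‖ • y‖ ≤ δ q * ‖v‖ := by
    intro p q
    have := h.finB q
    have : FiniteDimensional ℝ
        (B q ⊓ ann (NormedSpace.inclusionInDoubleDual ℝ X) (A p) : Submodule ℝ (StrongDual ℝ X)) :=
      Submodule.finiteDimensional_of_le inf_le_left
    exact exists_finite_net _ (hδ q)
  choose D hD1 hD2 using hnet
  -- `K` is the first player's strategy for never entering a lost position.
  have hK : ∀ s : List (StrongDual ℝ X), ∃ k, ¬ Lost (LegalMove A) (c : ℝ) s →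
      ∀ x, LegalMove A k x → ¬ Lost (LegalMove A) (c : ℝ) (x :: s) := by
    intro s
    by_cases hs : Lost (LegalMove A) (c : ℝ) s
    · exact ⟨0, fun h => absurd hs h⟩
    · obtain ⟨k, hk⟩ := exists_of_not_lost hs
      exact ⟨k, fun _ => hk⟩
  choose K hK using hK
  let N : ℕ → ℕ := fun i => (blockingData D K i).1
  have hN : StrictMono N := blockingData_strictMono D K
  refine ⟨N, hN, rfl, 2 * c + 1, by positivity, fun j f hj hjk hf n σ hσ => ?_⟩
  have hy : ∀ k, ∃ y : StrongDual ℝ X, ‖f k - ‖f k‖ • y‖ ≤ δ k * ‖f k‖ ∧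
      (f k ≠ 0 → y ∈ D (N (j k)) (N (j (k + 1) - 1))) := by
    intro k
    by_cases h0 : f k = 0
    · exact ⟨0, by simp [h0], fun h => absurd h0 h⟩
    · obtain ⟨y, hy, hyf⟩ := hD2 _ _ (f k) (hf k) h0
      refine ⟨y, hyf.trans ?_, fun _ => hy⟩
      gcongr
      refine hδanti ?_
      have h1 := hjk (k + 1)
      have h2 := hN.le_apply (x := j (k + 1) - 1)
      omega
  choose y hy1 hy2 using hy
  -- With no room in the gap, `f k` kills the partner space that separates the space containing it.
  have hpq : ∀ k, f k ≠ 0 → j k < j (k + 1) - 1 := by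
    intro k h0
    by_contra hle
    refine h0 (h.sepB _ _ (hf k).1 fun a ha => (hf k).2 a (h.monoA (hN.monotone ?_) ha))
    omega
  refine norm_sum_le_of_perturbation hc0 (fun k => (hδ k).le) (hδsum n) hy1
    (fun k h0 => (hD1 _ _ _ (hy2 k h0)).2) (fun τ hτ => ?_) hσ
  -- A position recorded at stage `j m - 1` has its demand met by `N (j m)`, and the next move
  -- vanishes on `A (N (j m))`. This uses the skipped index and needs `j m ≥ 1`.
  have hmain : ∀ m, ∃ s ∈ (blockingData D K (j m - 1)).2, ¬ Lost (LegalMove A) (c : ℝ) s ∧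
      SignComb s (∑ k ∈ Finset.range m, ‖f k‖ • y k)
        (∑ k ∈ Finset.range m, (τ k * ‖f k‖) • y k) := by
    intro m
    induction m with
    | zero =>
      refine ⟨[], blockingData_mono D K (Nat.zero_le _) rfl, hc, ?_⟩
      simpa using SignComb.nil
    | succ m ih =>
      obtain ⟨s, hs, hsl, hsc⟩ := ih
      rw [Finset.sum_range_succ, Finset.sum_range_succ]
      have hjm := hj m.le_succ
      by_cases h0 : f m = 0
      · refine ⟨s, blockingData_mono D K (by simp only [Nat.succ_eq_add_one] at hjm; omega) hs,
          hsl, ?_⟩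
        simpa [h0] using hsc
      · have hlt := hpq m h0
        refine ⟨y m :: s, ?_, ?_, hsc.cons (y m) _ _ (hτ m)⟩
        · have hj1 : j (m + 1) - 1 = (j (m + 1) - 1 - 1) + 1 := by omega
          have hmem := hy2 m h0
          rw [hj1] at hmem ⊢
          refine cons_mem_blockingData D K
            (blockingData_mono D K (show j m - 1 ≤ j (m + 1) - 1 - 1 by omega) hs) ?_ hmem
          omega
        · refine hK s hsl (y m) ⟨(hD1 _ _ _ (hy2 m h0)).2, fun a ha => ?_⟩
          refine (hD1 _ _ _ (hy2 m h0)).1.2 a (h.monoA ?_ ha)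
          have := blockingData_le D K hs
          have h3 : j m - 1 + 1 = j m := by have := hjk m; omega
          rwa [h3] at this
  obtain ⟨s, -, hsl, hsc⟩ := hmain n
  exact uncList_of_not_lost hsl _ _ hsc

/-- Sequences of functionals whose supports are separated by gaps are uniformly unconditional. -/
def SkippedUnconditional (E : ℕ → Submodule ℝ X) (C : ℝ) : Prop :=
  ∀ (j : ℕ → ℕ) (f : ℕ → StrongDual ℝ X), Monotone j → (∀ k, k ≤ j k) → 
    (∀ k, dualSupp E (f k) ⊆ Set.Ioo (j k) (j (k + 1))) →
    ∀ (n : ℕ) (σ : ℕ → ℝ), (∀ k, σ k = 1 ∨ σ k = -1) →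
      ‖∑ k ∈ Finset.range n, σ k • f k‖ ≤ C * ‖∑ k ∈ Finset.range n, f k‖

/-- The tail estimate needs `j 0 ≥ 1`, whereas here `j 0 = 0` is allowed. So the first functional is
split off: the others vanish on the block that norms it, and it is bounded by 2.5 times the norm of
the sum. -/
theorem exists_skippedUnconditional (hX : WeakStarUTP X)
    [TopologicalSpace.SeparableSpace (StrongDual ℝ X)] :
    ∃ (A : ℕ → Submodule ℝ X) (B : ℕ → Submodule ℝ (StrongDual ℝ X)), IsTower A B ∧
      ∃ C, 0 ≤ C ∧ SkippedUnconditional (towerDecomp A B) C := by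
  obtain ⟨A, B, h⟩ := exists_tower (X := X)
  obtain ⟨N, hN, hN0, C, hC, hu⟩ := exists_unconditional_tails hX h
  have h' := h.comp hN hN0
  refine ⟨A ∘ N, B ∘ N, h', 2.5 + C * 3.5, by positivity, fun j f hj hjk hf n σ hσ => ?_⟩
  have hmem := fun k => h'.mem_of_dualSupp (hf k)
  rcases n with _ | n
  · simp
  have htail := hu (fun k => j (k + 1)) (fun k => f (k + 1))
    (fun a b hab => hj (by omega)) (fun k => hjk (k + 1)) (fun k => hmem (k + 1)) n
    (fun k => σ (k + 1)) (fun k => hσ (k + 1))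
  set T := ‖∑ k ∈ Finset.range (n + 1), f k‖ with hT
  have h0 : ‖f 0‖ ≤ 2.5 * T := by
    by_cases hj1 : j 1 ≤ 1
    · have : f 0 = 0 := by
        have h1 := (hmem 0).1
        have h2 : j (0 + 1) - 1 = 0 := by rw [zero_add]; omega
        rw [h2, h'.zeroB] at h1
        exact (Submodule.mem_bot ℝ).1 h1
      rw [this, norm_zero]; positivity
    · have hb : f 0 ∈ blockSum (biorth (towerDecomp (A ∘ N) (B ∘ N))) 1 (j 1 - 1) := by
        rw [h'.blockSum_biorth (by omega)]
        refine ⟨(hmem 0).1, fun a ha => (hmem 0).2 a (h'.monoA (by omega) ha)⟩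
      refine (h'.blockEstimates.norming_dual 1 (j 1 - 1) le_rfl (by omega) _ hb).trans ?_
      gcongr
      refine norm_restr_le (norm_nonneg _) fun x hx => ?_
      rw [h'.blockSum_towerDecomp (by omega)] at hx
      have hx1 : x ∈ (A ∘ N) (j 1) := by
        have := hx.1
        rwa [Nat.sub_add_cancel (by omega)] at this
      have hz : ∀ k ∈ Finset.range n, f (k + 1) x = 0 := fun k _ =>
        (hmem (k + 1)).2 x (h'.monoA (hj (by omega)) hx1)
      have : f 0 x = (∑ k ∈ Finset.range (n + 1), f k) x := by
        rw [Finset.sum_range_succ', add_apply, sum_apply,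
          Finset.sum_eq_zero hz, zero_add]
      rw [this]
      exact (∑ k ∈ Finset.range (n + 1), f k).le_opNorm x
  have h1 : ‖∑ k ∈ Finset.range n, f (k + 1)‖ ≤ 3.5 * T := by
    have : ∑ k ∈ Finset.range n, f (k + 1) = ∑ k ∈ Finset.range (n + 1), f k - f 0 := by
      rw [Finset.sum_range_succ', add_sub_cancel_right]
    rw [this]
    have := norm_sub_le (∑ k ∈ Finset.range (n + 1), f k) (f 0)
    linarith
  rw [Finset.sum_range_succ']
  have h2 : ‖σ 0 • f 0‖ = ‖f 0‖ := by
    rw [norm_smul]; rcases hσ 0 with h | h <;> simp [h]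
  calc _ ≤ ‖∑ k ∈ Finset.range n, σ (k + 1) • f (k + 1)‖ + ‖σ 0 • f 0‖ := norm_add_le _ _
    _ ≤ C * (3.5 * T) + 2.5 * T := by
      rw [h2]; exact add_le_add (htail.trans (by gcongr)) h0
    _ = _ := by ring

end Blocking

/-! ### Cutting functionals at indices where they vanish. -/

section Cut

variable {X : Type*} [NormedAddCommGroup X] [NormedSpace ℝ X]

/-- Shrinking decompositions with block estimates, together with cut-offs of functionals. -/
structure IsBlockFMD (E : ℕ → Submodule ℝ X) : Prop where
  zero : E 0 = ⊥
  isFMD : IsFMD E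
  isShrinking : IsShrinking E
  blockEstimates : BlockEstimates E
  exists_cut : ∀ (g : StrongDual ℝ X) (p q : ℕ), ∃ f : StrongDual ℝ X,
    (∀ l ∈ Set.Ioo p q, ∀ x ∈ E l, f x = g x) ∧ ∀ l ∉ Set.Ioo p q, ∀ x ∈ E l, f x = 0

theorem IsTower.isBlockFMD {A : ℕ → Submodule ℝ X} {B : ℕ → Submodule ℝ (StrongDual ℝ X)}
    (h : IsTower A B) : IsBlockFMD (towerDecomp A B) :=
  ⟨h.towerDecomp_zero, h.isFMD, h.isShrinking, h.blockEstimates, h.exists_part⟩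

theorem blockSum_self {Y : Type*} [NormedAddCommGroup Y] [NormedSpace ℝ Y]
    (E : ℕ → Submodule ℝ Y) (l : ℕ) : blockSum E l l = E l := by
  simp [blockSum]

theorem le_blockSum {Y : Type*} [NormedAddCommGroup Y] [NormedSpace ℝ Y]
    (E : ℕ → Submodule ℝ Y) {m n l : ℕ} (hl : l ∈ Set.Icc m n) : E l ≤ blockSum E m n :=
  le_iSup₂_of_le (f := fun j (_ : j ∈ Finset.Icc m n) => E j) l (by simpa using hl) le_rfl

theorem eq_of_mem_blockSum {E : ℕ → Submodule ℝ X} {m n : ℕ} {f g : StrongDual ℝ X}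
    (h : ∀ l ∈ Set.Icc m n, ∀ x ∈ E l, f x = g x) {x : X} (hx : x ∈ blockSum E m n) :
    f x = g x := by
  have : blockSum E m n ≤ LinearMap.ker (f - g).toLinearMap := by
    refine iSup₂_le fun j hj x hx => ?_
    simp [h j (by simpa using hj) x hx]
  simpa [sub_eq_zero] using this hx

theorem vanish_of_mem_blockSum_biorth {E : ℕ → Submodule ℝ X} {m n l : ℕ} {f : StrongDual ℝ X}
    (hf : f ∈ blockSum (biorth E) m n) (hl : l ∉ Set.Icc m n) {x : X} (hx : x ∈ E l) :
    f x = 0 := by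
  have : blockSum (biorth E) m n ≤
      LinearMap.ker (NormedSpace.inclusionInDoubleDual ℝ X x).toLinearMap := by
    refine iSup₂_le fun j hj g hg => ?_
    refine IsTower.mem_biorth_iff.1 hg l (fun h => hl ?_) x hx
    simpa [h] using hj
  exact this hf

namespace IsBlockFMD

variable {E : ℕ → Submodule ℝ X} (h : IsBlockFMD E)
include h

theorem dual_ext {f g : StrongDual ℝ X} (hfg : ∀ k, ∀ x ∈ E k, f x = g x) : f = g :=
  dual_ext_of_topologicalClosure_eq_top h.isFMD.fundamental hfg

omit h in
theorem vanish_zero (h : IsBlockFMD E) (f : StrongDual ℝ X) : ∀ x ∈ E 0, f x = 0 := by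
  intro x hx
  rw [h.zero, Submodule.mem_bot] at hx
  rw [hx, map_zero]

/-- The functional that agrees with `g` on `E l`, `p < l < q`, and vanishes on the other `E l`. -/
def cut (g : StrongDual ℝ X) (p q : ℕ) : StrongDual ℝ X :=
  (h.exists_cut g p q).choose

theorem cut_of_mem (g : StrongDual ℝ X) {p q l : ℕ} (hp : p < l) (hq : l < q) {x : X}
    (hx : x ∈ E l) : h.cut g p q x = g x :=
  (h.exists_cut g p q).choose_spec.1 l ⟨hp, hq⟩ x hx

theorem cut_of_notMem (g : StrongDual ℝ X) {p q l : ℕ} (hl : ¬ (p < l ∧ l < q)) {x : X}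
    (hx : x ∈ E l) : h.cut g p q x = 0 :=
  (h.exists_cut g p q).choose_spec.2 l hl x hx

theorem dualSupp_cut (g : StrongDual ℝ X) (p q : ℕ) :
    dualSupp E (h.cut g p q) ⊆ Set.Ioo p q := by
  intro l hl
  by_contra hl'
  exact notMem_dualSupp.2 (fun x hx => h.cut_of_notMem g hl' hx) hl

theorem eq_cut {f g : StrongDual ℝ X} {p q : ℕ} (hf : dualSupp E f ⊆ Set.Ioo p q)
    (hfg : ∀ l, p < l → l < q → ∀ x ∈ E l, f x = g x) : f = h.cut g p q := by
  refine h.dual_ext fun l x hx => ?_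
  by_cases hl : p < l ∧ l < q
  · rw [h.cut_of_mem g hl.1 hl.2 hx, hfg l hl.1 hl.2 x hx]
  · rw [h.cut_of_notMem g hl hx]
    exact notMem_dualSupp.1 (fun hl' => hl (hf hl')) x hx

theorem mem_blockSum_biorth {f : StrongDual ℝ X} {m n : ℕ} (hf : dualSupp E f ⊆ Set.Icc m n) :
    f ∈ blockSum (biorth E) m n := by
  have hsum : f = ∑ l ∈ Finset.Icc m n, h.cut f (l - 1) (l + 1) := by
    refine h.dual_ext fun l x hx => ?_
    rcases Nat.eq_zero_or_pos l with rfl | hl0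
    · rw [h.vanish_zero _ x hx, h.vanish_zero _ x hx]
    rw [sum_apply]
    by_cases hl : l ∈ Finset.Icc m n
    · rw [Finset.sum_eq_single_of_mem l hl,
        h.cut_of_mem f (show l - 1 < l by omega) (show l < l + 1 by omega) hx]
      intro i _ hi
      exact h.cut_of_notMem f (by omega) hx
    · rw [notMem_dualSupp.1 (fun hl' => hl (by simpa using hf hl')) x hx]
      refine (Finset.sum_eq_zero fun i hi => h.cut_of_notMem f ?_ hx).symm
      intro hi'
      have : l = i := by omega
      exact hl (this ▸ hi)
  rw [hsum]
  refine Submodule.sum_mem _ fun l hl => le_blockSum (biorth E) (by simpa using hl) ?_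
  refine IsTower.mem_biorth_iff.2 fun i hi x hx => ?_
  rcases Nat.eq_zero_or_pos i with rfl | hi0
  · exact h.vanish_zero _ x hx
  exact h.cut_of_notMem f (by omega) hx

/-- The cut lies in the biorthogonal block from p + 1 to q - 1 and is therefore normed by the block
of `E` from p to q. There it agrees with `g`, since `g` vanishes on the two end spaces. -/
theorem norm_cut_le {g : StrongDual ℝ X} {p q : ℕ} (hp : ∀ x ∈ E p, g x = 0)
    (hq : ∀ x ∈ E q, g x = 0) : ‖h.cut g p q‖ ≤ 2.5 * ‖restr g (blockSum E p q)‖ := by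
  by_cases hpq : p + 2 ≤ q
  · have hmem : h.cut g p q ∈ blockSum (biorth E) (p + 1) (q - 1) := by
      refine h.mem_blockSum_biorth fun l hl => ?_
      have := h.dualSupp_cut g p q hl
      rw [Set.mem_Ioo] at this
      rw [Set.mem_Icc]
      omega
    have := h.blockEstimates.norming_dual (p + 1) (q - 1) (by omega) (by omega) _ hmem
    rw [Nat.add_sub_cancel, Nat.sub_add_cancel (by omega)] at this
    refine this.trans ?_
    gcongr
    refine norm_restr_le (norm_nonneg (restr g _)) fun x hx => ?_
    rw [eq_of_mem_blockSum (f := h.cut g p q) (g := g) ?_ hx]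
    · exact le_norm_restr g hx
    · intro l hl y hy
      by_cases hl' : p < l ∧ l < q
      · exact h.cut_of_mem g hl'.1 hl'.2 hy
      · rw [h.cut_of_notMem g hl' hy]
        have : l = p ∨ l = q := by rw [Set.mem_Icc] at hl; omega
        rcases this with rfl | rfl
        · exact (hp y hy).symm
        · exact (hq y hy).symm
  · have : h.cut g p q = 0 := h.dual_ext fun l x hx => by
      rw [h.cut_of_notMem g (by omega) hx]; rfl
    rw [this, norm_zero]
    positivity

theorem cut_add_cut {g : StrongDual ℝ X} {p q r : ℕ} (hpq : p ≤ q) (hqr : q ≤ r)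
    (hq : ∀ x ∈ E q, g x = 0) : h.cut g p q + h.cut g q r = h.cut g p r := by
  refine h.dual_ext fun l x hx => ?_
  rw [add_apply]
  by_cases hl : p < l ∧ l < r
  · rw [h.cut_of_mem g hl.1 hl.2 hx]
    rcases lt_trichotomy l q with h1 | rfl | h1
    · rw [h.cut_of_mem g hl.1 h1 hx, h.cut_of_notMem g (by omega) hx, add_zero]
    · rw [h.cut_of_notMem g (by omega) hx, h.cut_of_notMem g (by omega) hx, hq x hx, add_zero]
    · rw [h.cut_of_mem g h1 hl.2 hx, h.cut_of_notMem g (by omega) hx, zero_add]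
  · rw [h.cut_of_notMem g hl hx, h.cut_of_notMem g (by omega) hx,
      h.cut_of_notMem g (by omega) hx, add_zero]

theorem sum_cut {g : StrongDual ℝ X} {j : ℕ → ℕ} (hj : Monotone j)
    (hg : ∀ k, ∀ x ∈ E (j k), g x = 0) {M N : ℕ} (hMN : M ≤ N) :
    ∑ k ∈ Finset.Ico M N, h.cut g (j k) (j (k + 1)) = h.cut g (j M) (j N) := by
  induction N, hMN using Nat.le_induction with
  | base =>
    rw [Finset.Ico_self, Finset.sum_empty]
    exact h.dual_ext fun l x hx => by rw [h.cut_of_notMem g (by omega) hx]; rfl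
  | succ N hN ih =>
    rw [Finset.sum_Ico_succ_top hN, ih, h.cut_add_cut (hj hN) (hj N.le_succ) (hg N)]

omit h in
theorem exists_vanish_of_mem_iSup_biorth {f : StrongDual ℝ X} (hf : f ∈ ⨆ k, biorth E k) :
    ∃ L, ∀ l, L ≤ l → ∀ x ∈ E l, f x = 0 := by
  refine Submodule.iSup_induction (biorth E)
    (motive := fun f => ∃ L, ∀ l, L ≤ l → ∀ x ∈ E l, f x = 0) hf ?_ ?_ ?_
  · intro k f hf
    exact ⟨k + 1, fun l hl x hx => IsTower.mem_biorth_iff.1 hf l (by omega) x hx⟩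
  · exact ⟨0, by simp⟩
  · rintro f g ⟨L, hL⟩ ⟨L', hL'⟩
    refine ⟨max L L', fun l hl x hx => ?_⟩
    rw [add_apply, hL l (by omega) x hx, hL' l (by omega) x hx, add_zero]

/-- The decomposition is shrinking: `g` is near a finite sum of biorthogonal functionals, which
vanishes on all late blocks. -/
theorem exists_approx (g : StrongDual ℝ X) {η : ℝ} (hη : 0 < η) :
    ∃ L, ∀ p q, L ≤ p → ‖restr g (blockSum E p q)‖ ≤ η := by
  have hd := Submodule.dense_iff_topologicalClosure_eq_top.2 h.isShrinking
  obtain ⟨f, hf, hfg⟩ := Metric.mem_closure_iff.1 (hd g) η hη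
  obtain ⟨L, hL⟩ := exists_vanish_of_mem_iSup_biorth hf
  refine ⟨L, fun p q hp => norm_restr_le hη.le fun x hx => ?_⟩
  have h0 : f x = (0 : StrongDual ℝ X) x :=
    eq_of_mem_blockSum (fun l hl y hy => hL l (hp.trans hl.1) y hy) hx
  have : g x = (g - f) x := by rw [sub_apply, h0]; simp
  rw [this]
  refine ((g - f).le_opNorm x).trans ?_
  rw [dist_eq_norm] at hfg
  gcongr

theorem exists_norm_cut_le {g : StrongDual ℝ X} {j : ℕ → ℕ} (hjk : ∀ k, k ≤ j k)
    (hg : ∀ k, ∀ x ∈ E (j k), g x = 0) {η : ℝ} (hη : 0 < η) :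
    ∃ L, ∀ M N, L ≤ M → ‖h.cut g (j M) (j N)‖ ≤ η := by
  obtain ⟨L, hL⟩ := h.exists_approx g (η := η / 2.5) (by positivity)
  refine ⟨L, fun M N hM => (h.norm_cut_le (hg M) (hg N)).trans ?_⟩
  have := hL (j M) (j N) (hM.trans (hjk M))
  calc _ ≤ 2.5 * (η / 2.5) := by gcongr
    _ = η := by ring

/-- Differences of these cuts are cuts far out, whose norms are controlled by `g` on late blocks.
The limit is identified on each `E l`. -/
theorem tendsto_cut {g : StrongDual ℝ X} {j : ℕ → ℕ} (hj : Monotone j)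
    (hjk : ∀ k, k ≤ j k) (hg : ∀ k, ∀ x ∈ E (j k), g x = 0) :
    Tendsto (fun N => h.cut g 0 (j N)) atTop (𝓝 g) := by
  have hcau : CauchySeq fun N => h.cut g 0 (j N) := by
    refine Metric.cauchySeq_iff'.2 fun η hη => ?_
    obtain ⟨L, hL⟩ := h.exists_norm_cut_le hjk hg (half_pos hη)
    refine ⟨L, fun n hn => ?_⟩
    rw [← h.cut_add_cut (Nat.zero_le (j L)) (hj hn) (hg L), dist_eq_norm, add_sub_cancel_left]
    exact (hL L n le_rfl).trans_lt (half_lt_self hη)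
  obtain ⟨g', hg'⟩ := cauchySeq_tendsto_of_complete hcau
  have : g' = g := by
    refine h.dual_ext fun l x hx => ?_
    have h1 : Tendsto (fun N => h.cut g 0 (j N) x) atTop (𝓝 (g' x)) :=
      ((ContinuousLinearMap.apply ℝ ℝ x).continuous.tendsto g').comp hg'
    refine tendsto_nhds_unique h1 (tendsto_const_nhds.congr' ?_)
    filter_upwards [eventually_gt_atTop l] with N hN
    rcases Nat.eq_zero_or_pos l with rfl | hl
    · rw [h.vanish_zero _ x hx, h.vanish_zero _ x hx]
    · exact (h.cut_of_mem g hl (hN.trans_le (hjk N)) hx).symm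
  exact this ▸ hg'

theorem seriesTendsto_cut {g : StrongDual ℝ X} {j : ℕ → ℕ} (hj : Monotone j) (hj0 : j 0 = 0)
    (hjk : ∀ k, k ≤ j k) (hg : ∀ k, ∀ x ∈ E (j k), g x = 0) :
    SeriesTendsto (fun k => h.cut g (j k) (j (k + 1))) g := by
  refine (h.tendsto_cut hj hjk hg).congr fun N => ?_
  rw [Finset.range_eq_Ico, h.sum_cut hj hg (Nat.zero_le N), hj0]

end IsBlockFMD

/-- The sequences `j` in the definition of `skippedSeqBall`. -/
structure IsSkip (n j : ℕ → ℕ) : Prop where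
  zero : j 0 = 0
  mem : ∀ k, j (k + 1) ∈ Set.Icc (n (k + 1)) (n (k + 2))

namespace IsSkip

variable {n j : ℕ → ℕ}

theorem bounds (hj : IsSkip n j) (hn0 : n 0 = 0) (k : ℕ) : n k ≤ j k ∧ j k ≤ n (k + 1) := by
  cases k with
  | zero => rw [hj.zero, hn0]; exact ⟨le_rfl, Nat.zero_le _⟩
  | succ k => exact hj.mem k

theorem monotone (hj : IsSkip n j) (hn0 : n 0 = 0) : Monotone j :=
  monotone_nat_of_le_succ fun k => (hj.bounds hn0 k).2.trans (hj.bounds hn0 (k + 1)).1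

theorem le_apply (hj : IsSkip n j) (hn0 : n 0 = 0) (hn : StrictMono n) (k : ℕ) : k ≤ j k :=
  hn.le_apply.trans (hj.bounds hn0 k).1

end IsSkip

namespace IsBlockFMD

variable {E : ℕ → Submodule ℝ X} (h : IsBlockFMD E) {n : ℕ → ℕ} (hn : StrictMono n) (hn0 : n 0 = 0)

include hn hn0

omit hn in
-- At most one term acts on a given `E l`, so the terms can be read off from the sum. Hence members
-- of `skippedSeqBall` may be replaced by pairs (g, j).
theorem eq_of_seriesTendsto {j : ℕ → ℕ} (hj : IsSkip n j) {f : ℕ → StrongDual ℝ X}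
    (hf : ∀ k, dualSupp E (f k) ⊆ Set.Ioo (j k) (j (k + 1))) {g : StrongDual ℝ X}
    (hfg : SeriesTendsto f g) :
    (∀ k, ∀ x ∈ E (j k), g x = 0) ∧ ∀ k, f k = h.cut g (j k) (j (k + 1)) := by
  have hmono := hj.monotone hn0
  have hf' : ∀ k l, ¬ (j k < l ∧ l < j (k + 1)) → ∀ x ∈ E l, f k x = 0 :=
    fun k l hl => notMem_dualSupp.1 fun hl' => hl (hf k hl')
  have hev : ∀ x, Tendsto (fun N => ∑ k ∈ Finset.range N, f k x) atTop (𝓝 (g x)) := by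
    intro x
    have := ((ContinuousLinearMap.apply ℝ ℝ x).continuous.tendsto g).comp hfg
    refine this.congr fun N => ?_
    simp
  constructor
  · intro m x hx
    have h0 : ∀ k, f k x = 0 := by
      refine fun k => hf' k (j m) ?_ x hx
      rintro ⟨h1, h2⟩
      have h3 := hmono.reflect_lt h1
      have h4 := hmono.reflect_lt h2
      omega
    refine tendsto_nhds_unique (hev x) ?_
    simp only [h0, Finset.sum_const_zero]
    exact tendsto_const_nhds
  · intro m
    refine h.eq_cut (hf m) fun l hl1 hl2 x hx => ?_
    refine tendsto_nhds_unique (tendsto_const_nhds.congr' ?_) (hev x)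
    have h0 : ∀ k, k ≠ m → f k x = 0 := by
      refine fun k hk => hf' k l ?_ x hx
      rintro ⟨h1, h2⟩
      have h3 := hmono.reflect_lt (h1.trans hl2)
      have h4 := hmono.reflect_lt (hl1.trans h2)
      omega
    filter_upwards [eventually_gt_atTop m] with N hN
    exact (Finset.sum_eq_single_of_mem (f := fun k => f k x) m (Finset.mem_range.2 hN)
      fun k _ hk => h0 k hk).symm

omit hn in
theorem exists_of_mem_skippedSeqBall {f : ℕ → StrongDual ℝ X} (hf : f ∈ skippedSeqBall E n) :
    ∃ j g, IsSkip n j ∧ (∀ k, ∀ x ∈ E (j k), g x = 0) ∧ ‖g‖ ≤ 1 ∧ SeriesTendsto f g ∧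
      f = fun k => h.cut g (j k) (j (k + 1)) := by
  obtain ⟨j, hj0, hj, hs, g, hfg, hg⟩ := hf
  have hsk : IsSkip n j := ⟨hj0, hj⟩
  obtain ⟨h1, h2⟩ := h.eq_of_seriesTendsto hn0 hsk hs hfg
  exact ⟨j, g, hsk, h1, hg, hfg, funext h2⟩

end IsBlockFMD

end Cut

/-! ### Admissible sequences and approximation by skipped functionals. -/

section Admissible

variable {X : Type*} [NormedAddCommGroup X] [NormedSpace ℝ X]

theorem continuous_norm_comp_weakDual {V : Type*} [NormedAddCommGroup V] [NormedSpace ℝ V]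
    [FiniteDimensional ℝ V] (ι : V →L[ℝ] X) :
    Continuous fun f : WeakDual ℝ X => ‖(WeakDual.toStrongDual f).comp ι‖ := by
  let b := Module.finBasis ℝ V
  let T : (Fin (Module.finrank ℝ V) → ℝ) →ₗ[ℝ] StrongDual ℝ V :=
    LinearMap.toContinuousLinearMap.toLinearMap ∘ₗ (b.constr ℝ).toLinearMap
  have hT : Continuous T := T.continuous_of_finiteDimensional
  have heq : (fun f : WeakDual ℝ X => (WeakDual.toStrongDual f).comp ι) =
      fun f => T fun i => f (ι (b i)) := by
    funext f
    apply ContinuousLinearMap.coe_injective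
    refine b.ext fun i => ?_
    simp [T]
  refine Continuous.norm ?_
  rw [heq]
  exact hT.comp (continuous_pi fun i => WeakDual.eval_continuous _)

theorem continuous_norm_restr_weakDual (S : Submodule ℝ X) [FiniteDimensional ℝ S] :
    Continuous fun f : WeakDual ℝ X => ‖restr (WeakDual.toStrongDual f) S‖ :=
  continuous_norm_comp_weakDual S.subtypeL

theorem norm_restr_comb_le (f g : StrongDual ℝ X) (a b : ℝ) (S : Submodule ℝ X) :
    ‖restr (a • f + b • g) S‖ ≤ |a| * ‖restr f S‖ + |b| * ‖restr g S‖ := by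
  have h1 : 0 ≤ ‖restr f S‖ := ContinuousLinearMap.opNorm_nonneg _
  have h2 : 0 ≤ ‖restr g S‖ := ContinuousLinearMap.opNorm_nonneg _
  refine norm_restr_le (by positivity) fun y hy => ?_
  have h3 := mul_le_mul_of_nonneg_left (le_norm_restr f hy) (abs_nonneg a)
  have h4 := mul_le_mul_of_nonneg_left (le_norm_restr g hy) (abs_nonneg b)
  calc |(a • f + b • g) y| ≤ |a * f y| + |b * g y| := abs_add_le _ _
    _ ≤ _ := by rw [abs_mul, abs_mul]; linarith

namespace IsBlockFMD

variable {E : ℕ → Submodule ℝ X} (h : IsBlockFMD E)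
include h

/-- For a fixed functional the restrictions to `E l` tend to zero, so the weak* open sets of
functionals small on some `E l`, l ≥ m, cover the unit ball. By Banach-Alaoglu finitely many
suffice. -/
theorem exists_small (m : ℕ) {η : ℝ} (hη : 0 < η) :
    ∃ M, m < M ∧ ∀ f : StrongDual ℝ X, ‖f‖ ≤ 1 → ∃ l ∈ Set.Icc m M, ‖restr f (E l)‖ ≤ η := by
  have := h.isFMD.finiteDimensional
  let U : ℕ → Set (WeakDual ℝ X) := fun l =>
    {f | m ≤ l ∧ ‖restr (WeakDual.toStrongDual f) (E l)‖ < η}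
  have hU : ∀ l, IsOpen (U l) := fun l => by
    by_cases hl : m ≤ l
    · simp only [U, hl, true_and]
      exact isOpen_lt (continuous_norm_restr_weakDual (E l)) continuous_const
    · simp [U, hl]
  obtain ⟨t, ht⟩ := (WeakDual.isCompact_closedBall (𝕜 := ℝ) (E := X) 0 1).elim_finite_subcover U hU
    (by
      intro f _
      obtain ⟨L, hL⟩ := h.exists_approx (WeakDual.toStrongDual f) (half_pos hη)
      have := hL (max m L) (max m L) (le_max_right _ _)
      rw [blockSum_self] at this
      exact Set.mem_iUnion.2 ⟨max m L, le_max_left _ _, this.trans_lt (half_lt_self hη)⟩)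
  refine ⟨max (m + 1) (t.sup id), by omega, fun f hf => ?_⟩
  obtain ⟨l, hl, hlm, hlf⟩ := Set.mem_iUnion₂.1
    (ht (show StrongDual.toWeakDual f ∈ _ by simpa using hf))
  exact ⟨l, ⟨hlm, (Finset.le_sup (f := id) hl).trans (le_max_right _ _)⟩, hlf.le⟩

theorem exists_admissible {ε : ℕ → ℝ} (hε : ∀ k, 0 < ε k) : ∃ n, Admissible E ε n := by
  choose M hM1 hM2 using fun (m k : ℕ) => h.exists_small m (hε k)
  let n : ℕ → ℕ := fun k => Nat.rec 0 (fun k m => M m (k - 1)) k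
  have hn : ∀ k, n (k + 1) = M (n k) (k - 1) := fun _ => rfl
  refine ⟨n, rfl, strictMono_nat_of_lt_succ fun k => hM1 _ _, fun k f hf => ?_⟩
  exact hM2 (n (k + 1)) k f hf

/-- Consecutive non-trivial spaces: some functional is large on both. -/
theorem exists_large_on_both {i : ℕ} (hi : 1 ≤ i) (h1 : E i ≠ ⊥) (h2 : E (i + 1) ≠ ⊥) :
    ∃ f : StrongDual ℝ X, ‖f‖ ≤ 1 ∧ 1 / 50 < ‖restr f (E i)‖ ∧ 1 / 50 < ‖restr f (E (i + 1))‖ := by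
  have hex : ∀ l, 1 ≤ l → E l ≠ ⊥ → ∃ f : StrongDual ℝ X, ‖f‖ ≤ 2.5 ∧ ‖restr f (E l)‖ = 1 := by
    intro l hl hl0
    have : Nontrivial (E l) := Submodule.nontrivial_iff_ne_bot.2 hl0
    obtain ⟨x, hx⟩ := exists_ne (0 : E l)
    obtain ⟨e, he, -⟩ := exists_dual_vector ℝ x (by simpa using hx)
    have := h.blockEstimates.extend_dual l l hl le_rfl
    rw [blockSum_self] at this
    obtain ⟨f, -, hf, hfn⟩ := this e
    exact ⟨f, by simpa [he] using hfn, by rw [hf, he]⟩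
  obtain ⟨f, hf, hf1⟩ := hex i hi h1
  obtain ⟨g, hg, hg1⟩ := hex (i + 1) (by omega) h2
  have hle : ∀ (f : StrongDual ℝ X) (S : Submodule ℝ X), ‖restr f S‖ ≤ ‖f‖ := fun f S =>
    norm_restr_le (norm_nonneg f) fun y _ => f.le_opNorm y
  -- Take `f ± 0.3 g`: the norm is at most 3.25, on `E i` at least 1 - 0.75 = 0.25 remains, and
  -- since the two differ by `0.6 g`, one of them has norm at least 0.3 on `E (i + 1)`. Dividing by
  -- 3.25 leaves more than 1/50 on both.
  have hmain : ∀ t : ℝ, |t| = 0.3 → 0.3 ≤ ‖restr (f + t • g) (E (i + 1))‖ →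
      ∃ f : StrongDual ℝ X, ‖f‖ ≤ 1 ∧ 1 / 50 < ‖restr f (E i)‖ ∧
        1 / 50 < ‖restr f (E (i + 1))‖ := by
    intro t ht hlarge
    have hscale : ∀ S : Submodule ℝ X,
        ‖restr (f + t • g) S‖ ≤ 3.25 * ‖restr ((1 / 3.25 : ℝ) • (f + t • g)) S‖ := by
      intro S
      have h3 := norm_restr_comb_le ((1 / 3.25 : ℝ) • (f + t • g)) 0 3.25 0 S
      have h4 : (3.25 : ℝ) • (1 / 3.25 : ℝ) • (f + t • g) + (0 : ℝ) • (0 : StrongDual ℝ X) =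
          f + t • g := by rw [smul_smul]; norm_num
      rw [h4, abs_zero, zero_mul, add_zero, abs_of_pos (by norm_num)] at h3
      exact h3
    refine ⟨(1 / 3.25 : ℝ) • (f + t • g), ?_, ?_, ?_⟩
    · have h3 : ‖f + t • g‖ ≤ 3.25 := by
        refine (norm_add_le _ _).trans ?_
        rw [norm_smul, Real.norm_eq_abs, ht]
        linarith
      rw [norm_smul, Real.norm_of_nonneg (by norm_num)]
      linarith
    · have h3 := norm_restr_comb_le (f + t • g) g 1 (-t) (E i)
      have h4 : (1 : ℝ) • (f + t • g) + (-t) • g = f := by module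
      rw [h4, abs_one, one_mul, abs_neg, ht, hf1] at h3
      have := (hle g (E i)).trans hg
      have := hscale (E i)
      linarith
    · have := hscale (E (i + 1))
      linarith
  by_cases hlarge : 0.3 ≤ ‖restr (f + (0.3 : ℝ) • g) (E (i + 1))‖
  · exact hmain 0.3 (by norm_num) hlarge
  · refine hmain (-0.3) (by norm_num) ?_
    have h3 := norm_restr_comb_le (f + (0.3 : ℝ) • g) (f + (-0.3 : ℝ) • g) (1 / 0.6) (-1 / 0.6)
      (E (i + 1))
    have h4 : (1 / 0.6 : ℝ) • (f + (0.3 : ℝ) • g) + (-1 / 0.6 : ℝ) • (f + (-0.3 : ℝ) • g) = g := by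
      module
    rw [h4, hg1, abs_of_pos (by norm_num), abs_of_neg (by norm_num)] at h3
    linarith

/-- Functionals in the unit ball are close to functionals that vanish on some `E j` in every
interval. -/
theorem exists_skipped_near {ε : ℕ → ℝ} {n : ℕ → ℕ} (hε0 : ∀ k, 0 < ε k) (hεs : Summable ε)
    (hεt : ∑' k, ε k < 1 / 50) (hn : Admissible E ε n) (f : StrongDual ℝ X) (hf : ‖f‖ ≤ 1) :
    ∃ g : StrongDual ℝ X, ‖f - g‖ ≤ 1 / 20 ∧
      ∀ k, ∃ l ∈ Set.Icc (n (k + 1)) (n (k + 2)), ∀ x ∈ E l, g x = 0 := by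
  classical
  have hε : ∀ k, ε k < 1 / 50 := fun k =>
    (hεs.le_tsum k fun i _ => (hε0 i).le).trans_lt hεt
  -- Two adjacent endpoints form a whole interval, and a functional large on both spaces would
  -- contradict admissibility.
  have hadj : ∀ i i', n i + 1 = n i' → 1 ≤ n i → E (n i) ≠ ⊥ → E (n i') = ⊥ := by
    intro i i' hii' hi1 h1
    by_contra h2
    obtain ⟨i, rfl⟩ : ∃ i₀, i = i₀ + 1 := by
      refine Nat.exists_eq_add_of_le' ?_
      rcases Nat.eq_zero_or_pos i with rfl | h0
      · rw [hn.zero] at hi1; omega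
      · exact h0
    have hlt : i + 1 < i' := hn.strictMono.lt_iff_lt.1 (by omega)
    have hi' : n (i + 2) = n i' := by
      refine le_antisymm (hn.strictMono.monotone hlt) ?_
      have := hn.strictMono (show i + 1 < i + 2 by omega)
      omega
    rw [← hi', show n (i + 2) = n (i + 1) + 1 by omega] at h2
    obtain ⟨g, hg, hg1, hg2⟩ := h.exists_large_on_both hi1 h1 h2
    obtain ⟨l, hl, hgl⟩ := hn.small i g hg
    have := hε i
    have : l = n (i + 1) ∨ l = n (i + 1) + 1 := by rw [Set.mem_Icc] at hl; omega
    rcases this with rfl | rfl <;> linarith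
  choose j hj hjf using fun k => hn.small k f hf
  have hj1 : ∀ k, 1 ≤ j k := fun k => by
    have h1 := (hj k).1
    have h2 := hn.strictMono.le_apply (x := k + 1)
    omega
  -- The extension of `f` from `E l` may disturb the neighbouring spaces, so the selected indices
  -- must not be adjacent. `S` keeps the selected endpoints and drops interior indices next to one
  -- of them; that endpoint then serves the same interval.
  let J : Set ℕ := {l | E l ≠ ⊥ ∧ ∃ k, j k = l}
  let S₀ : Set ℕ := {l | l ∈ J ∧ ∃ i, n i = l}
  let S : Set ℕ := {l | l ∈ J ∧ ((∃ i, n i = l) ∨ (l + 1 ∉ S₀ ∧ ∀ l', l' + 1 = l → l' ∉ S₀))}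
  have hsep : ∀ l, l ∈ S → l + 1 ∉ S := by
    rintro l ⟨⟨hl, k, hk⟩, hl'⟩ ⟨⟨hm, k', hk'⟩, hm'⟩
    by_cases h1 : ∃ i, n i = l
    · by_cases h2 : ∃ i, n i = l + 1
      · obtain ⟨i, hi⟩ := h1
        obtain ⟨i', hi'⟩ := h2
        refine hm ?_
        rw [← hi']
        refine hadj i i' (by omega) ?_ (by rwa [hi])
        rw [hi, ← hk]; exact hj1 k
      · exact (hm'.resolve_left h2).2 l rfl ⟨⟨hl, k, hk⟩, h1⟩
    · by_cases h2 : ∃ i, n i = l + 1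
      · exact (hl'.resolve_left h1).1 ⟨⟨hm, k', hk'⟩, h2⟩
      · have hk1 := hj k
        have hk2 := hj k'
        rw [Set.mem_Icc] at hk1 hk2
        have e1 : n (k + 1) ≠ l := fun h => h1 ⟨_, h⟩
        have e2 : n (k + 2) ≠ l := fun h => h1 ⟨_, h⟩
        have e3 : n (k' + 1) ≠ l + 1 := fun h => h2 ⟨_, h⟩
        have e4 : n (k' + 2) ≠ l + 1 := fun h => h2 ⟨_, h⟩
        rcases lt_trichotomy k k' with hlt | rfl | hlt
        · have := hn.strictMono.monotone (show k + 2 ≤ k' + 1 by omega)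
          omega
        · omega
        · have := hn.strictMono.monotone (show k' + 2 ≤ k + 1 by omega)
          omega
  have hcover : ∀ k, E (j k) = ⊥ ∨ ∃ l ∈ Set.Icc (n (k + 1)) (n (k + 2)), l ∈ S := by
    intro k
    by_cases hE : E (j k) = ⊥
    · exact Or.inl hE
    right
    have hJ : j k ∈ J := ⟨hE, k, rfl⟩
    by_cases hS : j k ∈ S
    · exact ⟨j k, hj k, hS⟩
    have h1 : ¬ ∃ i, n i = j k := fun h1 => hS ⟨hJ, Or.inl h1⟩
    have hk1 := hj k
    rw [Set.mem_Icc] at hk1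
    have e1 : n (k + 1) ≠ j k := fun h => h1 ⟨_, h⟩
    have e2 : n (k + 2) ≠ j k := fun h => h1 ⟨_, h⟩
    have h2 : ¬ (j k + 1 ∉ S₀ ∧ ∀ l', l' + 1 = j k → l' ∉ S₀) := fun h2 => hS ⟨hJ, Or.inr h2⟩
    rw [not_and_or] at h2
    push Not at h2
    rcases h2 with h2 | ⟨l', hl', h2⟩
    · exact ⟨j k + 1, by rw [Set.mem_Icc]; omega, h2.1, Or.inl h2.2⟩
    · exact ⟨l', by rw [Set.mem_Icc]; omega, h2.1, Or.inl h2.2⟩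
  have hext : ∀ l, ∃ y : StrongDual ℝ X, 1 ≤ l → y ∈ blockSum (biorth E) (l - 1) (l + 1) ∧
      (∀ x ∈ E l, y x = f x) ∧ ‖y‖ ≤ 2.5 * ‖restr f (E l)‖ := by
    intro l
    by_cases hl : 1 ≤ l
    · have := h.blockEstimates.extend_dual l l hl le_rfl
      rw [blockSum_self] at this
      obtain ⟨y, hy, hyf, hyn⟩ := this (restr f (E l))
      exact ⟨y, fun _ => ⟨hy, fun x hx => DFunLike.congr_fun hyf (⟨x, hx⟩ : E l), hyn⟩⟩
    · exact ⟨0, fun h => absurd h hl⟩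
  choose Y hY using hext
  -- A common endpoint may be selected for two intervals; its correction is subtracted only the
  -- first time.
  let y : ℕ → StrongDual ℝ X := fun k => if j k ∈ S ∧ ∀ i < k, j i ≠ j k then Y (j k) else 0
  have hyn : ∀ k, ‖y k‖ ≤ 2.5 * ε k := by
    intro k
    simp only [y]
    split_ifs
    · refine (hY (j k) (hj1 k)).2.2.trans ?_
      gcongr
      exact hjf k
    · rw [norm_zero]
      have := hε0 k
      positivity
  have hys : Summable y := Summable.of_norm_bounded (hεs.mul_left 2.5) hyn
  have hval : ∀ l ∈ S, ∀ x ∈ E l, (∑' k, y k) x = f x := by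
    intro l hl x hx
    have hex : ∃ k, j k = l := hl.1.2
    have h1 : (∑' k, y k) x = ∑' k, y k x :=
      (ContinuousLinearMap.apply ℝ ℝ x).map_tsum hys
    have hfind := Nat.find_spec hex
    rw [h1, tsum_eq_single (Nat.find hex)]
    · simp only [y]
      rw [if_pos, hfind]
      · exact (hY l (hfind ▸ hj1 _)).2.1 x hx
      · rw [hfind]
        exact ⟨hl, fun i hi => Nat.find_min hex hi⟩
    · intro k hk
      simp only [y]
      split_ifs with hc
      · have hne : j k ≠ l := by
          intro hkl
          refine hk (le_antisymm ?_ (Nat.find_min' hex hkl))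
          by_contra! hlt
          exact hc.2 _ hlt (by rw [hfind, hkl])
        refine vanish_of_mem_blockSum_biorth (hY (j k) (hj1 k)).1 ?_ hx
        intro hmem
        rw [Set.mem_Icc] at hmem
        have h2 : l = j k + 1 ∨ l + 1 = j k := by have := hj1 k; omega
        rcases h2 with h2 | h2
        · exact hsep _ hc.1 (h2 ▸ hl)
        · exact hsep _ hl (h2 ▸ hc.1)
      · rfl
  refine ⟨f - ∑' k, y k, ?_, fun k => ?_⟩
  · rw [sub_sub_cancel]
    refine (tsum_of_norm_bounded (hεs.hasSum.mul_left 2.5) hyn).trans ?_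
    linarith
  · rcases hcover k with hk | ⟨l, hl, hlS⟩
    · refine ⟨j k, hj k, fun x hx => ?_⟩
      rw [hk, Submodule.mem_bot] at hx
      rw [hx, map_zero]
    · exact ⟨l, hl, fun x hx => by rw [sub_apply, hval l hlS x hx, sub_self]⟩

end IsBlockFMD

end Admissible

/-! ### Functionals as measures on a compact norming set, and uniform smallness on tails. -/

section Representation

open MeasureTheory CompactlySupported

variable {P : Type*} [SeminormedAddCommGroup P] [NormedSpace ℝ P] {K : Type*} [TopologicalSpace K]
  [CompactSpace K] [Nonempty K]

/-- A functional dominated by a supremum over a compact space is given by a measure. -/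
theorem exists_measure_representation [T2Space K] [MeasurableSpace K] [BorelSpace K]
    (b : K → P →ₗ[ℝ] ℝ) (hcont : ∀ z, Continuous fun κ => b κ z)
    (hnorm : ∀ z, ∀ r < ‖z‖, ∃ κ, r < b κ z) (φ : StrongDual ℝ P) :
    ∃ μ : Measure K, IsFiniteMeasure μ ∧ ∀ z, φ z = ∫ κ, b κ z ∂μ := by
  have hbdd : ∀ (z : P) (f : C_c(K, ℝ)), BddAbove (Set.range fun κ => b κ z + f κ) := fun z f =>
    (isCompact_range ((hcont z).add f.continuous)).bddAbove
  -- This sublinear functional depends only on `b · z + f`. A linear functional below it is positive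
  -- on the second factor and vanishes where `b · z + f = 0`, so it computes `φ z` as its value at
  -- the function `κ ↦ b κ z`.
  let p : P × C_c(K, ℝ) → ℝ := fun x => ‖φ‖ * ⨆ κ, (b κ x.1 + x.2 κ)
  obtain ⟨g, hg, hgp⟩ := exists_extension_of_le_sublinear
    (E := P × C_c(K, ℝ))
    ⟨Submodule.prod ⊤ ⊥, φ.toLinearMap ∘ₗ LinearMap.fst ℝ P C_c(K, ℝ) ∘ₗ Submodule.subtype _⟩ p
    (by
      intro c hc x
      simp only [p]
      rw [← mul_assoc, mul_comm c, mul_assoc, Real.mul_iSup_of_nonneg hc.le]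
      congr 2
      funext κ
      simp [mul_add])
    (by
      intro x y
      simp only [p]
      rw [← mul_add]
      gcongr
      refine ciSup_le fun κ => ?_
      have h1 := le_ciSup (hbdd x.1 x.2) κ
      have h2 := le_ciSup (hbdd y.1 y.2) κ
      simp only [Prod.fst_add, Prod.snd_add, map_add, CompactlySupportedContinuousMap.coe_add,
        Pi.add_apply] at *
      linarith)
    (by
      rintro ⟨⟨z, f⟩, -, hf⟩
      have hf0 : f = 0 := by simpa using hf
      subst hf0
      refine (le_abs_self _).trans ((φ.le_opNorm z).trans ?_)
      refine mul_le_mul_of_nonneg_left ?_ (norm_nonneg φ)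
      refine le_of_forall_lt fun r hr => ?_
      obtain ⟨κ, hκ⟩ := hnorm z r hr
      refine hκ.trans_le ?_
      have := le_ciSup (hbdd z 0) κ
      simpa using this)
  let Λ₀ : C_c(K, ℝ) →ₗ[ℝ] ℝ := g ∘ₗ LinearMap.inr ℝ P C_c(K, ℝ)
  have hpos : ∀ f : C_c(K, ℝ), 0 ≤ f → 0 ≤ Λ₀ f := by
    intro f hf
    have h1 := hgp (0, -f)
    have h2 : g (0, -f) = -Λ₀ f := by
      simp only [Λ₀, LinearMap.comp_apply, LinearMap.inr_apply]
      rw [← map_neg]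
      simp
    have h3 : p (0, -f) ≤ 0 := by
      refine mul_nonpos_of_nonneg_of_nonpos (norm_nonneg φ) (ciSup_le fun κ => ?_)
      have := hf κ
      simp only [map_zero, CompactlySupportedContinuousMap.coe_neg, Pi.neg_apply, zero_add]
      simpa using this
    linarith
  let Λ : C_c(K, ℝ) →ₚ[ℝ] ℝ := PositiveLinearMap.mk₀ Λ₀ hpos
  refine ⟨RealRMK.rieszMeasure Λ, inferInstance, fun z => ?_⟩
  let f : C_c(K, ℝ) :=
    CompactlySupportedContinuousMap.continuousMapEquiv ⟨fun κ => b κ z, hcont z⟩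
  have hf : ∀ κ, f κ = b κ z := fun _ => rfl
  have h1 : ∫ κ, b κ z ∂(RealRMK.rieszMeasure Λ) = Λ₀ f := by
    rw [show Λ₀ f = Λ f from rfl, ← RealRMK.integral_rieszMeasure Λ f]
    rfl
  rw [h1]
  have h2 : g (z, 0) = φ z := hg ⟨(z, 0), by simp⟩
  have h3 : ∀ (z' : P) (f' : C_c(K, ℝ)), (∀ κ, b κ z' + f' κ = 0) → g (z', 0) + Λ₀ f' ≤ 0 := by
    intro z' f' h0
    have h4 : g (z', 0) + Λ₀ f' = g (z', f') := by
      simp only [Λ₀, LinearMap.comp_apply, LinearMap.inr_apply]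
      rw [← map_add]
      simp
    rw [h4]
    refine (hgp _).trans ?_
    simp [p, h0]
  have h4 := h3 z (-f) fun κ => by simp [hf]
  have h5 := h3 (-z) f fun κ => by simp [hf]
  have h6 : g (-z, 0) = - g (z, 0) := by
    rw [← map_neg]
    simp
  rw [map_neg] at h4
  rw [h6] at h5
  linarith

/-- If the functionals in a compact norming set are uniformly small on tails, one at a time, then
so are all functionals. -/
theorem tail_small_of_compact [T2Space K]
    (b : K → P →ₗ[ℝ] ℝ) (hcont : ∀ z, Continuous fun κ => b κ z)
    (hle : ∀ κ z, |b κ z| ≤ ‖z‖) (hnorm : ∀ z, ∀ r < ‖z‖, ∃ κ, r < b κ z)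
    (S : ℕ → P →ₗ[ℝ] P) {C : ℝ} (hS : ∀ N z, ‖S N z‖ ≤ C * ‖z‖)
    (htail : ∀ κ, ∀ η : ℝ, 0 < η → ∃ L, ∀ N, L ≤ N → ∀ z, |b κ (z - S N z)| ≤ η * ‖z‖)
    (φ : StrongDual ℝ P) {η : ℝ} (hη : 0 < η) :
    ∃ L, ∀ N, L ≤ N → ∀ z, |φ (z - S N z)| ≤ η * ‖z‖ := by
  by_contra! hcon
  choose N hN z hz using hcon
  let _ : MeasurableSpace K := borel K
  have : BorelSpace K := ⟨rfl⟩
  obtain ⟨μ, hμ, hφ⟩ := exists_measure_representation b hcont hnorm φ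
  have hsub : ∀ L, ‖z L - S (N L) (z L)‖ ≤ (1 + C) * ‖z L‖ := fun L => by
    refine (norm_sub_le _ _).trans ?_
    have := hS (N L) (z L)
    linarith
  have hz0 : ∀ L, 0 < ‖z L‖ := by
    intro L
    refine lt_of_le_of_ne (norm_nonneg _) fun h0 => ?_
    have h1 := hsub L
    have h2 := φ.le_opNorm (z L - S (N L) (z L))
    have h3 := hz L
    rw [← h0] at h1 h3
    have h4 : ‖z L - S (N L) (z L)‖ = 0 := le_antisymm (by simpa using h1) (norm_nonneg _)
    rw [h4, Real.norm_eq_abs] at h2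
    linarith
  -- Normalized counterexamples: as functions on `K` they are bounded by 1 + C and tend pointwise to
  -- zero, so their integrals tend to zero, while `φ` stays above η on them in absolute value.
  let w : ℕ → P := fun L => ‖z L‖⁻¹ • (z L - S (N L) (z L))
  have hw1 : ∀ L, ‖w L‖ ≤ 1 + C := by
    intro L
    rw [norm_smul, norm_inv, norm_norm, inv_mul_le_iff₀ (hz0 L), mul_comm]
    exact hsub L
  have hw2 : ∀ L, η < |φ (w L)| := by
    intro L
    simp only [w]
    rw [map_smul, smul_eq_mul, abs_mul, abs_inv, abs_norm, lt_inv_mul_iff₀ (hz0 L), mul_comm]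
    exact hz L
  have hlim : Tendsto (fun L => ∫ κ, b κ (w L) ∂μ) atTop (𝓝 (∫ _, 0 ∂μ)) := by
    refine tendsto_integral_of_dominated_convergence (fun _ => 1 + C)
      (fun L => (hcont _).aestronglyMeasurable) (integrable_const _)
      (fun L => Eventually.of_forall fun κ => (hle κ _).trans (hw1 L))
      (Eventually.of_forall fun κ => ?_)
    rw [Metric.tendsto_atTop]
    intro η' hη'
    obtain ⟨L₀, hL₀⟩ := htail κ (η' / 2) (half_pos hη')
    refine ⟨L₀, fun L hL => ?_⟩
    have := hL₀ (N L) (hL.trans (hN L)) (z L)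
    rw [dist_zero_right, Real.norm_eq_abs]
    simp only [w]
    rw [map_smul, smul_eq_mul, abs_mul, abs_inv, abs_norm, inv_mul_lt_iff₀ (hz0 L), mul_comm]
    refine this.trans_lt ?_
    have := hz0 L
    nlinarith
  rw [integral_zero] at hlim
  obtain ⟨L, hL⟩ := ((Metric.tendsto_atTop.1 hlim) η hη)
  have := hL L le_rfl
  rw [dist_zero_right, ← hφ, Real.norm_eq_abs] at this
  exact lt_asymm this (hw2 L)

end Representation

/-! ### FDDs from bounded partial sum projections. -/

section Projections

variable {Z : Type*} [NormedAddCommGroup Z] [NormedSpace ℝ Z] {G : ℕ → Submodule ℝ Z}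
  {S : ℕ → Z →L[ℝ] Z}

/-- A sequence of partial sum projections for the sequence `G` of subspaces. -/
structure IsPartialSums (G : ℕ → Submodule ℝ Z) (S : ℕ → Z →L[ℝ] Z) : Prop where
  finiteDimensional : ∀ k, FiniteDimensional ℝ (G k)
  dense : (⨆ k, G k).topologicalClosure = ⊤
  apply_of_lt : ∀ N k, k < N → ∀ v ∈ G k, S N v = v
  apply_of_le : ∀ N k, N ≤ k → ∀ v ∈ G k, S N v = 0
  bounded : ∃ C, ∀ N, ‖S N‖ ≤ C

namespace IsPartialSums

variable (h : IsPartialSums G S)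
include h

theorem induction {p : Z → Prop} (hp : IsClosed {z | p z}) (hG : ∀ k, ∀ v ∈ G k, p v)
    (h0 : p 0) (hadd : ∀ v w, p v → p w → p (v + w)) (z : Z) : p z := by
  have hz : z ∈ closure ((⨆ k, G k : Submodule ℝ Z) : Set Z) := by
    have : z ∈ (⨆ k, G k).topologicalClosure := h.dense ▸ Submodule.mem_top
    exact this
  refine closure_minimal (fun w hw => ?_) hp hz
  exact Submodule.iSup_induction G (motive := p) hw hG h0 hadd

theorem coord_of_mem {k : ℕ} {v : Z} (hv : v ∈ G k) : (S (k + 1) - S k) v = v := by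
  rw [sub_apply, h.apply_of_lt _ _ k.lt_succ_self v hv,
    h.apply_of_le _ _ le_rfl v hv, sub_zero]

theorem coord_of_ne {k l : ℕ} (hkl : l ≠ k) {v : Z} (hv : v ∈ G l) : (S (k + 1) - S k) v = 0 := by
  rw [sub_apply]
  rcases lt_or_gt_of_ne hkl with hlt | hlt
  · rw [h.apply_of_lt _ _ (by omega) v hv, h.apply_of_lt _ _ hlt v hv, sub_self]
  · rw [h.apply_of_le _ _ (by omega) v hv, h.apply_of_le _ _ hlt.le v hv, sub_self]

theorem coord_mem (k : ℕ) (z : Z) : (S (k + 1) - S k) z ∈ G k := by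
  have := h.finiteDimensional k
  refine h.induction (p := fun z => (S (k + 1) - S k) z ∈ G k) ?_ ?_ ?_ ?_ z
  · exact (G k).closed_of_finiteDimensional.preimage (S (k + 1) - S k).continuous
  · intro l v hv
    rcases eq_or_ne l k with rfl | hlk
    · rwa [h.coord_of_mem hv]
    · rw [h.coord_of_ne hlk hv]; exact zero_mem _
  · rw [map_zero]; exact zero_mem _
  · intro v w hv hw
    rw [map_add]; exact add_mem hv hw

theorem zero_apply (z : Z) : S 0 z = 0 := by
  refine h.induction (p := fun z => S 0 z = 0) (isClosed_eq (S 0).continuous continuous_const)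
    (fun k v hv => h.apply_of_le 0 k k.zero_le v hv) (map_zero _) (fun v w hv hw => ?_) z
  rw [map_add, hv, hw, add_zero]

theorem eq_sum (N : ℕ) (z : Z) : ∑ k ∈ Finset.range N, (S (k + 1) - S k) z = S N z := by
  simp only [sub_apply]
  rw [Finset.sum_range_sub (fun k => S k z), h.zero_apply, sub_zero]

theorem tendsto (z : Z) : Tendsto (fun N => S N z) atTop (𝓝 z) := by
  obtain ⟨C, hC⟩ := h.bounded
  have hC0 : 0 ≤ C := (norm_nonneg _).trans (hC 0)
  rw [Metric.tendsto_atTop]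
  intro η hη
  have hd := Submodule.dense_iff_topologicalClosure_eq_top.2 h.dense
  obtain ⟨w, hw, hzw⟩ := Metric.mem_closure_iff.1 (hd z) (η / (C + 2)) (by positivity)
  have hev : ∃ L, ∀ N, L ≤ N → S N w = w := by
    refine Submodule.iSup_induction G (motive := fun w => ∃ L, ∀ N, L ≤ N → S N w = w) hw
      (fun k v hv => ⟨k + 1, fun N hN => h.apply_of_lt N k hN v hv⟩)
      ⟨0, fun N _ => map_zero _⟩ ?_
    rintro v w ⟨L, hL⟩ ⟨L', hL'⟩
    exact ⟨max L L', fun N hN => by rw [map_add, hL N (by omega), hL' N (by omega)]⟩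
  obtain ⟨L, hL⟩ := hev
  refine ⟨L, fun N hN => ?_⟩
  rw [dist_eq_norm] at hzw ⊢
  have h1 : S N z - z = S N (z - w) - (z - w) := by rw [map_sub, hL N hN]; abel
  rw [h1]
  calc ‖S N (z - w) - (z - w)‖ ≤ C * ‖z - w‖ + ‖z - w‖ :=
        (norm_sub_le _ _).trans (by gcongr; exact (S N).le_of_opNorm_le (hC N) _)
    _ = (C + 1) * ‖z - w‖ := by ring
    _ ≤ (C + 1) * (η / (C + 2)) := by gcongr
    _ < (C + 2) * (η / (C + 2)) := by gcongr; linarith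
    _ = η := by field_simp

theorem seriesTendsto (z : Z) : SeriesTendsto (fun k => (S (k + 1) - S k) z) z :=
  (h.tendsto z).congr fun N => (h.eq_sum N z).symm

theorem comp_coord_mem_biorth (f : StrongDual ℝ Z) (k : ℕ) :
    f.comp (S (k + 1) - S k) ∈ biorth G k :=
  IsTower.mem_biorth_iff.2 fun j hj x hx => by
    rw [ContinuousLinearMap.comp_apply, h.coord_of_ne hj hx, map_zero]

theorem coord_eq_of_seriesTendsto {y : ℕ → Z} (hy : ∀ k, y k ∈ G k) {z : Z}
    (hz : SeriesTendsto y z) (m : ℕ) : y m = (S (m + 1) - S m) z := by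
  have h1 := ((S (m + 1) - S m).continuous.tendsto z).comp hz
  refine tendsto_nhds_unique (tendsto_const_nhds.congr' ?_) h1
  filter_upwards [eventually_gt_atTop m] with N hN
  simp only [Function.comp_apply, map_sum]
  rw [Finset.sum_eq_single_of_mem m (Finset.mem_range.2 hN), h.coord_of_mem (hy m)]
  exact fun k _ hk => h.coord_of_ne hk (hy k)

theorem isFDD : IsFDD G where
  finiteDimensional := h.finiteDimensional
  fundamental := h.dense
  minimal k := by
    rw [eq_bot_iff]
    rintro x ⟨hx, hx'⟩
    have hle : (⨆ (j : ℕ) (_ : j ≠ k), G j).topologicalClosure ≤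
        LinearMap.ker (S (k + 1) - S k).toLinearMap :=
      Submodule.topologicalClosure_minimal _
        (iSup₂_le fun j hj v hv => h.coord_of_ne hj hv) (S (k + 1) - S k).isClosed_ker
    rw [Submodule.mem_bot, ← h.coord_of_mem hx]
    exact hle hx'
  total x hx := by
    refine tendsto_nhds_unique (h.seriesTendsto x) ?_
    have h0 : ∀ k, (S (k + 1) - S k) x = 0 := fun k =>
      SeparatingDual.eq_zero_of_forall_dual_eq_zero (R := ℝ)
        fun f => hx k _ (h.comp_coord_mem_biorth f k)
    simp only [h0, Finset.sum_const_zero]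
    exact tendsto_const_nhds
  existsUnique_expansion x :=
    ⟨fun k => (S (k + 1) - S k) x, ⟨fun k => h.coord_mem k x, h.seriesTendsto x⟩,
      fun _ hy => funext fun k => h.coord_eq_of_seriesTendsto hy.1 hy.2 k⟩

theorem isShrinking
    (hs : ∀ F : StrongDual ℝ Z, ∀ η : ℝ, 0 < η → ∃ N, ‖F - F.comp (S N)‖ ≤ η) :
    IsShrinking G := by
  unfold IsShrinking
  rw [← Submodule.dense_iff_topologicalClosure_eq_top]
  intro F
  refine Metric.mem_closure_iff.2 fun η hη => ?_
  obtain ⟨N, hN⟩ := hs F (η / 2) (half_pos hη)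
  refine ⟨F.comp (S N), ?_, ?_⟩
  · have : F.comp (S N) = ∑ k ∈ Finset.range N, F.comp (S (k + 1) - S k) := by
      ext z
      simp only [ContinuousLinearMap.comp_apply, sum_apply]
      rw [← map_sum, h.eq_sum]
    rw [this]
    exact Submodule.sum_mem _ fun k _ =>
      (le_iSup (biorth G) k) (h.comp_coord_mem_biorth F k)
  · rw [dist_eq_norm]
    exact hN.trans_lt (half_lt_self hη)

omit h in
theorem _root_.FMD.isUnconditional_of_multipliers {C : ℝ}
    (hD : ∀ σ : ℕ → ℝ, (∀ k, σ k = 1 ∨ σ k = -1) →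
      ∃ D : Z →L[ℝ] Z, ‖D‖ ≤ C ∧ ∀ k, ∀ v ∈ G k, D v = σ k • v) :
    IsUnconditional G := by
  refine ⟨C, fun σ y x hσ hy hx hx1 => ?_⟩
  obtain ⟨D, hDC, hD⟩ := hD σ hσ
  refine ⟨D x, ?_, ?_⟩
  · refine ((D.continuous.tendsto x).comp hx).congr fun N => ?_
    simp only [Function.comp_apply, map_sum]
    exact Finset.sum_congr rfl fun k _ => hD k _ (hy k)
  · refine (D.le_of_opNorm_le hDC x).trans ?_
    have : 0 ≤ C := (norm_nonneg _).trans hDC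
    nlinarith

end IsPartialSums

end Projections

/-! ### Passage to the completion. -/

section Completion

open UniformSpace

variable {P : Type*} [SeminormedAddCommGroup P] [NormedSpace ℝ P]

theorem exists_completion_map (S : P →ₗ[ℝ] P) {C : ℝ} (hC : 0 ≤ C) (hS : ∀ z, ‖S z‖ ≤ C * ‖z‖) :
    ∃ T : Completion P →L[ℝ] Completion P, ‖T‖ ≤ C ∧ ∀ z : P, T z = (S z : Completion P) := by
  let e : P →ₗ[ℝ] Completion P := (Completion.toComplₗᵢ (𝕜 := ℝ) (E := P)).toLinearMap
  have he : ∀ z, e z = (z : Completion P) := fun _ => rfl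
  have hd : DenseRange e := Completion.denseRange_coe
  have hb : ∀ z, ‖(e ∘ₗ S) z‖ ≤ C * ‖e z‖ := fun z => by
    simpa only [LinearMap.comp_apply, he, Completion.norm_coe] using hS z
  exact ⟨(e ∘ₗ S).extendOfNorm e, LinearMap.opNorm_extendOfNorm_le hd hC hb, fun z =>
    LinearMap.extendOfNorm_eq hd ⟨C, hb⟩ z⟩

variable {V : ℕ → Type*} [∀ k, AddCommGroup (V k)] [∀ k, Module ℝ (V k)]

/-- The image in the completion of the range of a linear map. -/
def complRange {V : Type*} [AddCommGroup V] [Module ℝ V] (s : V →ₗ[ℝ] P) :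
    Submodule ℝ (Completion P) :=
  LinearMap.range ((Completion.toComplₗᵢ (𝕜 := ℝ) (E := P)).toLinearMap ∘ₗ s)

theorem exists_isPartialSums (s : ∀ k, V k →ₗ[ℝ] P) [∀ k, FiniteDimensional ℝ (V k)]
    (hs : ⨆ k, LinearMap.range (s k) = ⊤) (S : ℕ → P →ₗ[ℝ] P)
    (hlt : ∀ N k, k < N → ∀ v, S N (s k v) = s k v) (hle : ∀ N k, N ≤ k → ∀ v, S N (s k v) = 0)
    {C : ℝ} (hC : 0 ≤ C) (hS : ∀ N z, ‖S N z‖ ≤ C * ‖z‖) :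
    ∃ T : ℕ → Completion P →L[ℝ] Completion P, (∀ N (z : P), T N z = (S N z : Completion P)) ∧
      IsPartialSums (fun k => complRange (s k)) T := by
  choose T hT1 hT2 using fun N => exists_completion_map (S N) hC (hS N)
  refine ⟨T, hT2, ⟨fun k => ?_, ?_, ?_, ?_, C, hT1⟩⟩
  · unfold complRange
    infer_instance
  · rw [← Submodule.dense_iff_topologicalClosure_eq_top]
    refine Completion.denseRange_coe.mono ?_
    rintro _ ⟨z, rfl⟩
    have hz : z ∈ ⨆ k, LinearMap.range (s k) := hs ▸ Submodule.mem_top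
    have : (⨆ k, LinearMap.range (s k)) ≤ (⨆ k, complRange (s k)).comap
        (Completion.toComplₗᵢ (𝕜 := ℝ) (E := P)).toLinearMap := by
      refine iSup_le fun k => ?_
      rintro _ ⟨v, rfl⟩
      exact (le_iSup (fun k => complRange (s k)) k) ⟨v, rfl⟩
    exact this hz
  · rintro N k hk _ ⟨v, rfl⟩
    exact (hT2 N _).trans (congrArg _ (hlt N k hk v))
  · rintro N k hk _ ⟨v, rfl⟩
    refine (hT2 N _).trans ?_
    rw [hle N k hk v]
    exact Completion.coe_zero

theorem norm_sub_comp_le (F : StrongDual ℝ (Completion P)) (S : P →ₗ[ℝ] P)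
    (T : Completion P →L[ℝ] Completion P) (hT : ∀ z : P, T z = (S z : Completion P)) {η : ℝ}
    (hη : 0 ≤ η) (h : ∀ z : P, |F ((z - S z : P) : Completion P)| ≤ η * ‖z‖) :
    ‖F - F.comp T‖ ≤ η := by
  refine ContinuousLinearMap.opNorm_le_bound _ hη fun w => ?_
  induction w using Completion.induction_on with
  | hp => exact isClosed_le (by fun_prop) (by fun_prop)
  | ih z =>
    rw [Completion.norm_coe]
    refine le_trans (le_of_eq ?_) (h z)
    rw [sub_apply, ContinuousLinearMap.comp_apply, hT, Completion.coe_sub, map_sub,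
      Real.norm_eq_abs]

/-- A criterion for the coordinate spaces to be a shrinking decomposition of the completion. -/
theorem isFDD_isShrinking_of_compact {K : Type*} [TopologicalSpace K] [CompactSpace K] [Nonempty K]
    [T2Space K] (b : K → P →ₗ[ℝ] ℝ) (hcont : ∀ z, Continuous fun κ => b κ z)
    (hle : ∀ κ z, |b κ z| ≤ ‖z‖) (hnorm : ∀ z, ∀ r < ‖z‖, ∃ κ, r < b κ z)
    (s : ∀ k, V k →ₗ[ℝ] P) [∀ k, FiniteDimensional ℝ (V k)]
    (hs : ⨆ k, LinearMap.range (s k) = ⊤) (S : ℕ → P →ₗ[ℝ] P)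
    (hlt : ∀ N k, k < N → ∀ v, S N (s k v) = s k v) (hge : ∀ N k, N ≤ k → ∀ v, S N (s k v) = 0)
    {C : ℝ} (hC : 0 ≤ C) (hS : ∀ N z, ‖S N z‖ ≤ C * ‖z‖)
    (htail : ∀ κ, ∀ η : ℝ, 0 < η → ∃ L, ∀ N, L ≤ N → ∀ z, |b κ (z - S N z)| ≤ η * ‖z‖) :
    IsFDD (fun k => complRange (s k)) ∧ IsShrinking (fun k => complRange (s k)) := by
  obtain ⟨T, hT, h⟩ := exists_isPartialSums s hs S hlt hge hC hS
  refine ⟨h.isFDD, h.isShrinking fun F η hη => ?_⟩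
  obtain ⟨L, hL⟩ := tail_small_of_compact b hcont hle hnorm S hS htail
    (F.comp (Completion.toComplL (𝕜 := ℝ) (E := P))) hη
  exact ⟨L, norm_sub_comp_le F (S L) (T L) (hT L) hη.le (hL L le_rfl)⟩

theorem isUnconditional_completion (s : ∀ k, V k →ₗ[ℝ] P) {C : ℝ} (hC : 0 ≤ C)
    (D : (ℕ → ℝ) → P →ₗ[ℝ] P) (hD : ∀ σ k v, D σ (s k v) = σ k • s k v)
    (hDC : ∀ σ : ℕ → ℝ, (∀ k, σ k = 1 ∨ σ k = -1) → ∀ z, ‖D σ z‖ ≤ C * ‖z‖) :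
    IsUnconditional (fun k => complRange (s k)) := by
  refine isUnconditional_of_multipliers (C := C) fun σ hσ => ?_
  obtain ⟨T, hT1, hT2⟩ := exists_completion_map (D σ) hC (hDC σ hσ)
  refine ⟨T, hT1, ?_⟩
  rintro k _ ⟨v, rfl⟩
  refine (hT2 _).trans ?_
  rw [hD]
  exact Completion.coe_smul _ _

end Completion

/-! ### The space Z: shrinking and unconditional FDD. -/

section ZSpace

variable {X : Type*} [NormedAddCommGroup X] [NormedSpace ℝ X] {E : ℕ → Submodule ℝ X} {n : ℕ → ℕ}

namespace PreZ

theorem iSup_range_single : ⨆ k, LinearMap.range (single E n k) = ⊤ :=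
  DFinsupp.iSup_range_lsingle

theorem submodule_eq_top {Q : Submodule ℝ (PreZ E n)}
    (hQ : ∀ k l (hl : n k < l ∧ l < n (k + 2)) (x : E l), single E n k ⟨x, mem_ZBlock hl x⟩ ∈ Q) :
    Q = ⊤ := by
  rw [eq_top_iff, ← iSup_range_single]
  refine iSup_le fun k => ?_
  have hle : ZBlock E n k ≤ (Q.comap (single E n k)).map (ZBlock E n k).subtype := by
    refine iSup₂_le fun l hl x hx => ?_
    exact ⟨⟨x, mem_ZBlock hl ⟨x, hx⟩⟩, hQ k l hl ⟨x, hx⟩, rfl⟩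
  rintro _ ⟨⟨v, hv⟩, rfl⟩
  obtain ⟨w, hw, hwv⟩ := hle hv
  have : w = ⟨v, hv⟩ := Subtype.ext hwv
  exact this ▸ hw

theorem hom_ext {M : Type*} [AddCommGroup M] [Module ℝ M] {f g : PreZ E n →ₗ[ℝ] M}
    (h : ∀ k v, f (single E n k v) = g (single E n k v)) : f = g :=
  DFinsupp.lhom_ext' fun k => LinearMap.ext fun v => h k v

theorem pairing_single (f : ℕ → StrongDual ℝ X) (k : ℕ) (v : ZBlock E n k) :
    pairing E n f (single E n k v) = f k v :=
  DFinsupp.lsum_single _ _ _ _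

theorem pairing_smul (f : ℕ → StrongDual ℝ X) (c : ℝ) (z : PreZ E n) :
    pairing E n (fun k => c • f k) z = c * pairing E n f z := by
  have : pairing E n (fun k => c • f k) = c • pairing E n f := hom_ext fun k v => by
    simp [pairing_single]
  rw [this]; rfl

/-- The diagonal operator with the multipliers `σ`. -/
def mapCoord (E : ℕ → Submodule ℝ X) (n : ℕ → ℕ) (σ : ℕ → ℝ) : PreZ E n →ₗ[ℝ] PreZ E n :=
  DFinsupp.mapRange.linearMap fun k => σ k • (LinearMap.id : ZBlock E n k →ₗ[ℝ] ZBlock E n k)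

theorem mapCoord_single (σ : ℕ → ℝ) (k : ℕ) (v : ZBlock E n k) :
    mapCoord E n σ (single E n k v) = σ k • single E n k v := by
  rw [← map_smul]
  exact DFinsupp.mapRange_single (hf := fun k => map_zero _)

theorem pairing_mapCoord (f : ℕ → StrongDual ℝ X) (σ : ℕ → ℝ) (z : PreZ E n) :
    pairing E n f (mapCoord E n σ z) = pairing E n (fun k => σ k • f k) z := by
  have : pairing E n f ∘ₗ mapCoord E n σ = pairing E n (fun k => σ k • f k) :=
    hom_ext fun k v => by
      rw [LinearMap.comp_apply, mapCoord_single, map_smul, pairing_single, pairing_single]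
      rfl
  exact LinearMap.congr_fun this z

/-- Pointwise boundedness is needed for the supremum of seminorms defining the norm of `PreZ` to be
the actual supremum. -/
theorem exists_pairing_le (z : PreZ E n) (c : ℝ) :
    ∃ C, ∀ f : ℕ → StrongDual ℝ X, (∀ k, ‖f k‖ ≤ c) → |pairing E n f z| ≤ C := by
  let Q : Submodule ℝ (PreZ E n) :=
    { carrier := {z | ∃ C, ∀ f : ℕ → StrongDual ℝ X, (∀ k, ‖f k‖ ≤ c) → |pairing E n f z| ≤ C}
      zero_mem' := ⟨0, fun f _ => by simp⟩
      add_mem' := by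
        rintro z w ⟨C, hC⟩ ⟨C', hC'⟩
        refine ⟨C + C', fun f hf => ?_⟩
        rw [map_add]
        exact (abs_add_le _ _).trans (add_le_add (hC f hf) (hC' f hf))
      smul_mem' := by
        rintro a z ⟨C, hC⟩
        refine ⟨|a| * C, fun f hf => ?_⟩
        rw [map_smul, smul_eq_mul, abs_mul]
        exact mul_le_mul_of_nonneg_left (hC f hf) (abs_nonneg a) }
  have : Q = ⊤ := submodule_eq_top fun k l hl x => ⟨c * ‖(x : X)‖, fun f hf => by
    rw [pairing_single]
    exact (f k).le_of_opNorm_le (hf k) _⟩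
  have hz : z ∈ Q := by
    rw [this]
    trivial
  exact hz

end PreZ

theorem neg_mem_skippedSeqBall {f : ℕ → StrongDual ℝ X} (hf : f ∈ skippedSeqBall E n) :
    (fun k => -f k) ∈ skippedSeqBall E n := by
  obtain ⟨j, hj0, hj, hs, g, hg, hg1⟩ := hf
  refine ⟨j, hj0, hj, fun k => ?_, -g, ?_, by rwa [norm_neg]⟩
  · rintro l ⟨x, hx, hfx⟩
    exact hs k ⟨x, hx, by simpa using hfx⟩
  · refine (Tendsto.neg hg).congr fun N => ?_
    rw [Finset.sum_neg_distrib]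

theorem zero_mem_skippedSeqBall (hn : Monotone n) : 0 ∈ skippedSeqBall E n := by
  refine ⟨fun k => if k = 0 then 0 else n k, if_pos rfl, fun k => ?_, fun k => ?_, 0, ?_, by simp⟩
  · simp only [if_neg k.succ_ne_zero]
    exact ⟨le_rfl, hn (by omega)⟩
  · rintro l ⟨x, -, hx⟩
    exact absurd rfl hx
  · simp [SeriesTendsto]

namespace IsBlockFMD

variable (h : IsBlockFMD E)
include h

theorem norm_cut_le_mul {g : StrongDual ℝ X} {p q : ℕ} (hp : ∀ x ∈ E p, g x = 0)
    (hq : ∀ x ∈ E q, g x = 0) : ‖h.cut g p q‖ ≤ 2.5 * ‖g‖ := by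
  refine (h.norm_cut_le hp hq).trans ?_
  gcongr
  exact norm_restr_le (norm_nonneg _) fun y _ => g.le_opNorm y

theorem norm_le_of_mem_skippedSeqBall (hn0 : n 0 = 0) {f : ℕ → StrongDual ℝ X}
    (hf : f ∈ skippedSeqBall E n) (k : ℕ) : ‖f k‖ ≤ 2.5 := by
  obtain ⟨j, g, -, hj, hg, -, rfl⟩ := h.exists_of_mem_skippedSeqBall hn0 hf
  exact (h.norm_cut_le_mul (hj k) (hj (k + 1))).trans (by linarith)

theorem bddAbove_pairing (hn0 : n 0 = 0) (z : PreZ E n) :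
    BddAbove (Set.range fun f : skippedSeqBall E n => |PreZ.pairing E n f z|) := by
  obtain ⟨C, hC⟩ := PreZ.exists_pairing_le z 2.5
  refine ⟨C, ?_⟩
  rintro _ ⟨f, rfl⟩
  exact hC f (h.norm_le_of_mem_skippedSeqBall hn0 f.2)

theorem norm_eq_iSup (hn0 : n 0 = 0) (z : PreZ E n) :
    ‖z‖ = ⨆ f : skippedSeqBall E n, |PreZ.pairing E n f z| :=
  Seminorm.iSup_apply (Seminorm.bddAbove_range_iff.2 fun z => h.bddAbove_pairing hn0 z)

theorem abs_pairing_le (hn0 : n 0 = 0) {f : ℕ → StrongDual ℝ X} (hf : f ∈ skippedSeqBall E n)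
    (z : PreZ E n) : |PreZ.pairing E n f z| ≤ ‖z‖ := by
  rw [h.norm_eq_iSup hn0]
  exact le_ciSup (h.bddAbove_pairing hn0 z) ⟨f, hf⟩

theorem norm_preZ_le (hn0 : n 0 = 0) (hn : Monotone n) {z : PreZ E n} {C : ℝ}
    (hC : ∀ f ∈ skippedSeqBall E n, |PreZ.pairing E n f z| ≤ C) : ‖z‖ ≤ C := by
  have : Nonempty (skippedSeqBall E n) := ⟨⟨0, zero_mem_skippedSeqBall hn⟩⟩
  rw [h.norm_eq_iSup hn0]
  exact ciSup_le fun f => hC f f.2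

theorem exists_lt_pairing (hn0 : n 0 = 0) (hn : Monotone n) (z : PreZ E n) {r : ℝ} (hr : r < ‖z‖) :
    ∃ f ∈ skippedSeqBall E n, r < PreZ.pairing E n f z := by
  by_contra! hcon
  refine absurd (h.norm_preZ_le hn0 hn (z := z) (C := r) fun f hf => ?_) (not_le.2 hr)
  refine abs_le'.2 ⟨hcon f hf, ?_⟩
  have h1 := hcon _ (neg_mem_skippedSeqBall hf)
  have h2 := PreZ.pairing_smul f (-1) z
  have h3 : (fun k => (-1 : ℝ) • f k) = fun k => -f k := by
    funext k
    ext x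
    simp
  rw [h3] at h2
  rwa [h2, neg_one_mul] at h1

theorem abs_pairing_le_mul (hn0 : n 0 = 0) {f : ℕ → StrongDual ℝ X} {j : ℕ → ℕ} (hj : IsSkip n j)
    (hf : ∀ k, dualSupp E (f k) ⊆ Set.Ioo (j k) (j (k + 1))) {g : StrongDual ℝ X}
    (hg : SeriesTendsto f g) {C : ℝ} (hC : 0 < C) (hgC : ‖g‖ ≤ C) (z : PreZ E n) :
    |PreZ.pairing E n f z| ≤ C * ‖z‖ := by
  have hmem : (fun k => C⁻¹ • f k) ∈ skippedSeqBall E n := by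
    refine ⟨j, hj.zero, hj.mem, fun k => ?_, C⁻¹ • g, ?_, ?_⟩
    · rintro l ⟨x, hx, hfx⟩
      refine hf k ⟨x, hx, fun h0 => hfx ?_⟩
      rw [smul_apply, h0, smul_zero]
    · refine (Tendsto.const_smul hg C⁻¹).congr fun N => ?_
      rw [Finset.smul_sum]
    · rw [norm_smul, norm_inv, Real.norm_of_nonneg hC.le, inv_mul_le_iff₀ hC, mul_one]
      exact hgC
  have := h.abs_pairing_le hn0 hmem z
  rwa [PreZ.pairing_smul, abs_mul, abs_inv, abs_of_pos hC, inv_mul_le_iff₀ hC] at this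

/-- The functional on finitely supported sequences that is defined by the pieces of `g` between
consecutive terms of `j`. -/
def cutPairing (n : ℕ → ℕ) (g : StrongDual ℝ X) (j : ℕ → ℕ) : PreZ E n →ₗ[ℝ] ℝ :=
  PreZ.pairing E n fun k => h.cut g (j k) (j (k + 1))

theorem abs_cutPairing_le (hn : StrictMono n) (hn0 : n 0 = 0) {j : ℕ → ℕ} (hj : IsSkip n j)
    {g : StrongDual ℝ X} (hg : ∀ k, ∀ x ∈ E (j k), g x = 0) {C : ℝ} (hC : 0 < C) (hgC : ‖g‖ ≤ C)
    (z : PreZ E n) : |h.cutPairing n g j z| ≤ C * ‖z‖ :=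
  h.abs_pairing_le_mul hn0 hj (fun _ => h.dualSupp_cut _ _ _)
    (h.seriesTendsto_cut (hj.monotone hn0) hj.zero (hj.le_apply hn0 hn) hg) hC hgC z

theorem cut_cut_zero {j : ℕ → ℕ} (hj : Monotone j) (g : StrongDual ℝ X) (N k : ℕ) :
    h.cut (h.cut g 0 (j N)) (j k) (j (k + 1)) =
      (if k < N then (1 : ℝ) else 0) • h.cut g (j k) (j (k + 1)) := by
  refine h.dual_ext fun l x hx => ?_
  by_cases hl : j k < l ∧ l < j (k + 1)
  · rw [h.cut_of_mem _ hl.1 hl.2 hx, smul_apply, h.cut_of_mem _ hl.1 hl.2 hx]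
    split_ifs with hk
    · rw [h.cut_of_mem _ (by omega) (hl.2.trans_le (hj hk)) hx, one_smul]
    · rw [h.cut_of_notMem _ (fun h0 => hk ?_) hx, zero_smul]
      by_contra hk
      have := hj (not_lt.1 hk)
      omega
  · rw [smul_apply, h.cut_of_notMem _ hl hx, h.cut_of_notMem _ hl hx, smul_zero]

theorem cut_zero_vanish {j : ℕ → ℕ} {g : StrongDual ℝ X} (hg : ∀ k, ∀ x ∈ E (j k), g x = 0)
    (N k : ℕ) : ∀ x ∈ E (j k), h.cut g 0 (j N) x = 0 := fun x hx => by
  by_cases hl : 0 < j k ∧ j k < j N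
  · rw [h.cut_of_mem _ hl.1 hl.2 hx, hg k x hx]
  · rw [h.cut_of_notMem _ hl hx]

/-- The truncation of finitely supported sequences. -/
abbrev _root_.FMD.PreZ.trunc (E : ℕ → Submodule ℝ X) (n : ℕ → ℕ) (N : ℕ) :
    PreZ E n →ₗ[ℝ] PreZ E n :=
  PreZ.mapCoord E n fun k => if k < N then 1 else 0

theorem cutPairing_trunc {j : ℕ → ℕ} (hj : Monotone j) (g : StrongDual ℝ X) (N : ℕ)
    (z : PreZ E n) :
    h.cutPairing n g j (PreZ.trunc E n N z) = h.cutPairing n (h.cut g 0 (j N)) j z := by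
  simp only [cutPairing, PreZ.pairing_mapCoord, h.cut_cut_zero hj]

theorem cutPairing_sub (g g' : StrongDual ℝ X) (j : ℕ → ℕ) (z : PreZ E n) :
    h.cutPairing n (g - g') j z = h.cutPairing n g j z - h.cutPairing n g' j z := by
  have : h.cutPairing n (g - g') j = h.cutPairing n g j - h.cutPairing n g' j :=
    PreZ.hom_ext fun k v => by
      simp only [cutPairing, LinearMap.sub_apply, PreZ.pairing_single, ← sub_apply]
      congr 1
      refine h.dual_ext fun l x hx => ?_
      by_cases hl : j k < l ∧ l < j (k + 1)
      · simp only [sub_apply, h.cut_of_mem _ hl.1 hl.2 hx]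
      · simp only [sub_apply, h.cut_of_notMem _ hl hx, sub_zero]
  rw [this]; rfl

/-- Truncating `z` amounts to cutting `g` at `j N`, where it vanishes, with the same `j`; this costs
the factor 2.5. -/
theorem norm_trunc_le (hn : StrictMono n) (hn0 : n 0 = 0) (N : ℕ) (z : PreZ E n) :
    ‖PreZ.trunc E n N z‖ ≤ 2.5 * ‖z‖ := by
  refine h.norm_preZ_le hn0 hn.monotone fun f hf => ?_
  obtain ⟨j, g, hj, hg, hg1, -, rfl⟩ := h.exists_of_mem_skippedSeqBall hn0 hf
  change |h.cutPairing n g j (PreZ.trunc E n N z)| ≤ _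
  rw [h.cutPairing_trunc (hj.monotone hn0)]
  refine h.abs_cutPairing_le hn hn0 hj (h.cut_zero_vanish hg N) (by norm_num) ?_ z
  exact (h.norm_cut_le_mul (h.vanish_zero g) (hg N)).trans (by linarith)

theorem exists_abs_cutPairing_tail_le (hn : StrictMono n) (hn0 : n 0 = 0) {j : ℕ → ℕ}
    (hj : IsSkip n j) {g : StrongDual ℝ X} (hg : ∀ k, ∀ x ∈ E (j k), g x = 0) {η : ℝ}
    (hη : 0 < η) : ∃ L, ∀ N, L ≤ N → ∀ z : PreZ E n,
      |h.cutPairing n g j (z - PreZ.trunc E n N z)| ≤ η * ‖z‖ := by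
  obtain ⟨L, hL⟩ := Metric.tendsto_atTop.1
    (h.tendsto_cut (hj.monotone hn0) (hj.le_apply hn0 hn) hg) η hη
  refine ⟨L, fun N hN z => ?_⟩
  rw [map_sub, h.cutPairing_trunc (hj.monotone hn0), ← h.cutPairing_sub]
  refine h.abs_cutPairing_le hn hn0 hj (fun k x hx => ?_) hη ?_ z
  · rw [sub_apply, hg k x hx, h.cut_zero_vanish hg N k x hx, sub_zero]
  · have := (hL N hN).le
    rwa [dist_comm, dist_eq_norm] at this

theorem finiteDimensional_ZBlock (n : ℕ → ℕ) (k : ℕ) : FiniteDimensional ℝ (ZBlock E n k) := by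
  have := h.isFMD.finiteDimensional
  have : FiniteDimensional ℝ (blockSum E (n k) (n (k + 2))) := by
    unfold blockSum
    rw [← Finset.sup_eq_iSup]
    infer_instance
  refine Submodule.finiteDimensional_of_le (S₂ := blockSum E (n k) (n (k + 2))) ?_
  exact iSup₂_le fun l hl => le_blockSum E ⟨hl.1.le, hl.2.le⟩

omit h in
theorem _root_.FMD.isCompact_setOf_isSkip (n : ℕ → ℕ) : IsCompact {j | IsSkip n j} := by
  have hJ : {j | IsSkip n j} =
      Set.univ.pi fun k => if k = 0 then {0} else Set.Icc (n k) (n (k + 1)) := by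
    ext j
    constructor
    · intro hj k _
      cases k with
      | zero => simpa using hj.zero
      | succ k => simpa using hj.mem k
    · intro hj
      refine ⟨by simpa using hj 0 trivial, fun k => ?_⟩
      simpa using hj (k + 1) trivial
  rw [hJ]
  refine isCompact_univ_pi fun k => ?_
  split_ifs
  · exact isCompact_singleton
  · exact (Set.finite_Icc _ _).isCompact

omit h in
/-- The pairs `(g, j)` where `‖g‖ ≤ R` and `g` vanishes on `E (j k)` for all `k`. -/
def _root_.FMD.skippedPairs (E : ℕ → Submodule ℝ X) (n : ℕ → ℕ) (R : ℝ) :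
    Set (WeakDual ℝ X × (ℕ → ℕ)) :=
  {κ | ‖WeakDual.toStrongDual κ.1‖ ≤ R ∧ IsSkip n κ.2 ∧ ∀ k, ∀ x ∈ E (κ.2 k), κ.1 x = 0}

omit h in
-- Banach-Alaoglu for `g` and a product of finite sets for `j`. Vanishing on `E (j k)` is a closed
-- condition because `j k` is locally constant. Keeping `j` beside `g` is what makes the pieces
-- depend continuously on the point.
theorem _root_.FMD.isCompact_skippedPairs (R : ℝ) : IsCompact (skippedPairs E n R) := by
  have hball := (WeakDual.isCompact_closedBall (𝕜 := ℝ) (E := X) 0 R).prod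
    (isCompact_setOf_isSkip n)
  have h1 : skippedPairs E n R =
      ((WeakDual.toStrongDual ⁻¹' Metric.closedBall (0 : StrongDual ℝ X) R) ×ˢ {j | IsSkip n j}) ∩
        ⋂ (k : ℕ) (l : ℕ) (x : E l), {κ : WeakDual ℝ X × (ℕ → ℕ) | κ.2 k = l → κ.1 x = 0} := by
    ext κ
    simp only [skippedPairs, Set.mem_ofPred_eq, Set.mem_inter_iff, Set.mem_prod, Set.mem_preimage,
      mem_closedBall_zero_iff, Set.mem_iInter, and_assoc]
    refine and_congr_right fun _ => and_congr_right fun _ => forall_congr' fun k => ?_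
    constructor
    · rintro H l x rfl
      exact H x x.2
    · intro H x hx
      exact H _ ⟨x, hx⟩ rfl
  rw [h1]
  refine hball.inter_right (isClosed_iInter fun k => isClosed_iInter fun l =>
    isClosed_iInter fun x => isClosed_imp ?_ ?_)
  · have hk : Continuous fun κ : WeakDual ℝ X × (ℕ → ℕ) => κ.2 k :=
      (continuous_apply k).comp continuous_snd
    exact (isOpen_discrete ({l} : Set ℕ)).preimage hk
  · exact isClosed_eq ((WeakDual.eval_continuous _).comp continuous_fst) continuous_const

theorem continuous_cutPairing (n : ℕ → ℕ) (R : ℝ) (z : PreZ E n) :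
    Continuous fun κ : skippedPairs E n R =>
      h.cutPairing n (WeakDual.toStrongDual κ.1.1) κ.1.2 z := by
  let Q : Submodule ℝ (PreZ E n) :=
    { carrier := {z | Continuous fun κ : skippedPairs E n R =>
        h.cutPairing n (WeakDual.toStrongDual κ.1.1) κ.1.2 z}
      zero_mem' := by simpa using continuous_const
      add_mem' := by
        intro z w hz hw
        refine (Continuous.add hz hw).congr fun κ => ?_
        exact (map_add _ _ _).symm
      smul_mem' := by
        intro a z hz
        refine (Continuous.mul (continuous_const (y := a)) hz).congr fun κ => ?_
        exact (map_smul _ a z).symm }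
  have : Q = ⊤ := by
    refine PreZ.submodule_eq_top fun k l hl x => ?_
    have h1 : Continuous fun κ : skippedPairs E n R => (κ.1.2 k, κ.1.2 (k + 1)) :=
      ((continuous_apply k).comp (continuous_snd.comp continuous_subtype_val)).prodMk
        ((continuous_apply (k + 1)).comp (continuous_snd.comp continuous_subtype_val))
    have h2 : Continuous fun κ : skippedPairs E n R => κ.1.1 x :=
      (WeakDual.eval_continuous _).comp (continuous_fst.comp continuous_subtype_val)
    have h3 : Continuous fun p : ℕ × ℕ => if p.1 < l ∧ l < p.2 then (1 : ℝ) else 0 :=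
      continuous_of_discreteTopology
    have hc := (h3.comp h1).mul h2
    refine hc.congr fun κ => ?_
    simp only [cutPairing, PreZ.pairing_single]
    simp only [Pi.mul_apply, Function.comp_apply]
    split_ifs with hκ
    · rw [h.cut_of_mem _ hκ.1 hκ.2 x.2, one_mul]
      rfl
    · rw [h.cut_of_notMem _ hκ x.2, zero_mul]
  have hz : z ∈ Q := by
    rw [this]
    trivial
  exact hz

theorem isFDD_isShrinking_ZDecomp (hn : StrictMono n) (hn0 : n 0 = 0) :
    IsFDD (ZDecomp E n) ∧ IsShrinking (ZDecomp E n) := by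
  have := fun k => h.finiteDimensional_ZBlock n k
  have : CompactSpace (skippedPairs E n 1) := isCompact_iff_compactSpace.1 (isCompact_skippedPairs 1)
  have hmem : ∀ f ∈ skippedSeqBall E n, ∃ κ : skippedPairs E n 1, ∀ z : PreZ E n,
      PreZ.pairing E n f z = h.cutPairing n (WeakDual.toStrongDual κ.1.1) κ.1.2 z := by
    intro f hf
    obtain ⟨j, g, hj, hg, hg1, -, rfl⟩ := h.exists_of_mem_skippedSeqBall hn0 hf
    exact ⟨⟨(StrongDual.toWeakDual g, j), by simpa using hg1, hj, hg⟩, fun z => rfl⟩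
  have : Nonempty (skippedPairs E n 1) :=
    ⟨(hmem 0 (zero_mem_skippedSeqBall hn.monotone)).choose⟩
  refine isFDD_isShrinking_of_compact
    (fun κ : skippedPairs E n 1 => h.cutPairing n (WeakDual.toStrongDual κ.1.1) κ.1.2)
    (h.continuous_cutPairing n 1) (fun κ z => ?_) (fun z r hr => ?_) (PreZ.single E n)
    PreZ.iSup_range_single (PreZ.trunc E n) (fun N k hk v => ?_) (fun N k hk v => ?_)
    (C := 2.5) (by norm_num) (h.norm_trunc_le hn hn0) fun κ η hη => ?_
  · have := h.abs_cutPairing_le hn hn0 κ.2.2.1 κ.2.2.2 one_pos κ.2.1 z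
    rwa [one_mul] at this
  · obtain ⟨f, hf, hr⟩ := h.exists_lt_pairing hn0 hn.monotone z hr
    obtain ⟨κ, hκ⟩ := hmem f hf
    exact ⟨κ, hκ z ▸ hr⟩
  · rw [PreZ.mapCoord_single, if_pos hk, one_smul]
  · rw [PreZ.mapCoord_single, if_neg (not_lt.2 hk), zero_smul]
  · exact h.exists_abs_cutPairing_tail_le hn hn0 κ.2.2.1 κ.2.2.2 hη

end IsBlockFMD

/-- The finite inequality, with the first M terms replaced by zero, controls the signed Cauchy
differences by the unsigned ones. -/
theorem SkippedUnconditional.exists_seriesTendsto {C : ℝ} (hC : SkippedUnconditional E C)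
    {j : ℕ → ℕ} (hj : Monotone j) (hj' : ∀ k, k ≤ j k) {f : ℕ → StrongDual ℝ X}
    (hf : ∀ k, dualSupp E (f k) ⊆ Set.Ioo (j k) (j (k + 1))) {g : StrongDual ℝ X}
    (hg : SeriesTendsto f g) {σ : ℕ → ℝ} (hσ : ∀ k, σ k = 1 ∨ σ k = -1) :
    ∃ g', SeriesTendsto (fun k => σ k • f k) g' ∧ ‖g'‖ ≤ C * ‖g‖ := by
  have hb : ∀ M N, M ≤ N → ‖∑ k ∈ Finset.Ico M N, σ k • f k‖ ≤ C * ‖∑ k ∈ Finset.Ico M N, f k‖ := by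
    intro M N hMN
    have h1 := hC j (fun k => if M ≤ k then f k else 0) hj hj' (fun k => by
      split_ifs
      · exact hf k
      · rintro l ⟨x, -, hx⟩
        exact absurd rfl hx) N σ hσ
    have h2 : ∀ u : ℕ → StrongDual ℝ X,
        ∑ k ∈ Finset.Ico M N, u k = ∑ k ∈ Finset.range N, if M ≤ k then u k else 0 := fun u => by
      rw [← Finset.sum_filter]
      congr 1
      ext k
      simp [and_comm]
    rw [h2, h2]
    simpa only [smul_ite, smul_zero] using h1
  have hcau : CauchySeq fun N => ∑ k ∈ Finset.range N, σ k • f k := by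
    have h0 := Tendsto.cauchySeq hg
    rw [Metric.cauchySeq_iff'] at h0 ⊢
    intro η hη
    obtain ⟨M, hM⟩ := h0 (η / (|C| + 1)) (by positivity)
    refine ⟨M, fun N hN => ?_⟩
    have h1 := hM N hN
    rw [dist_eq_norm, ← Finset.sum_Ico_eq_sub _ hN] at h1 ⊢
    refine (hb M N hN).trans_lt ?_
    calc C * ‖∑ k ∈ Finset.Ico M N, f k‖ ≤ (|C| + 1) * ‖∑ k ∈ Finset.Ico M N, f k‖ := by
          gcongr
          linarith [le_abs_self C]
      _ < (|C| + 1) * (η / (|C| + 1)) := by gcongr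
      _ = η := by field_simp
  obtain ⟨g', hg'⟩ := cauchySeq_tendsto_of_complete hcau
  refine ⟨g', hg', le_of_tendsto_of_tendsto hg'.norm (hg.norm.const_mul C)
    (Eventually.of_forall fun N => ?_)⟩
  simpa using hb 0 N N.zero_le

theorem IsBlockFMD.isUnconditional_ZDecomp (h : IsBlockFMD E) (hn : StrictMono n) (hn0 : n 0 = 0)
    {C : ℝ} (hC : SkippedUnconditional E C) : IsUnconditional (ZDecomp E n) := by
  refine isUnconditional_completion (PreZ.single E n) (C := |C| + 1) (by positivity)
    (PreZ.mapCoord E n) PreZ.mapCoord_single fun σ hσ z => ?_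
  refine h.norm_preZ_le hn0 hn.monotone fun f hf => ?_
  obtain ⟨j, hj0, hj, hs, g, hg, hg1⟩ := hf
  have hj : IsSkip n j := ⟨hj0, hj⟩
  obtain ⟨g', hg', hgC⟩ := hC.exists_seriesTendsto (hj.monotone hn0) (hj.le_apply hn0 hn) hs hg hσ
  rw [PreZ.pairing_mapCoord]
  refine h.abs_pairing_le_mul hn0 hj (fun k => ?_) hg' (by positivity) ?_ z
  · rintro l ⟨x, hx, hfx⟩
    refine hs k ⟨x, hx, fun h0 => hfx ?_⟩
    rw [smul_apply, h0, smul_zero]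
  · refine hgC.trans ?_
    have := norm_nonneg g
    have := le_abs_self C
    have := abs_nonneg C
    nlinarith

end ZSpace

/-! ### The embedding of X into Z. -/

section Embedding

variable {X : Type*} [NormedAddCommGroup X] [NormedSpace ℝ X] {E : ℕ → Submodule ℝ X} {n : ℕ → ℕ}

/-- The map `diag` as a linear map. -/
def diagHom (E : ℕ → Submodule ℝ X) (n : ℕ → ℕ) (l : ℕ) : E l →ₗ[ℝ] PreZ E n :=
  ∑ k ∈ Finset.range l, if hl : n k < l ∧ l < n (k + 2) then
    PreZ.single E n k ∘ₗ Submodule.inclusion fun x hx => mem_ZBlock hl ⟨x, hx⟩ else 0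

theorem diagHom_apply (l : ℕ) (x : E l) : diagHom E n l x = diag E n l x := by
  unfold diagHom diag
  rw [LinearMap.sum_apply]
  refine Finset.sum_congr rfl fun k _ => ?_
  split_ifs <;> rfl

/-- The summation map on finitely supported sequences. -/
def sumHom (E : ℕ → Submodule ℝ X) : (Π₀ l, E l) →ₗ[ℝ] X :=
  DFinsupp.lsum ℕ fun l => (E l).subtype

theorem sumHom_single (l : ℕ) (x : E l) : sumHom E (DFinsupp.single l x) = x :=
  DFinsupp.lsum_single _ _ _ _

theorem IsBlockFMD.denseRange_sumHom (h : IsBlockFMD E) : DenseRange (sumHom E) := by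
  have h1 : Dense ((⨆ k, E k : Submodule ℝ X) : Set X) :=
    Submodule.dense_iff_topologicalClosure_eq_top.2 h.isFMD.fundamental
  rw [Submodule.iSup_eq_range_dfinsupp_lsum] at h1
  exact h1

/-- The diagonal map on finitely supported sequences. -/
def diagSumHom (E : ℕ → Submodule ℝ X) (n : ℕ → ℕ) : (Π₀ l, E l) →ₗ[ℝ] PreZ E n :=
  DFinsupp.lsum ℕ fun l => diagHom E n l

theorem diagSumHom_single (l : ℕ) (x : E l) :
    diagSumHom E n (DFinsupp.single l x) = diag E n l x :=
  (DFinsupp.lsum_single _ _ _ _).trans (diagHom_apply l x)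

theorem exists_isSkip_of_forall {g : StrongDual ℝ X}
    (hg : ∀ k, ∃ l ∈ Set.Icc (n (k + 1)) (n (k + 2)), ∀ x ∈ E l, g x = 0) (hE : E 0 = ⊥) :
    ∃ j, IsSkip n j ∧ ∀ k, ∀ x ∈ E (j k), g x = 0 := by
  choose j hj hgj using hg
  refine ⟨fun k => k.casesOn 0 j, ⟨rfl, hj⟩, fun k => ?_⟩
  cases k with
  | zero =>
    intro x hx
    have hx' : x ∈ E 0 := hx
    rw [hE, Submodule.mem_bot] at hx'
    rw [hx', map_zero]
  | succ k => exact hgj k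

namespace IsBlockFMD

variable (h : IsBlockFMD E)
include h

/-- The pieces of `g` telescope. A piece that meets `l` has its coordinate present in the diagonal
vector, and if `l` is itself some `j k`, both sides vanish. -/
theorem cutPairing_diag (hn : StrictMono n) (hn0 : n 0 = 0) {j : ℕ → ℕ} (hj : IsSkip n j)
    {g : StrongDual ℝ X} (hg : ∀ k, ∀ x ∈ E (j k), g x = 0) (l : ℕ) (x : E l) :
    h.cutPairing n g j (diag E n l x) = g x := by
  have h1 : h.cutPairing n g j (diag E n l x) =
      ∑ k ∈ Finset.range l, h.cut g (j k) (j (k + 1)) x := by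
    unfold diag
    rw [map_sum]
    refine Finset.sum_congr rfl fun k _ => ?_
    split_ifs with hl
    · exact PreZ.pairing_single _ _ _
    · rw [map_zero, h.cut_of_notMem g (fun hl' => hl ?_) x.2]
      exact ⟨(hj.bounds hn0 k).1.trans_lt hl'.1, hl'.2.trans_le (hj.bounds hn0 (k + 1)).2⟩
  rw [h1, ← sum_apply, Finset.range_eq_Ico, h.sum_cut (hj.monotone hn0) hg l.zero_le, hj.zero]
  by_cases hl : 0 < l ∧ l < j l
  · exact h.cut_of_mem g hl.1 hl.2 x.2
  · rw [h.cut_of_notMem g hl x.2]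
    rcases Nat.eq_zero_or_pos l with rfl | hpos
    · exact (h.vanish_zero g x x.2).symm
    · have hl' : j l = l := by
        have := hj.le_apply hn0 hn l
        omega
      exact (hg l x (hl'.symm ▸ x.2)).symm

theorem cutPairing_diagSumHom (hn : StrictMono n) (hn0 : n 0 = 0) {j : ℕ → ℕ} (hj : IsSkip n j)
    {g : StrongDual ℝ X} (hg : ∀ k, ∀ x ∈ E (j k), g x = 0) (u : Π₀ l, E l) :
    h.cutPairing n g j (diagSumHom E n u) = g (sumHom E u) := by
  have : h.cutPairing n g j ∘ₗ diagSumHom E n = g.toLinearMap ∘ₗ sumHom E := by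
    refine DFinsupp.lhom_ext' fun l => LinearMap.ext fun x => ?_
    simp only [LinearMap.comp_apply, DFinsupp.lsingle_apply, diagSumHom_single,
      h.cutPairing_diag hn hn0 hj hg]
    exact congrArg g (sumHom_single l x).symm
  exact LinearMap.congr_fun this u

theorem le_norm_diagSumHom (hn : StrictMono n) (hn0 : n 0 = 0) {g : StrongDual ℝ X}
    (hg : g ∈ skippedBall E n) (u : Π₀ l, E l) : |g (sumHom E u)| ≤ ‖diagSumHom E n u‖ := by
  obtain ⟨j, hj, hgj⟩ := exists_isSkip_of_forall hg.2 h.zero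
  rw [← h.cutPairing_diagSumHom hn hn0 hj hgj]
  have := h.abs_cutPairing_le hn hn0 hj hgj one_pos hg.1 (diagSumHom E n u)
  rwa [one_mul] at this

theorem norm_diagSumHom_le (hn : StrictMono n) (hn0 : n 0 = 0) {u : Π₀ l, E l} {c : ℝ}
    (hc : ∀ g ∈ skippedBall E n, |g (sumHom E u)| ≤ c) : ‖diagSumHom E n u‖ ≤ c := by
  refine h.norm_preZ_le hn0 hn.monotone fun f hf => ?_
  obtain ⟨j, g, hj, hgj, hg1, -, rfl⟩ := h.exists_of_mem_skippedSeqBall hn0 hf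
  change |h.cutPairing n g j _| ≤ c
  rw [h.cutPairing_diagSumHom hn hn0 hj hgj]
  exact hc g ⟨hg1, fun k => ⟨j (k + 1), hj.mem k, hgj (k + 1)⟩⟩

theorem exists_embedding {ε : ℕ → ℝ} (hε0 : ∀ k, 0 < ε k) (hεs : Summable ε)
    (hεt : ∑' k, ε k < 1 / 50) (hn : Admissible E ε n) :
    ∃ J : X →L[ℝ] ZSpace E n,
      (∀ (l : ℕ) (x : E l), J x = (diag E n l x : ZSpace E n)) ∧
      (∀ x, IsLUB {r : ℝ | ∃ f ∈ skippedBall E n, r = |f x|} ‖J x‖) ∧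
      ∃ c : ℝ, 0 < c ∧ ∀ x, c * ‖x‖ ≤ ‖J x‖ := by
  have hm := hn.strictMono
  have hn0 := hn.zero
  let L : (Π₀ l, E l) →ₗ[ℝ] ZSpace E n :=
    (UniformSpace.Completion.toComplₗᵢ (𝕜 := ℝ) (E := PreZ E n)).toLinearMap ∘ₗ diagSumHom E n
  have hL : ∀ u, ‖L u‖ = ‖diagSumHom E n u‖ := fun u => UniformSpace.Completion.norm_coe _
  have hb : ∀ u, ‖L u‖ ≤ 1 * ‖sumHom E u‖ := fun u => by
    rw [hL, one_mul]
    refine h.norm_diagSumHom_le hm hn0 fun g hg => ?_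
    simpa using g.le_of_opNorm_le hg.1 (sumHom E u)
  let J : X →L[ℝ] ZSpace E n := L.extendOfNorm (sumHom E)
  have hJ : ∀ u, J (sumHom E u) = L u := fun u =>
    LinearMap.extendOfNorm_eq h.denseRange_sumHom ⟨1, hb⟩ u
  have hJ1 : ∀ x, ‖J x‖ ≤ ‖x‖ := fun x => by
    simpa using LinearMap.norm_extendOfNorm_apply_le h.denseRange_sumHom 1 hb x
  have hub : ∀ x, ∀ g ∈ skippedBall E n, |g x| ≤ ‖J x‖ := fun x g hg => by
    refine h.denseRange_sumHom.induction_on x (isClosed_le (by fun_prop) (by fun_prop)) fun u => ?_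
    rw [hJ, hL]
    exact h.le_norm_diagSumHom hm hn0 hg u
  -- A norming functional moves by 1/20, so 19/20 of ‖x‖ survives; scaling it back into the unit
  -- ball costs the factor 20/21.
  refine ⟨J, fun l x => ?_, fun x => ⟨?_, fun b hbx => ?_⟩, 19 / 21, by norm_num, fun x => ?_⟩
  · rw [← sumHom_single l x, hJ]
    exact congrArg (fun z : PreZ E n => (z : ZSpace E n)) (diagSumHom_single l x)
  · rintro _ ⟨g, hg, rfl⟩
    exact hub x g hg
  · refine le_of_forall_pos_le_add fun δ hδ => ?_
    obtain ⟨u, hu⟩ := h.denseRange_sumHom.exists_dist_lt x (half_pos hδ)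
    rw [dist_eq_norm] at hu
    have h1 : ‖J (sumHom E u)‖ ≤ b + δ / 2 := by
      rw [hJ, hL]
      refine h.norm_diagSumHom_le hm hn0 fun g hg => ?_
      have h2 : |g x| ≤ b := hbx ⟨g, hg, rfl⟩
      have h3 : |g (x - sumHom E u)| ≤ ‖x - sumHom E u‖ := by
        simpa using g.le_of_opNorm_le hg.1 (x - sumHom E u)
      have h4 : g (sumHom E u) = g x - g (x - sumHom E u) := by
        rw [map_sub, sub_sub_cancel]
      rw [h4]
      refine (abs_sub _ _).trans ?_
      linarith
    have h2 : J x = J (sumHom E u) + J (x - sumHom E u) := by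
      rw [← map_add, add_sub_cancel]
    rw [h2]
    refine (norm_add_le _ _).trans ?_
    have := hJ1 (x - sumHom E u)
    linarith
  · obtain ⟨f, hf1, hfx⟩ := exists_dual_vector'' ℝ x
    obtain ⟨g, hfg, hg⟩ := h.exists_skipped_near hε0 hεs hεt hn f hf1
    have hg1 : ‖g‖ ≤ 21 / 20 := by
      have h1 : g = f - (f - g) := (sub_sub_cancel _ _).symm
      rw [h1]
      refine (norm_sub_le _ _).trans ?_
      linarith
    have h1 : ((20 / 21 : ℝ) • g) ∈ skippedBall E n := by
      refine ⟨?_, fun k => ?_⟩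
      · rw [norm_smul, Real.norm_eq_abs, abs_of_pos (by norm_num)]
        linarith
      · obtain ⟨l, hl, hgl⟩ := hg k
        exact ⟨l, hl, fun y hy => by rw [smul_apply, hgl y hy, smul_zero]⟩
    have h2 := hub x _ h1
    rw [smul_apply, smul_eq_mul, abs_mul, abs_of_pos (by norm_num)] at h2
    have h3 : |(f - g) x| ≤ 1 / 20 * ‖x‖ := (f - g).le_of_opNorm_le hfg x
    have h4 : g x = ‖x‖ - (f - g) x := by
      rw [sub_apply, hfx]
      simp
    have h5 : 19 / 20 * ‖x‖ ≤ |g x| := by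
      refine le_trans ?_ (le_abs_self _)
      rw [h4]
      have := le_abs_self ((f - g) x)
      linarith
    linarith

end IsBlockFMD

end Embedding

/-! ### Sequence spaces normed by sign invariant compact sets. -/

section SeqSpan

/-- The finitely supported sequences, with the seminorm `z ↦ sup |∑ c a * z a|`, `c ∈ K`. -/
def SeqSpan (_K : Set (ℕ → ℝ)) : Type := ℕ →₀ ℝ

variable {K : Set (ℕ → ℝ)}

instance (K : Set (ℕ → ℝ)) : AddCommGroup (SeqSpan K) := inferInstanceAs (AddCommGroup (ℕ →₀ ℝ))

instance (K : Set (ℕ → ℝ)) : Module ℝ (SeqSpan K) := inferInstanceAs (Module ℝ (ℕ →₀ ℝ))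

namespace SeqSpan

/-- The multiples of the `a`-th unit vector. -/
def single (K : Set (ℕ → ℝ)) (a : ℕ) : ℝ →ₗ[ℝ] SeqSpan K := Finsupp.lsingle a

/-- The `a`-th coordinate. -/
def apply (K : Set (ℕ → ℝ)) (a : ℕ) : SeqSpan K →ₗ[ℝ] ℝ := Finsupp.lapply a

/-- The functional `z ↦ ∑ c a * z a`. -/
def pairing (K : Set (ℕ → ℝ)) (c : ℕ → ℝ) : SeqSpan K →ₗ[ℝ] ℝ := Finsupp.linearCombination ℝ c

/-- The diagonal operator with the multipliers `τ`. -/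
def mul (K : Set (ℕ → ℝ)) (τ : ℕ → ℝ) : SeqSpan K →ₗ[ℝ] SeqSpan K :=
  Finsupp.linearCombination ℝ fun a => single K a (τ a)

theorem hom_ext {M : Type*} [AddCommGroup M] [Module ℝ M] {f g : SeqSpan K →ₗ[ℝ] M}
    (h : ∀ a, f (single K a 1) = g (single K a 1)) : f = g :=
  Finsupp.lhom_ext' fun a => LinearMap.ext_ring (h a)

theorem iSup_range_single : ⨆ a, LinearMap.range (single K a) = ⊤ :=
  Finsupp.iSup_lsingle_range

theorem pairing_single (c : ℕ → ℝ) (a : ℕ) (r : ℝ) : pairing K c (single K a r) = r * c a :=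
  Finsupp.linearCombination_single ℝ r a

theorem apply_single (a b : ℕ) (r : ℝ) : apply K a (single K b r) = if b = a then r else 0 :=
  Finsupp.single_apply

theorem mul_single (τ : ℕ → ℝ) (a : ℕ) (r : ℝ) : mul K τ (single K a r) = τ a • single K a r := by
  refine (Finsupp.linearCombination_single ℝ r a).trans ?_
  rw [← map_smul, ← map_smul, smul_eq_mul, smul_eq_mul, mul_comm]

theorem pairing_mul (c τ : ℕ → ℝ) (z : SeqSpan K) :
    pairing K c (mul K τ z) = pairing K (τ * c) z := by
  have : pairing K c ∘ₗ mul K τ = pairing K (τ * c) := hom_ext fun a => by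
    rw [LinearMap.comp_apply, mul_single, map_smul, pairing_single, pairing_single, Pi.mul_apply,
      smul_eq_mul]
    ring
  exact LinearMap.congr_fun this z

theorem pairing_smul (r : ℝ) (c : ℕ → ℝ) (z : SeqSpan K) :
    pairing K (r • c) z = r * pairing K c z := by
  have : pairing K (r • c) = r • pairing K c := hom_ext fun a => by
    rw [LinearMap.smul_apply, pairing_single, pairing_single, Pi.smul_apply, smul_eq_mul,
      smul_eq_mul]
    ring
  rw [this]; rfl

theorem continuous_pairing (z : SeqSpan K) : Continuous fun c => pairing K c z := by
  have : (fun c => pairing K c z) = fun c => Finsupp.sum (z : ℕ →₀ ℝ) fun a r => r * c a := by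
    funext c
    exact Finsupp.linearCombination_apply ℝ _
  rw [this]
  unfold Finsupp.sum
  fun_prop

theorem apply_eq_pairing (a : ℕ) (z : SeqSpan K) : apply K a z = pairing K (Pi.single a 1) z := by
  have : apply K a = pairing K (Pi.single a 1) := hom_ext fun b => by
    rw [apply_single, pairing_single, Pi.single_apply, one_mul]
  rw [this]

end SeqSpan

/-- The seminorm `z ↦ sup |∑ c a * z a|`, `c ∈ K`. -/
def SeqSpan.seminorm (K : Set (ℕ → ℝ)) : Seminorm ℝ (SeqSpan K) :=
  ⨆ c : K, (normSeminorm ℝ ℝ).comp (SeqSpan.pairing K c)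

instance (K : Set (ℕ → ℝ)) : SeminormedAddCommGroup (SeqSpan K) :=
  (SeqSpan.seminorm K).toAddGroupSeminorm.toSeminormedAddCommGroup

instance (K : Set (ℕ → ℝ)) : NormedSpace ℝ (SeqSpan K) where
  norm_smul_le a z := (map_smul_eq_mul (SeqSpan.seminorm K) a z).le

/-- Compact sets of sequences that are invariant under changes of signs and contain the unit
vectors, and whose members have small tails. -/
structure IsSignCompact (K : Set (ℕ → ℝ)) : Prop where
  isCompact : IsCompact K
  sign_mul : ∀ c ∈ K, ∀ σ : ℕ → ℝ, (∀ a, σ a = 1 ∨ σ a = -1) → σ * c ∈ K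
  single_mem : ∀ a, Pi.single a 1 ∈ K
  tail : ∀ c ∈ K, ∀ η : ℝ, 0 < η → ∃ A : Finset ℕ, ∃ c' ∈ K, ∀ a ∉ A, c a = η * c' a

namespace IsSignCompact

open SeqSpan

variable (h : IsSignCompact K)
include h

theorem bddAbove_pairing (z : SeqSpan K) : BddAbove (Set.range fun c : K => |pairing K c z|) := by
  have := (h.isCompact.image (continuous_pairing z).abs).bddAbove
  rwa [Set.image_eq_range] at this

theorem norm_eq_iSup (z : SeqSpan K) : ‖z‖ = ⨆ c : K, |pairing K c z| :=
  Seminorm.iSup_apply (Seminorm.bddAbove_range_iff.2 h.bddAbove_pairing)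

theorem abs_pairing_le {c : ℕ → ℝ} (hc : c ∈ K) (z : SeqSpan K) : |pairing K c z| ≤ ‖z‖ := by
  rw [h.norm_eq_iSup]
  exact le_ciSup (h.bddAbove_pairing z) ⟨c, hc⟩

theorem norm_le {z : SeqSpan K} {C : ℝ} (hC : ∀ c ∈ K, |pairing K c z| ≤ C) : ‖z‖ ≤ C := by
  have : Nonempty K := ⟨⟨_, h.single_mem 0⟩⟩
  rw [h.norm_eq_iSup]
  exact ciSup_le fun c => hC c c.2

theorem exists_lt_pairing (z : SeqSpan K) {r : ℝ} (hr : r < ‖z‖) : ∃ c ∈ K, r < pairing K c z := by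
  by_contra! hcon
  refine absurd (h.norm_le (z := z) (C := r) fun c hc => ?_) (not_le.2 hr)
  refine abs_le'.2 ⟨hcon c hc, ?_⟩
  have h1 := hcon _ (h.sign_mul c hc (fun _ => -1) fun _ => Or.inr rfl)
  have h2 : (fun _ => -1 : ℕ → ℝ) * c = (-1 : ℝ) • c := by
    funext a
    simp
  rwa [h2, pairing_smul, neg_one_mul] at h1

theorem norm_sign_mul_le {σ : ℕ → ℝ} (hσ : ∀ a, σ a = 1 ∨ σ a = -1) (z : SeqSpan K) :
    ‖mul K σ z‖ ≤ ‖z‖ :=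
  h.norm_le fun c hc => by
    rw [pairing_mul]
    exact h.abs_pairing_le (h.sign_mul c hc σ hσ) z

theorem norm_indicator_mul_le {τ : ℕ → ℝ} (hτ : ∀ a, τ a = 1 ∨ τ a = 0) (z : SeqSpan K) :
    ‖mul K τ z‖ ≤ ‖z‖ := by
  -- A coordinate projection is the average of the identity and a sign change.
  have h1 : mul K τ = (1 / 2 : ℝ) • (LinearMap.id + mul K fun a => 2 * τ a - 1) :=
    hom_ext fun a => by
      simp only [LinearMap.smul_apply, LinearMap.add_apply, LinearMap.id_apply, mul_single]
      rw [smul_add, smul_smul, ← add_smul]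
      congr 1
      ring
  have h2 : ‖mul K (fun a => 2 * τ a - 1) z‖ ≤ ‖z‖ := h.norm_sign_mul_le (fun a => by
    rcases hτ a with ha | ha <;> rw [ha] <;> norm_num) z
  rw [h1, LinearMap.smul_apply, norm_smul, Real.norm_of_nonneg (by norm_num)]
  have h3 := norm_add_le z (mul K (fun a => 2 * τ a - 1) z)
  change 1 / 2 * ‖z + _‖ ≤ ‖z‖
  linarith

/-- The compactness criterion with `K` itself as norming set: beyond a finite set, `c` is η times a
member of `K`, hence small on tails. -/
theorem isShrinking : IsShrinking fun a => complRange (single K a) := by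
  have : CompactSpace K := isCompact_iff_compactSpace.1 h.isCompact
  have : Nonempty K := ⟨⟨_, h.single_mem 0⟩⟩
  refine (isFDD_isShrinking_of_compact (fun c : K => pairing K c)
    (fun z => (continuous_pairing z).comp continuous_subtype_val)
    (fun c z => h.abs_pairing_le c.2 z) (fun z r hr => ?_) (single K) iSup_range_single
    (fun N => mul K fun a => if a < N then 1 else 0) (fun N k hk v => ?_) (fun N k hk v => ?_)
    (C := 1) zero_le_one (fun N z => ?_) fun c η hη => ?_).2
  · obtain ⟨c, hc, hr⟩ := h.exists_lt_pairing z hr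
    exact ⟨⟨c, hc⟩, hr⟩
  · rw [mul_single, if_pos hk, one_smul]
  · rw [mul_single, if_neg (not_lt.2 hk), zero_smul]
  · rw [one_mul]
    refine h.norm_indicator_mul_le (fun a => ?_) z
    split_ifs <;> simp
  · obtain ⟨A, c', hc', hA⟩ := h.tail c c.2 η hη
    refine ⟨A.sup id + 1, fun N hN z => ?_⟩
    have h1 : z - mul K (fun a => if a < N then 1 else 0) z =
        mul K (fun a => if a < N then 0 else 1) z := by
      rw [sub_eq_iff_eq_add, ← LinearMap.add_apply]
      have : LinearMap.id = mul K (fun a => if a < N then 0 else 1) +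
          mul K (fun a => if a < N then 1 else 0) := hom_ext fun a => by
        simp only [LinearMap.add_apply, LinearMap.id_apply, mul_single]
        split_ifs <;> simp
      rw [← this]
      rfl
    have h2 : (fun a => if a < N then (0 : ℝ) else 1) * (c : ℕ → ℝ) =
        η • ((fun a => if a < N then (0 : ℝ) else 1) * c') := by
      funext a
      simp only [Pi.mul_apply, Pi.smul_apply, smul_eq_mul]
      split_ifs with ha
      · simp
      · rw [hA a fun haA => ha ?_]
        · ring
        · have := Finset.le_sup (f := id) haA
          simp only [id] at this
          omega
    rw [h1, pairing_mul, h2, pairing_smul, ← pairing_mul, abs_mul, abs_of_pos hη]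
    refine mul_le_mul_of_nonneg_left ((h.abs_pairing_le hc' _).trans ?_) hη.le
    refine h.norm_indicator_mul_le (fun a => ?_) z
    split_ifs <;> simp

/-- The completion has an unconditional basis with a fundamental sequence of coefficient
functionals. -/
theorem exists_basis : ∃ b : UnconditionalSchauderBasis ℕ ℝ (UniformSpace.Completion (SeqSpan K)),
    (Submodule.span ℝ (Set.range b.coord)).topologicalClosure = ⊤ := by
  let e : SeqSpan K →ₗ[ℝ] UniformSpace.Completion (SeqSpan K) :=
    (UniformSpace.Completion.toComplₗᵢ (𝕜 := ℝ) (E := SeqSpan K)).toLinearMap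
  have he : ∀ z, ‖e z‖ = ‖z‖ := fun z => UniformSpace.Completion.norm_coe z
  have hd : DenseRange e := UniformSpace.Completion.denseRange_coe
  have hb : ∀ a z, ‖apply K a z‖ ≤ 1 * ‖e z‖ := fun a z => by
    rw [one_mul, he, apply_eq_pairing]
    exact h.abs_pairing_le (h.single_mem a) z
  let coord : ℕ → StrongDual ℝ (UniformSpace.Completion (SeqSpan K)) := fun a =>
    (apply K a).extendOfNorm e
  have hcoord : ∀ a z, coord a (e z) = apply K a z := fun a z =>
    LinearMap.extendOfNorm_eq hd ⟨1, hb a⟩ z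
  let basis : ℕ → UniformSpace.Completion (SeqSpan K) := fun a => e (single K a 1)
  have hortho : ∀ a b, coord a (basis b) = if b = a then 1 else 0 := fun a b => by
    rw [hcoord, apply_single]
  have hsum : ∀ (A : Finset ℕ) z, ∑ a ∈ A, coord a (e z) • basis a =
      e (mul K (fun a => if a ∈ A then 1 else 0) z) := by
    intro A z
    have : ∑ a ∈ A, (LinearMap.toSpanSingleton ℝ _ (single K a 1)) ∘ₗ apply K a =
        mul K (fun a => if a ∈ A then 1 else 0) := hom_ext fun b => by
      simp only [LinearMap.sum_apply, LinearMap.comp_apply, apply_single, mul_single,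
        LinearMap.toSpanSingleton_apply, ite_smul, one_smul, zero_smul]
      rw [Finset.sum_ite_eq]
    rw [← this, LinearMap.sum_apply, map_sum]
    refine Finset.sum_congr rfl fun a _ => ?_
    rw [LinearMap.comp_apply, LinearMap.toSpanSingleton_apply, map_smul, hcoord]
  have hbound : ∀ (A : Finset ℕ) w, ‖∑ a ∈ A, coord a w • basis a‖ ≤ ‖w‖ := fun A w => by
    refine hd.induction_on w (isClosed_le (by fun_prop) (by fun_prop)) fun z => ?_
    rw [hsum, he, he]
    refine h.norm_indicator_mul_le (fun a => ?_) z
    split_ifs <;> simp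
  have hexp : ∀ w, HasSum (fun a => coord a w • basis a) w := by
    intro w
    refine Metric.tendsto_atTop.2 fun η hη => ?_
    obtain ⟨z, hz⟩ := hd.exists_dist_lt w (half_pos hη)
    rw [dist_eq_norm] at hz
    refine ⟨(z : ℕ →₀ ℝ).support, fun A hA => ?_⟩
    have h1 : ∑ a ∈ A, coord a (e z) • basis a = e z := by
      rw [hsum]
      congr 1
      have h2 : ∀ y : ℕ →₀ ℝ, y.support ⊆ A → y = ∑ a ∈ A, Finsupp.single a (y a) := fun y hy =>
        (Finsupp.sum_single y).symm.trans
          (Finsupp.sum_of_support_subset y hy Finsupp.single (by simp))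
      have h3 : z = ∑ a ∈ A, single K a (apply K a z) := h2 z hA
      have h4 : mul K (fun a => if a ∈ A then 1 else 0) (∑ a ∈ A, single K a (apply K a z)) =
          ∑ a ∈ A, single K a (apply K a z) := by
        rw [map_sum]
        refine Finset.sum_congr rfl fun a ha => ?_
        rw [mul_single, if_pos ha, one_smul]
      rw [← h3] at h4
      exact h4
    have h2 : ∑ a ∈ A, coord a w • basis a - w =
        ∑ a ∈ A, coord a (w - e z) • basis a - (w - e z) := by
      simp only [map_sub, sub_smul, Finset.sum_sub_distrib, h1]
      abel
    rw [dist_eq_norm, h2]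
    refine (norm_sub_le _ _).trans_lt ?_
    have := hbound A (w - e z)
    linarith
  refine ⟨⟨basis, coord, fun a b => ?_, hexp⟩, ?_⟩
  · rw [hortho]
    simp only [Pi.single, Function.update]
    split_ifs <;> simp_all
  · change (Submodule.span ℝ (Set.range coord)).topologicalClosure = ⊤
    have hs := h.isShrinking
    unfold IsShrinking at hs
    rw [eq_top_iff, ← hs]
    refine Submodule.topologicalClosure_mono (iSup_le fun a f hf => ?_)
    have h1 : f = f (basis a) • coord a := by
      ext w
      have h2 := (hexp w).mapL f
      have h3 : HasSum (fun b => f (coord b w • basis b)) (f (coord a w • basis a)) := by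
        refine hasSum_single a fun b hb => ?_
        rw [map_smul, IsTower.mem_biorth_iff.1 hf b hb (basis b) ⟨1, rfl⟩, smul_zero]
      rw [h2.unique h3, map_smul, smul_apply, smul_eq_mul, smul_eq_mul, mul_comm]
    rw [h1]
    exact Submodule.smul_mem _ _ (Submodule.subset_span ⟨a, rfl⟩)

end IsSignCompact

end SeqSpan

/-! ### Enumerated nets of the spaces of pieces. -/

section Nets

theorem exists_enumeration {V : Type*} [Zero V] (D : ℕ → Finset V) :
    ∃ (φ : ℕ → V) (blk : ℕ → ℕ), (∀ k, {a | blk a = k}.Finite) ∧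
      (∀ k, ∀ y ∈ D k, ∃ a, blk a = k ∧ φ a = y) ∧ ∀ a, φ a = 0 ∨ φ a ∈ D (blk a) := by
  -- An extra zero in every block makes the index set infinite even if the nets are empty, so that
  -- it can be enumerated by all of ℕ.
  have : Infinite (Σ k, Option (D k)) :=
    Infinite.of_injective (fun k => ⟨k, none⟩) fun k l hkl => congrArg Sigma.fst hkl
  obtain ⟨e⟩ : Nonempty ((Σ k, Option (D k)) ≃ ℕ) := nonempty_equiv_of_countable
  let val : (Σ k, Option (D k)) → V := fun i => i.2.elim 0 Subtype.val
  have hval : ∀ i, val i = 0 ∨ val i ∈ D i.1 := by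
    rintro ⟨k, _ | y⟩
    · exact Or.inl rfl
    · exact Or.inr y.2
  refine ⟨fun a => val (e.symm a), fun a => (e.symm a).1, fun k => ?_,
    fun k y hy => ⟨e ⟨k, some ⟨y, hy⟩⟩, by simp, ?_⟩, fun a => hval _⟩
  · refine (Set.finite_range fun o : Option (D k) => e ⟨k, o⟩).subset ?_
    rintro a rfl
    exact ⟨(e.symm a).2, by simp⟩
  · simp only [Equiv.symm_apply_apply]
    rfl

variable {X : Type*} [NormedAddCommGroup X] [NormedSpace ℝ X] {E : ℕ → Submodule ℝ X} {n : ℕ → ℕ}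

/-- The functionals with support strictly between `p` and `q`. -/
def suppIn (E : ℕ → Submodule ℝ X) (p q : ℕ) : Submodule ℝ (StrongDual ℝ X) where
  carrier := {f | dualSupp E f ⊆ Set.Ioo p q}
  zero_mem' := by
    rintro l ⟨x, -, hx⟩
    exact absurd rfl hx
  add_mem' := by
    rintro f g hf hg l ⟨x, hx, hfg⟩
    by_contra hl
    refine hfg ?_
    rw [add_apply, notMem_dualSupp.1 (fun h => hl (hf h)) x hx,
      notMem_dualSupp.1 (fun h => hl (hg h)) x hx, add_zero]
  smul_mem' := by
    rintro c f hf l ⟨x, hx, hcf⟩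
    refine hf ⟨x, hx, fun h0 => hcf ?_⟩
    rw [smul_apply, h0, smul_zero]

theorem apply_eq_zero_of_dualSupp {f : StrongDual ℝ X} {s : Set ℕ} (hf : dualSupp E f ⊆ s) {l : ℕ}
    (hl : l ∉ s) {x : X} (hx : x ∈ E l) : f x = 0 :=
  notMem_dualSupp.1 (fun h => hl (hf h)) x hx

/-- An enumeration, in finite blocks, of functionals that are zero or of norm one; the `k`-th block
contains a net of the unit sphere of `suppIn E p q` whenever `k ≤ p` and `q ≤ n (k + 2)`. -/
structure IsNet (E : ℕ → Submodule ℝ X) (n : ℕ → ℕ) (δ : ℕ → ℝ) (φ : ℕ → StrongDual ℝ X)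
    (blk : ℕ → ℕ) : Prop where
  finite : ∀ k, {a | blk a = k}.Finite
  norm_le : ∀ a, ‖φ a‖ ≤ 1
  vanish : ∀ a l, l ≤ blk a → ∀ x ∈ E l, φ a x = 0
  net : ∀ k p q, k ≤ p → q ≤ n (k + 2) → ∀ f ∈ suppIn E p q, f ≠ 0 →
    ∃ a, blk a = k ∧ ‖φ a‖ = 1 ∧ φ a ∈ suppIn E p q ∧ ‖f - ‖f‖ • φ a‖ ≤ δ k * ‖f‖

theorem IsBlockFMD.finiteDimensional_suppIn (h : IsBlockFMD E) (p q : ℕ) :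
    FiniteDimensional ℝ (suppIn E p q) := by
  have := h.isFMD.finiteDimensional
  have : FiniteDimensional ℝ (blockSum E p q) := by
    unfold blockSum
    rw [← Finset.sup_eq_iSup]
    infer_instance
  let T : suppIn E p q →ₗ[ℝ] Module.Dual ℝ (blockSum E p q) :=
    { toFun := fun f => f.1.toLinearMap ∘ₗ (blockSum E p q).subtype
      map_add' := fun _ _ => rfl
      map_smul' := fun _ _ => rfl }
  refine FiniteDimensional.of_injective T fun f g hfg => Subtype.ext (h.dual_ext fun l x hx => ?_)
  by_cases hl : l ∈ Set.Ioo p q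
  · exact LinearMap.congr_fun hfg ⟨x, le_blockSum E ⟨hl.1.le, hl.2.le⟩ hx⟩
  · rw [apply_eq_zero_of_dualSupp f.2 hl hx, apply_eq_zero_of_dualSupp g.2 hl hx]

theorem IsBlockFMD.exists_isNet (h : IsBlockFMD E) (n : ℕ → ℕ) {δ : ℕ → ℝ} (hδ : ∀ k, 0 < δ k) :
    ∃ φ blk, IsNet E n δ φ blk := by
  classical
  have := h.finiteDimensional_suppIn
  choose N hN1 hN2 using fun k p q => exists_finite_net (suppIn E p q) (hδ k)
  let D : ℕ → Finset (StrongDual ℝ X) := fun k =>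
    (Finset.Icc k (n (k + 2))).biUnion fun p => (Finset.range (n (k + 2) + 1)).biUnion (N k p)
  have hD : ∀ {k y}, y ∈ D k ↔ ∃ p q, (k ≤ p ∧ p ≤ n (k + 2)) ∧ q ≤ n (k + 2) ∧ y ∈ N k p q := by
    intro k y
    simp only [D, Finset.mem_biUnion, Finset.mem_Icc, Finset.mem_range, Nat.lt_succ_iff]
    constructor
    · rintro ⟨p, hp, q, hq, hy⟩
      exact ⟨p, q, hp, hq, hy⟩
    · rintro ⟨p, q, hp, hq, hy⟩
      exact ⟨p, hp, q, hq, hy⟩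
  obtain ⟨φ, blk, hfin, hnet, hφ⟩ := exists_enumeration D
  refine ⟨φ, blk, hfin, fun a => ?_, fun a l hl x hx => ?_, fun k p q hp hq f hf hf0 => ?_⟩
  · rcases hφ a with ha | ha
    · simp [ha]
    · obtain ⟨p, q, -, -, hy⟩ := hD.1 ha
      exact (hN1 _ _ _ _ hy).2.le
  · rcases hφ a with ha | ha
    · simp [ha]
    · obtain ⟨p, q, hp, -, hy⟩ := hD.1 ha
      refine apply_eq_zero_of_dualSupp (hN1 _ _ _ _ hy).1 (fun hl' => ?_) hx
      have := hl'.1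
      omega
  · have hp' : p ≤ n (k + 2) := by
      by_contra hp'
      refine hf0 (h.dual_ext fun l x hx => ?_)
      refine apply_eq_zero_of_dualSupp hf (fun hl => ?_) hx
      have := hl.1
      have := hl.2
      omega
    obtain ⟨y, hy, hfy⟩ := hN2 k p q f hf hf0
    obtain ⟨a, ha, rfl⟩ := hnet k y (hD.2 ⟨p, q, ⟨hp, hp'⟩, hq, hy⟩)
    exact ⟨a, ha, (hN1 _ _ _ _ hy).2, (hN1 _ _ _ _ hy).1, hfy⟩

end Nets

/-! ### Coding functionals by scalar sequences. -/

section Codes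

variable {X : Type*} [NormedAddCommGroup X] [NormedSpace ℝ X] {E : ℕ → Submodule ℝ X} {n : ℕ → ℕ}
  {δ : ℕ → ℝ} {φ : ℕ → StrongDual ℝ X} {blk : ℕ → ℕ}

/-- The indices of the `k`-th block. -/
def IsNet.block (hφ : IsNet E n δ φ blk) (k : ℕ) : Finset ℕ := (hφ.finite k).toFinset

theorem IsNet.mem_block (hφ : IsNet E n δ φ blk) {k a : ℕ} : a ∈ hφ.block k ↔ blk a = k := by
  simp [IsNet.block]

/-- The coefficients `c` have at most one non-zero term in each block, and the pieces of `g` between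
consecutive terms of `j` are the corresponding multiples of the functionals `φ a`. -/
structure IsCode (hφ : IsNet E n δ φ blk) (g : StrongDual ℝ X) (j : ℕ → ℕ) (c : ℕ → ℝ) :
    Prop where
  skip : IsSkip n j
  vanish : ∀ k, ∀ x ∈ E (j k), g x = 0
  eq_zero_or : ∀ a b, a ≠ b → blk a = blk b → c a = 0 ∨ c b = 0
  norm : ∀ a, c a ≠ 0 → ‖φ a‖ = 1
  supp : ∀ a, c a ≠ 0 → φ a ∈ suppIn E (j (blk a)) (j (blk a + 1))
  sum_eq : ∀ k l, j k < l → l < j (k + 1) → ∀ x ∈ E l, ∑ a ∈ hφ.block k, c a * φ a x = g x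

variable {hφ : IsNet E n δ φ blk} {g : StrongDual ℝ X} {j : ℕ → ℕ} {c : ℕ → ℝ}

namespace IsCode

theorem exists_sum_eq (hc : IsCode hφ g j c) (k : ℕ) :
    (∀ a ∈ hφ.block k, c a = 0) ∨
      ∃ a ∈ hφ.block k, c a ≠ 0 ∧ ∀ b ∈ hφ.block k, b ≠ a → c b = 0 := by
  by_cases h0 : ∀ a ∈ hφ.block k, c a = 0
  · exact Or.inl h0
  · push Not at h0
    obtain ⟨a, ha, hca⟩ := h0
    refine Or.inr ⟨a, ha, hca, fun b hb hba => ?_⟩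
    refine (hc.eq_zero_or b a hba ?_).resolve_right hca
    rw [hφ.mem_block.1 hb, hφ.mem_block.1 ha]

theorem sum_smul_eq (h : IsBlockFMD E) (hc : IsCode hφ g j c) (k : ℕ) :
    ∑ a ∈ hφ.block k, c a • φ a = h.cut g (j k) (j (k + 1)) := by
  refine h.eq_cut ?_ fun l h1 h2 x hx => ?_
  · refine Submodule.sum_mem (suppIn E (j k) (j (k + 1))) fun a ha => ?_
    by_cases hca : c a = 0
    · rw [hca, zero_smul]
      exact zero_mem _
    · refine Submodule.smul_mem _ _ ?_
      have := hc.supp a hca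
      rwa [hφ.mem_block.1 ha] at this
  · rw [sum_apply, ← hc.sum_eq k l h1 h2 x hx]
    rfl

theorem abs_le (h : IsBlockFMD E) (hc : IsCode hφ g j c) (a : ℕ) : |c a| ≤ 2.5 * ‖g‖ := by
  by_cases hca : c a = 0
  · rw [hca, abs_zero]
    positivity
  · have ha : a ∈ hφ.block (blk a) := hφ.mem_block.2 rfl
    have h1 : ∑ b ∈ hφ.block (blk a), c b • φ b = c a • φ a := by
      refine Finset.sum_eq_single_of_mem a ha fun b hb hba => ?_
      rw [(hc.eq_zero_or b a hba (hφ.mem_block.1 hb)).resolve_right hca, zero_smul]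
    have h2 := h.norm_cut_le_mul (hc.vanish (blk a)) (hc.vanish (blk a + 1))
    rwa [← hc.sum_smul_eq h, h1, norm_smul, hc.norm a hca, mul_one, Real.norm_eq_abs] at h2

/-- With at most one non-zero coefficient per block, sign changes of the coefficients are sign
changes of whole pieces, to which skipped unconditionality applies. -/
theorem exists_sign (h : IsBlockFMD E) (hc : IsCode hφ g j c) {σ : ℕ → ℝ}
    (hσ : ∀ a, σ a = 1 ∨ σ a = -1) : ∃ τ : ℕ → ℝ, (∀ k, τ k = 1 ∨ τ k = -1) ∧
      ∀ k, ∑ a ∈ hφ.block k, (σ * c) a • φ a = τ k • h.cut g (j k) (j (k + 1)) := by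
  have : ∀ k, ∃ t : ℝ, (t = 1 ∨ t = -1) ∧
      ∑ a ∈ hφ.block k, (σ * c) a • φ a = t • h.cut g (j k) (j (k + 1)) := by
    intro k
    rw [← hc.sum_smul_eq h]
    rcases hc.exists_sum_eq k with h0 | ⟨a, ha, -, h0⟩
    · refine ⟨1, Or.inl rfl, ?_⟩
      rw [one_smul]
      refine Finset.sum_congr rfl fun a ha => ?_
      rw [Pi.mul_apply, h0 a ha, mul_zero]
    · refine ⟨σ a, hσ a, ?_⟩
      rw [Finset.sum_eq_single_of_mem a ha, Finset.sum_eq_single_of_mem a ha, Pi.mul_apply,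
        mul_smul]
      · intro b hb hba
        rw [h0 b hb hba, zero_smul]
      · intro b hb hba
        rw [Pi.mul_apply, h0 b hb hba, mul_zero, zero_smul]
  choose τ hτ using this
  exact ⟨τ, fun k => (hτ k).1, fun k => (hτ k).2⟩

theorem tail (h : IsBlockFMD E) (hn : StrictMono n) (hn0 : n 0 = 0) (hc : IsCode hφ g j c) {η R : ℝ}
    (hη : 0 < η) (hR : 0 < R) : ∃ L g' c', ‖g'‖ ≤ R ∧ IsCode hφ g' j c' ∧
      ∀ a, L ≤ blk a → c a = η * c' a := by
  have hj := hc.skip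
  have hmono := hj.monotone hn0
  obtain ⟨L, hL⟩ := Metric.tendsto_atTop.1
    (h.tendsto_cut hmono (hj.le_apply hn0 hn) hc.vanish) (η * R) (mul_pos hη hR)
  -- The remainder of `g` beyond `j L` has norm at most ηR, so its multiple by 1/η is again within
  -- the bound, and its code is the tail of `c` divided by η.
  refine ⟨L, η⁻¹ • (g - h.cut g 0 (j L)), fun a => if blk a < L then 0 else η⁻¹ * c a, ?_,
    ⟨hj, fun k x hx => ?_, fun a b hab hblk => ?_, fun a ha => ?_, fun a ha => ?_,
      fun k l h1 h2 x hx => ?_⟩, fun a ha => ?_⟩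
  · have := (hL L le_rfl).le
    rw [dist_comm, dist_eq_norm] at this
    rwa [norm_smul, norm_inv, Real.norm_of_nonneg hη.le, inv_mul_le_iff₀ hη]
  · rw [smul_apply, sub_apply, hc.vanish k x hx, h.cut_zero_vanish hc.vanish L k x hx, sub_zero,
      smul_zero]
  · rw [hblk]
    split_ifs
    · exact Or.inl rfl
    · refine (hc.eq_zero_or a b hab hblk).imp (fun h0 => ?_) fun h0 => ?_ <;> rw [h0, mul_zero]
  · refine hc.norm a fun h0 => ha ?_
    simp [h0]
  · refine hc.supp a fun h0 => ha ?_
    simp [h0]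
  · have h3 : ∑ a ∈ hφ.block k, (if blk a < L then 0 else η⁻¹ * c a) * φ a x =
        if k < L then 0 else η⁻¹ * g x := by
      rw [← hc.sum_eq k l h1 h2 x hx]
      split_ifs with hk
      · refine Finset.sum_eq_zero fun a ha => ?_
        rw [hφ.mem_block.1 ha, if_pos hk, zero_mul]
      · rw [Finset.mul_sum]
        refine Finset.sum_congr rfl fun a ha => ?_
        rw [hφ.mem_block.1 ha, if_neg hk, mul_assoc]
    rw [h3, smul_apply, sub_apply, smul_eq_mul]
    split_ifs with hk
    · rw [h.cut_of_mem g (by omega) (h2.trans_le (hmono hk)) hx, sub_self, mul_zero]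
    · rw [h.cut_of_notMem g (fun hl => ?_) hx, sub_zero]
      have := hmono (not_lt.1 hk)
      omega
  · simp only [if_neg (not_lt.2 ha)]
    field_simp

end IsCode

/-- The triples `(g, j, c)` where `c` is a code for `(g, j)` and `‖g‖ ≤ R`. -/
def codes (hφ : IsNet E n δ φ blk) (R : ℝ) : Set ((WeakDual ℝ X × (ℕ → ℕ)) × (ℕ → ℝ)) :=
  {κ | ‖WeakDual.toStrongDual κ.1.1‖ ≤ R ∧ IsCode hφ (WeakDual.toStrongDual κ.1.1) κ.1.2 κ.2}

/-- Coefficients are bounded by 2.5R, being up to sign the norms of pieces. Each condition is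
closed: `j` takes discrete values, non-vanishing of a coefficient is open, and the sums over blocks
are finite. -/
theorem isCompact_codes (h : IsBlockFMD E) (hφ : IsNet E n δ φ blk) (R : ℝ) :
    IsCompact (codes hφ R) := by
  have h0 : IsCompact (skippedPairs E n R ×ˢ
      Set.univ.pi fun _ : ℕ => Set.Icc (-(2.5 * R)) (2.5 * R)) :=
    (isCompact_skippedPairs R).prod (isCompact_univ_pi fun _ => isCompact_Icc)
  have hg : ∀ x : X, Continuous fun κ : (WeakDual ℝ X × (ℕ → ℕ)) × (ℕ → ℝ) => κ.1.1 x := fun x =>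
    (WeakDual.eval_continuous x).comp (continuous_fst.comp continuous_fst)
  have hj : ∀ k, Continuous fun κ : (WeakDual ℝ X × (ℕ → ℕ)) × (ℕ → ℝ) => κ.1.2 k := fun k =>
    (continuous_apply k).comp (continuous_snd.comp continuous_fst)
  have hc : ∀ a, Continuous fun κ : (WeakDual ℝ X × (ℕ → ℕ)) × (ℕ → ℝ) => κ.2 a := fun a =>
    (continuous_apply a).comp continuous_snd
  have hc0 : ∀ a, IsOpen {κ : (WeakDual ℝ X × (ℕ → ℕ)) × (ℕ → ℝ) | κ.2 a ≠ 0} := fun a =>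
    isOpen_ne_fun (hc a) continuous_const
  have h1 : IsClosed {κ : (WeakDual ℝ X × (ℕ → ℕ)) × (ℕ → ℝ) |
      ∀ a b, a ≠ b → blk a = blk b → κ.2 a = 0 ∨ κ.2 b = 0} := by
    simp only [Set.ofPred_forall]
    exact isClosed_iInter fun a => isClosed_iInter fun b => isClosed_iInter fun _ =>
      isClosed_iInter fun _ => (isClosed_eq (hc a) continuous_const).union
        (isClosed_eq (hc b) continuous_const)
  have h2 : IsClosed {κ : (WeakDual ℝ X × (ℕ → ℕ)) × (ℕ → ℝ) |
      ∀ a, κ.2 a ≠ 0 → ‖φ a‖ = 1} := by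
    simp only [Set.ofPred_forall]
    exact isClosed_iInter fun a => isClosed_imp (hc0 a) isClosed_const
  have h3 : IsClosed {κ : (WeakDual ℝ X × (ℕ → ℕ)) × (ℕ → ℝ) |
      ∀ a, κ.2 a ≠ 0 → φ a ∈ suppIn E (κ.1.2 (blk a)) (κ.1.2 (blk a + 1))} := by
    simp only [Set.ofPred_forall]
    refine isClosed_iInter fun a => isClosed_imp (hc0 a) ?_
    exact (isClosed_discrete {p : ℕ × ℕ | φ a ∈ suppIn E p.1 p.2}).preimage
      ((hj (blk a)).prodMk (hj (blk a + 1)))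
  have h4 : IsClosed {κ : (WeakDual ℝ X × (ℕ → ℕ)) × (ℕ → ℝ) |
      ∀ k l, κ.1.2 k < l → l < κ.1.2 (k + 1) → ∀ x ∈ E l,
        ∑ a ∈ hφ.block k, κ.2 a * φ a x = κ.1.1 x} := by
    simp only [Set.ofPred_forall]
    refine isClosed_iInter fun k => isClosed_iInter fun l => ?_
    have h5 : IsClosed {κ : (WeakDual ℝ X × (ℕ → ℕ)) × (ℕ → ℝ) |
        κ.1.2 k < l → l < κ.1.2 (k + 1) → ∀ x ∈ E l,
          ∑ a ∈ hφ.block k, κ.2 a * φ a x = κ.1.1 x} := by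
      refine isClosed_imp ((isOpen_discrete (Set.Iio l)).preimage (hj k))
        (isClosed_imp ((isOpen_discrete (Set.Ioi l)).preimage (hj (k + 1))) ?_)
      simp only [Set.ofPred_forall]
      exact isClosed_iInter fun x => isClosed_iInter fun _ => isClosed_eq
        (continuous_finsetSum _ fun a _ => (hc a).mul continuous_const) (hg x)
    simpa only [Set.ofPred_forall] using h5
  have hK := h0.inter_right (h1.inter (h2.inter (h3.inter h4)))
  convert hK using 1
  refine Set.Subset.antisymm ?_ ?_
  · rintro ⟨⟨g, j⟩, c⟩ ⟨a1, a2⟩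
    refine ⟨⟨⟨a1, a2.skip, a2.vanish⟩, fun a _ => ?_⟩, a2.eq_zero_or, a2.norm, a2.supp, a2.sum_eq⟩
    have h5 := (a2.abs_le h a).trans (mul_le_mul_of_nonneg_left a1 (by norm_num))
    exact abs_le.1 h5
  · rintro ⟨⟨g, j⟩, c⟩ ⟨⟨⟨a1, a2, a3⟩, -⟩, b1, b2, b3, b4⟩
    exact ⟨a1, a2, a3, b1, b2, b3, b4⟩

end Codes

/-! ### The embedding into a space with a shrinking unconditional basis. -/

section BasisEmbedding

variable {X : Type*} [NormedAddCommGroup X] [NormedSpace ℝ X] {E : ℕ → Submodule ℝ X} {n : ℕ → ℕ}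
  {δ : ℕ → ℝ} {φ : ℕ → StrongDual ℝ X} {blk : ℕ → ℕ}

/-- Every piece of `g`, of norm at most 2.5·21/20 ≤ 3, is replaced by its norm times a net member
with support in the same gap. The errors sum to at most 3∑δ, and `g'` is `g` minus all errors. -/
theorem IsBlockFMD.exists_isCode (h : IsBlockFMD E) (hn : StrictMono n) (hn0 : n 0 = 0)
    (hφ : IsNet E n δ φ blk) (hδ : Summable δ) (hδ0 : ∀ k, 0 ≤ δ k) (hδ1 : 3 * ∑' k, δ k ≤ 1 / 20)
    {j : ℕ → ℕ} (hj : IsSkip n j) {g : StrongDual ℝ X} (hg : ∀ k, ∀ x ∈ E (j k), g x = 0)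
    (hg1 : ‖g‖ ≤ 21 / 20) : ∃ g' c, ‖g - g'‖ ≤ 1 / 20 ∧ IsCode hφ g' j c := by
  let f : ℕ → StrongDual ℝ X := fun k => h.cut g (j k) (j (k + 1))
  have hf3 : ∀ k, ‖f k‖ ≤ 3 := fun k =>
    (h.norm_cut_le_mul (hg k) (hg (k + 1))).trans (by linarith)
  have hfs : ∀ k, f k ∈ suppIn E (j k) (j (k + 1)) := fun k => h.dualSupp_cut g _ _
  have hA : ∀ k, ∃ a, f k ≠ 0 → blk a = k ∧ ‖φ a‖ = 1 ∧ φ a ∈ suppIn E (j k) (j (k + 1)) ∧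
      ‖f k - ‖f k‖ • φ a‖ ≤ δ k * ‖f k‖ := by
    intro k
    by_cases hk : f k = 0
    · exact ⟨0, fun h0 => absurd hk h0⟩
    · obtain ⟨a, ha⟩ := hφ.net k _ _ (hj.le_apply hn0 hn k) (hj.bounds hn0 (k + 1)).2 (f k)
        (hfs k) hk
      exact ⟨a, fun _ => ha⟩
  choose A hA using hA
  let r : ℕ → StrongDual ℝ X := fun k => f k - ‖f k‖ • φ (A k)
  have hr : ∀ k, ‖r k‖ ≤ 3 * δ k := by
    intro k
    by_cases hk : f k = 0
    · simp only [r, hk, norm_zero, zero_smul, sub_self]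
      have := hδ0 k
      positivity
    · refine (hA k hk).2.2.2.trans ?_
      rw [mul_comm]
      exact mul_le_mul_of_nonneg_right (hf3 k) (hδ0 k)
  have hrs : ∀ k, r k ∈ suppIn E (j k) (j (k + 1)) := by
    intro k
    refine Submodule.sub_mem _ (hfs k) ?_
    by_cases hk : f k = 0
    · rw [hk, norm_zero, zero_smul]
      exact zero_mem _
    · exact Submodule.smul_mem _ _ (hA k hk).2.2.1
  have hsum : Summable r := Summable.of_norm_bounded (hδ.mul_left 3) hr
  have he : ∀ x : X, HasSum (fun k => r k x) ((∑' k, r k) x) := fun x =>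
    hsum.hasSum.mapL (ContinuousLinearMap.apply ℝ ℝ x)
  have hmono := hj.monotone hn0
  let c : ℕ → ℝ := fun a => if a = A (blk a) then ‖f (blk a)‖ else 0
  have hc : ∀ a, c a ≠ 0 → a = A (blk a) ∧ f (blk a) ≠ 0 := by
    intro a ha
    simp only [c] at ha
    split_ifs at ha with h1
    · exact ⟨h1, norm_ne_zero_iff.1 ha⟩
    · exact absurd rfl ha
  refine ⟨g - ∑' k, r k, c, ?_, hj, fun m x hx => ?_, fun a b hab hblk => ?_, fun a ha => ?_,
    fun a ha => ?_, fun k l h1 h2 x hx => ?_⟩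
  · rw [sub_sub_cancel]
    refine (tsum_of_norm_bounded (hδ.mul_left 3).hasSum hr).trans ?_
    rwa [tsum_mul_left]
  · rw [sub_apply, hg m x hx, zero_sub, neg_eq_zero]
    refine (he x).unique ?_
    convert hasSum_zero using 2 with k
    refine apply_eq_zero_of_dualSupp (hrs k) (fun hm => ?_) hx
    rcases Nat.lt_or_ge k m with hk | hk
    · have : j (k + 1) ≤ j m := hmono hk
      have := hm.2
      omega
    · have := hmono hk
      have := hm.1
      omega
  · by_contra! h0
    have h1 := (hc a h0.1).1
    have h2 := (hc b h0.2).1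
    rw [hblk] at h1
    exact hab (h1.trans h2.symm)
  · obtain ⟨h1, h2⟩ := hc a ha
    rw [h1]
    exact (hA _ h2).2.1
  · obtain ⟨h1, h2⟩ := hc a ha
    have h3 := (hA _ h2).2.2.1
    rwa [← h1] at h3
  · have h3 : (∑' k, r k) x = r k x := by
      refine (he x).unique (hasSum_single k fun m hm => ?_)
      refine apply_eq_zero_of_dualSupp (hrs m) (fun hl => ?_) hx
      rcases lt_or_gt_of_ne hm with hlt | hlt
      · have : j (m + 1) ≤ j k := hmono hlt
        have := hl.2
        omega
      · have : j (k + 1) ≤ j m := hmono hlt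
        have := hl.1
        omega
    have h4 : f k x = g x := h.cut_of_mem g h1 h2 hx
    rw [sub_apply, h3, ← h4]
    simp only [r, sub_apply, smul_apply, smul_eq_mul, sub_sub_cancel]
    by_cases hk : f k = 0
    · rw [hk, norm_zero, zero_mul]
      refine Finset.sum_eq_zero fun a ha => ?_
      have : c a = 0 := by
        by_contra h0
        have := (hc a h0).2
        rw [hφ.mem_block.1 ha] at this
        exact this hk
      rw [this, zero_mul]
    · have hblk := (hA k hk).1
      rw [Finset.sum_eq_single_of_mem (A k) (hφ.mem_block.2 hblk)]
      · simp only [c, hblk, if_true]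
      · intro a ha haA
        have : c a = 0 := by
          by_contra h0
          have := (hc a h0).1
          rw [hφ.mem_block.1 ha] at this
          exact haA this
        rw [this, zero_mul]

/-- The sequences with at most one non-zero term, of absolute value at most one. -/
def unitMultiples : Set (ℕ → ℝ) := {q | (∀ a, |q a| ≤ 1) ∧ ∀ a b, a ≠ b → q a = 0 ∨ q b = 0}

/-- The codes of the functionals of norm at most `R`, up to changes of signs, together with the
multiples of the unit vectors. -/
def codeSet (hφ : IsNet E n δ φ blk) (R : ℝ) : Set (ℕ → ℝ) :=
  {c' | ∃ σ : ℕ → ℝ, (∀ a, σ a = 1 ∨ σ a = -1) ∧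
    ∃ g j c, ‖g‖ ≤ R ∧ IsCode hφ g j c ∧ c' = σ * c} ∪ unitMultiples

/-- Sign changes are adjoined by hand, as a compact factor, because a signed code may belong to a
functional of norm larger than `R`. The unit multiples are there to bound the coordinate
functionals. -/
theorem isSignCompact_codeSet (h : IsBlockFMD E) (hn : StrictMono n) (hn0 : n 0 = 0)
    (hφ : IsNet E n δ φ blk) {R : ℝ} (hR : 0 < R) : IsSignCompact (codeSet hφ R) where
  isCompact := by
    refine IsCompact.union ?_ ?_
    · have h1 : IsCompact (Set.univ.pi fun _ : ℕ => ({1, -1} : Set ℝ)) :=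
        isCompact_univ_pi fun _ => (Set.toFinite _).isCompact
      have h2 := (h1.prod (isCompact_codes h hφ R)).image
        (f := fun p : (ℕ → ℝ) × ((WeakDual ℝ X × (ℕ → ℕ)) × (ℕ → ℝ)) => p.1 * p.2.2)
        (continuous_fst.mul (continuous_snd.comp continuous_snd))
      convert h2 using 1
      ext c'
      constructor
      · rintro ⟨σ, hσ, g, j, c, hg, hc, rfl⟩
        exact ⟨(σ, ((StrongDual.toWeakDual g, j), c)), ⟨fun a _ => by simpa using hσ a, hg, hc⟩, rfl⟩
      · rintro ⟨⟨σ, ⟨g, j⟩, c⟩, ⟨hσ, hg, hc⟩, rfl⟩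
        exact ⟨σ, fun a => by simpa using hσ a trivial, _, j, c, hg, hc, rfl⟩
    · refine (isCompact_univ_pi fun _ : ℕ => isCompact_Icc (a := (-1 : ℝ)) (b := 1)).of_isClosed_subset
        ?_ fun q hq a _ => abs_le.1 (hq.1 a)
      have h1 : (unitMultiples : Set (ℕ → ℝ)) = {q | ∀ a, |q a| ≤ 1} ∩
          {q | ∀ a b, a ≠ b → q a = 0 ∨ q b = 0} := rfl
      rw [h1]
      simp only [Set.ofPred_forall]
      refine (isClosed_iInter fun a => ?_).inter (isClosed_iInter fun a => isClosed_iInter fun b =>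
        isClosed_iInter fun _ => ?_)
      · exact isClosed_le (continuous_apply a).abs continuous_const
      · exact (isClosed_eq (continuous_apply a) continuous_const).union
          (isClosed_eq (continuous_apply b) continuous_const)
  sign_mul := by
    rintro _ (⟨σ, hσ, g, j, c, hg, hc, rfl⟩ | hq) σ' hσ'
    · refine Or.inl ⟨σ' * σ, fun a => ?_, g, j, c, hg, hc, (mul_assoc _ _ _).symm⟩
      rw [Pi.mul_apply]
      rcases hσ a with h1 | h1 <;> rcases hσ' a with h2 | h2 <;> rw [h1, h2] <;> norm_num
    · refine Or.inr ⟨fun a => ?_, fun a b hab => ?_⟩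
      · rw [Pi.mul_apply, abs_mul]
        rcases hσ' a with h2 | h2 <;> rw [h2] <;> simpa using hq.1 a
      · refine (hq.2 a b hab).imp (fun h0 => ?_) fun h0 => ?_ <;> rw [Pi.mul_apply, h0, mul_zero]
  single_mem a := by
    refine Or.inr ⟨fun b => ?_, fun b b' hb => ?_⟩
    · rw [Pi.single_apply]
      split_ifs <;> simp
    · rcases eq_or_ne b a with rfl | hba
      · exact Or.inr (Pi.single_eq_of_ne hb.symm _)
      · exact Or.inl (Pi.single_eq_of_ne hba _)
  tail := by
    rintro _ (⟨σ, hσ, g, j, c, hg, hc, rfl⟩ | hq) η hη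
    · obtain ⟨L, g', c', hg', hc', hcc⟩ := hc.tail h hn hn0 hη hR
      refine ⟨(Finset.range L).biUnion hφ.block, σ * c', Or.inl ⟨σ, hσ, g', j, c', hg', hc', rfl⟩,
        fun a ha => ?_⟩
      have hL : L ≤ blk a := by
        by_contra hL
        exact ha (Finset.mem_biUnion.2 ⟨blk a, Finset.mem_range.2 (not_le.1 hL),
          hφ.mem_block.2 rfl⟩)
      rw [Pi.mul_apply, Pi.mul_apply, hcc a hL]
      ring
    · have h0 : (0 : ℕ → ℝ) ∈ codeSet hφ R := Or.inr ⟨by simp, by simp⟩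
      rename_i q
      by_cases hq0 : ∃ a, q a ≠ 0
      · obtain ⟨a, ha⟩ := hq0
        refine ⟨{a}, 0, h0, fun b hb => ?_⟩
        rw [Pi.zero_apply, mul_zero]
        exact (hq.2 b a (by simpa using hb)).resolve_right ha
      · push Not at hq0
        exact ⟨∅, 0, h0, fun b _ => by rw [Pi.zero_apply, mul_zero, hq0 b]⟩

/-- The map `u ↦ (φ a (∑ u))` on finitely supported sequences. -/
def codeHom (hφ : IsNet E n δ φ blk) (K : Set (ℕ → ℝ)) : (Π₀ l, E l) →ₗ[ℝ] SeqSpan K :=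
  DFinsupp.lsum ℕ fun l => ∑ k ∈ Finset.range l, ∑ a ∈ hφ.block k,
    SeqSpan.single K a ∘ₗ (φ a).toLinearMap ∘ₗ (E l).subtype

/-- Functionals of block k vanish on `E l` for l ≤ k, so the finite sum over k < l in `codeHom` is
the full series at a vector of `E l`. -/
theorem pairing_codeHom (hφ : IsNet E n δ φ blk) (K : Set (ℕ → ℝ)) {c : ℕ → ℝ}
    {g : StrongDual ℝ X} (hg : SeriesTendsto (fun k => ∑ a ∈ hφ.block k, c a • φ a) g)
    (u : Π₀ l, E l) : SeqSpan.pairing K c (codeHom hφ K u) = g (sumHom E u) := by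
  have : SeqSpan.pairing K c ∘ₗ codeHom hφ K = g.toLinearMap ∘ₗ sumHom E := by
    refine DFinsupp.lhom_ext' fun l => LinearMap.ext fun x => ?_
    have h1 : codeHom hφ K (DFinsupp.single l x) = ∑ k ∈ Finset.range l, ∑ a ∈ hφ.block k,
        SeqSpan.single K a (φ a x) := by
      refine (DFinsupp.lsum_single _ _ _ _).trans ?_
      simp only [LinearMap.sum_apply]
      rfl
    have h2 : Tendsto (fun N => ∑ k ∈ Finset.range N, ∑ a ∈ hφ.block k, c a * φ a x) atTop
        (𝓝 (g x)) := by
      refine (((ContinuousLinearMap.apply ℝ ℝ (x : X)).continuous.tendsto g).comp hg).congr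
        fun N => ?_
      simp only [Function.comp_apply, map_sum, map_smul, ContinuousLinearMap.apply_apply,
        smul_eq_mul]
    have h3 : ∀ N, l ≤ N → ∑ k ∈ Finset.range N, ∑ a ∈ hφ.block k, c a * φ a x =
        ∑ k ∈ Finset.range l, ∑ a ∈ hφ.block k, c a * φ a x := by
      intro N hN
      refine (Finset.sum_subset (Finset.range_mono hN) fun k _ hk => ?_).symm
      refine Finset.sum_eq_zero fun a ha => ?_
      have := hφ.mem_block.1 ha
      rw [hφ.vanish a l (by simpa [this] using hk) x x.2, mul_zero]
    have h4 : g x = ∑ k ∈ Finset.range l, ∑ a ∈ hφ.block k, c a * φ a x :=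
      tendsto_nhds_unique h2 (tendsto_const_nhds.congr' (by
        filter_upwards [eventually_ge_atTop l] with N hN using (h3 N hN).symm))
    simp only [LinearMap.comp_apply, DFinsupp.lsingle_apply, h1, sumHom_single, map_sum,
      SeqSpan.pairing_single]
    refine Eq.trans ?_ h4.symm
    exact Finset.sum_congr rfl fun k _ => Finset.sum_congr rfl fun a _ => mul_comm _ _
  exact LinearMap.congr_fun this u

theorem IsCode.seriesTendsto (h : IsBlockFMD E) (hn : StrictMono n) (hn0 : n 0 = 0)
    {hφ : IsNet E n δ φ blk} {g : StrongDual ℝ X} {j : ℕ → ℕ} {c : ℕ → ℝ} (hc : IsCode hφ g j c) :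
    SeriesTendsto (fun k => ∑ a ∈ hφ.block k, c a • φ a) g := by
  simp only [hc.sum_smul_eq h]
  exact h.seriesTendsto_cut (hc.skip.monotone hn0) hc.skip.zero (hc.skip.le_apply hn0 hn) hc.vanish

theorem IsBlockFMD.abs_pairing_codeHom_le (h : IsBlockFMD E) (hn : StrictMono n) (hn0 : n 0 = 0)
    {C : ℝ} (hC : SkippedUnconditional E C) (hφ : IsNet E n δ φ blk) (K : Set (ℕ → ℝ)) {R : ℝ}
    (hR : 0 < R) {c : ℕ → ℝ} (hc : c ∈ codeSet hφ R) (u : Π₀ l, E l) :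
    |SeqSpan.pairing K c (codeHom hφ K u)| ≤ (|C| * R + 1) * ‖sumHom E u‖ := by
  have hCR : 0 ≤ |C| * R := by positivity
  suffices ∃ g, SeriesTendsto (fun k => ∑ a ∈ hφ.block k, c a • φ a) g ∧ ‖g‖ ≤ |C| * R + 1 by
    obtain ⟨g, hg, hgC⟩ := this
    rw [pairing_codeHom hφ K hg]
    exact g.le_of_opNorm_le hgC _
  rcases hc with ⟨σ, hσ, g, j, c, hg, hc, rfl⟩ | hq
  · obtain ⟨τ, hτ, hsum⟩ := hc.exists_sign h hσ
    have hj := hc.skip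
    have hmono := hj.monotone hn0
    have hle := hj.le_apply hn0 hn
    obtain ⟨g', hg', hgC⟩ := hC.exists_seriesTendsto hmono hle (fun k => h.dualSupp_cut g _ _)
      (h.seriesTendsto_cut hmono hj.zero hle hc.vanish) hτ
    refine ⟨g', by simpa only [hsum] using hg', hgC.trans ?_⟩
    have h1 : C * ‖g‖ ≤ |C| * ‖g‖ := mul_le_mul_of_nonneg_right (le_abs_self C) (norm_nonneg g)
    have h2 : |C| * ‖g‖ ≤ |C| * R := mul_le_mul_of_nonneg_left hg (abs_nonneg C)
    linarith
  · by_cases hq0 : ∃ a, c a ≠ 0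
    · obtain ⟨a, ha⟩ := hq0
      have h1 : ∀ b, b ≠ a → c b = 0 := fun b hb => (hq.2 b a hb).resolve_right ha
      refine ⟨c a • φ a, ?_, ?_⟩
      · refine HasSum.tendsto_sum_nat ?_
        have h2 : ∑ b ∈ hφ.block (blk a), c b • φ b = c a • φ a :=
          Finset.sum_eq_single_of_mem a (hφ.mem_block.2 rfl) fun b _ hb => by
            rw [h1 b hb, zero_smul]
        rw [← h2]
        refine hasSum_single (blk a) fun k hk => Finset.sum_eq_zero fun b hb => ?_
        rw [h1 b fun hba => hk ?_, zero_smul]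
        rw [← hba, hφ.mem_block.1 hb]
      · rw [norm_smul, Real.norm_eq_abs]
        have h2 : |c a| * ‖φ a‖ ≤ 1 := mul_le_one₀ (hq.1 a) (norm_nonneg _) (hφ.norm_le a)
        linarith
    · push Not at hq0
      refine ⟨0, ?_, ?_⟩
      · simp only [hq0, zero_smul, Finset.sum_const_zero, SeriesTendsto]
        exact tendsto_const_nhds
      · rw [norm_zero]
        positivity

theorem IsBlockFMD.exists_basis_embedding (h : IsBlockFMD E) {C : ℝ}
    (hC : SkippedUnconditional E C) :
    ∃ (W : Type) (_ : NormedAddCommGroup W) (_ : NormedSpace ℝ W) (_ : CompleteSpace W)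
      (b : UnconditionalSchauderBasis ℕ ℝ W) (T : X →L[ℝ] W),
      (Submodule.span ℝ (Set.range b.coord)).topologicalClosure = ⊤ ∧
      ∃ c : ℝ, 0 < c ∧ ∀ x, c * ‖x‖ ≤ ‖T x‖ := by
  -- The sum is 1/60: below 1/50 as admissibility requires, and three times it is 1/20 for the
  -- coding error. The same sequence is used for both; the two errors leave the lower bound 1 - 1/20
  -- - 1/20 = 9/10.
  let ε : ℕ → ℝ := fun k => 1 / 120 * (1 / 2) ^ k
  have hε0 : ∀ k, 0 < ε k := fun k => by positivity
  have hεs : Summable ε := summable_geometric_two.mul_left _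
  have hεt : ∑' k, ε k = 1 / 60 := by
    rw [tsum_mul_left, tsum_geometric_two]
    norm_num
  obtain ⟨n, hn⟩ := h.exists_admissible hε0
  have hm := hn.strictMono
  have hn0 := hn.zero
  obtain ⟨φ, blk, hφ⟩ := h.exists_isNet n hε0
  have hR : (0 : ℝ) < 2 := by norm_num
  let K := codeSet hφ 2
  have hK : IsSignCompact K := isSignCompact_codeSet h hm hn0 hφ hR
  obtain ⟨b, hb⟩ := hK.exists_basis
  let L : (Π₀ l, E l) →ₗ[ℝ] UniformSpace.Completion (SeqSpan K) :=
    (UniformSpace.Completion.toComplₗᵢ (𝕜 := ℝ) (E := SeqSpan K)).toLinearMap ∘ₗ codeHom hφ K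
  have hL : ∀ u, ‖L u‖ = ‖codeHom hφ K u‖ := fun u => UniformSpace.Completion.norm_coe _
  have hbd : ∀ u, ‖L u‖ ≤ (|C| * 2 + 1) * ‖sumHom E u‖ := fun u => by
    rw [hL]
    exact hK.norm_le fun c hc => h.abs_pairing_codeHom_le hm hn0 hC hφ K hR hc u
  refine ⟨_, inferInstance, inferInstance, inferInstance, b, L.extendOfNorm (sumHom E), hb,
    9 / 10, by norm_num, fun x => ?_⟩
  refine h.denseRange_sumHom.induction_on x (isClosed_le (by fun_prop) (by fun_prop)) fun u => ?_
  rw [LinearMap.extendOfNorm_eq h.denseRange_sumHom ⟨_, hbd⟩ u, hL]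
  obtain ⟨f, hf1, hfx⟩ := exists_dual_vector'' ℝ (sumHom E u)
  obtain ⟨g, hfg, hg⟩ := h.exists_skipped_near hε0 hεs (by rw [hεt]; norm_num) hn f hf1
  have hg1 : ‖g‖ ≤ 21 / 20 := by
    rw [← sub_sub_cancel f g]
    refine (norm_sub_le _ _).trans ?_
    linarith
  obtain ⟨j, hj, hgj⟩ := exists_isSkip_of_forall hg h.zero
  obtain ⟨g', c, hgg', hc⟩ := h.exists_isCode hm hn0 hφ hεs (fun k => (hε0 k).le)
    (by rw [hεt]; norm_num) hj hgj hg1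
  have hg2 : ‖g'‖ ≤ 2 := by
    rw [← sub_sub_cancel g g']
    refine (norm_sub_le _ _).trans ?_
    linarith
  have hcK : c ∈ K :=
    Or.inl ⟨1, fun _ => Or.inl rfl, g', j, c, hg2, hc, (one_mul c).symm⟩
  refine le_trans ?_ (hK.abs_pairing_le hcK _)
  rw [pairing_codeHom hφ K (hc.seriesTendsto h hm hn0)]
  have h1 : g' (sumHom E u) = ‖sumHom E u‖ - (f - g) (sumHom E u) - (g - g') (sumHom E u) := by
    rw [sub_apply, sub_apply, hfx, RCLike.ofReal_real_eq_id, id]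
    ring
  have h2 := (f - g).le_of_opNorm_le hfg (sumHom E u)
  have h3 := (g - g').le_of_opNorm_le hgg' (sumHom E u)
  rw [Real.norm_eq_abs] at h2 h3
  have h4 := le_abs_self ((f - g) (sumHom E u))
  have h5 := le_abs_self ((g - g') (sumHom E u))
  refine le_trans ?_ (le_abs_self _)
  rw [h1]
  linarith

end BasisEmbedding

end FMD

end

theorem mainTheorem6 {X : Type*} [NormedAddCommGroup X] [NormedSpace ℝ X] [CompleteSpace X]
    [TopologicalSpace.SeparableSpace (StrongDual ℝ X)] (hX : FMD.WeakStarUTP X) :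
    (∃ E : ℕ → Submodule ℝ X, E 0 = ⊥ ∧ FMD.IsFMD E ∧ FMD.IsShrinking E ∧ FMD.BlockEstimates E ∧
      ∀ ε : ℕ → ℝ, Antitone ε → (∀ k, 0 < ε k ∧ ε k < 1) → Summable ε → ∑' k, ε k < 1 / 50 →
        (∃ n : ℕ → ℕ, FMD.Admissible E ε n) ∧
        ∀ n : ℕ → ℕ, FMD.Admissible E ε n →
          FMD.IsFDD (FMD.ZDecomp E n) ∧ FMD.IsShrinking (FMD.ZDecomp E n) ∧
          FMD.IsUnconditional (FMD.ZDecomp E n) ∧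
          ∃ J : X →L[ℝ] FMD.ZSpace E n,
            (∀ (j : ℕ) (x : E j), J x = (FMD.diag E n j x : FMD.ZSpace E n)) ∧
            (∀ x, IsLUB {r : ℝ | ∃ f ∈ FMD.skippedBall E n, r = |f x|} ‖J x‖) ∧
            ∃ c : ℝ, 0 < c ∧ ∀ x, c * ‖x‖ ≤ ‖J x‖) ∧
    ∃ (W : Type) (_ : NormedAddCommGroup W) (_ : NormedSpace ℝ W) (_ : CompleteSpace W)
      (b : UnconditionalSchauderBasis ℕ ℝ W) (T : X →L[ℝ] W),
      (Submodule.span ℝ (Set.range b.coord)).topologicalClosure = ⊤ ∧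
      ∃ c : ℝ, 0 < c ∧ ∀ x, c * ‖x‖ ≤ ‖T x‖ := by
  obtain ⟨A, B, hAB, C, -, hC⟩ := FMD.exists_skippedUnconditional hX
  have h := hAB.isBlockFMD
  refine ⟨⟨_, h.zero, h.isFMD, h.isShrinking, h.blockEstimates, fun ε _ hε hεs hεt =>
    ⟨h.exists_admissible fun k => (hε k).1, fun n hn => ?_⟩⟩, h.exists_basis_embedding hC⟩
  have hZ := h.isFDD_isShrinking_ZDecomp hn.strictMono hn.zero
  exact ⟨hZ.1, hZ.2, h.isUnconditional_ZDecomp hn.strictMono hn.zero hC,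
    h.exists_embedding (fun k => (hε k).1) hεs hεt hn⟩
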